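/- **Notation.** Let $\widehat u(\xi,\tau)$ denote the Fourier transform of $u(x,t)$ on $\mathbb R^2$, with kernel $e^{-i(x\xi+t\tau)}$. Fix $\phi\in\mathcal S(\mathbb R)$ with $\widehat\phi=1$ for $|\xi|\le 1$ and $\widehat\phi=0$ for $|\xi|>2$. Put $\psi_{-1}=\widehat\phi$ and $\psi_j(\xi)=\widehat\phi(2^{-j-1}\xi)-\widehat\phi(2^{-j}\xi)$ for $j\ge 0$. For integers $j,k\ge -1$, let $\Delta_j$ be the Fourier multiplier with symbol $\psi_j(\xi)$, let $S_{j-1}=\sum_{-1\le j'\le j-2}\Delta_{j'}$, and let $\Delta_{jk}$ be the Fourier multiplier with symbol $\psi_j(\xi)\,\psi_k(\tau-\xi|\xi|)$. Let $P^\pm$ be the Fourier multiplier with symbol $\mathbf 1_{\{\pm\xi\ge 0\}}$. For $s,b\in\mathbb R$ and $1\le q\le\infty$, the space $X^{s,b,q}$ consists of the tempered distributions $u$ on $\mathbb R^2$ whose Fourier transform is a function and for which $$\|u\|_{X^{s,b,q}}=\Big\|\big(2^{js+kb}\|\Delta_{jk}u\|_{L^2(\mathbb R^2)}\big)_{j,k\ge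 -1}\Big\|_{\ell^q}<\infty .$$ Let $$T_vu=\sum_{j\ge -1}S_{j-1}v\,\Delta_ju,\qquad R(v,u)=\sum_{j,j'\ge -1,\ |j-j'|\le 1}\Delta_jv\,\Delta_{j'}u .$$ The expressions $P^+(T_{P^\pm v}P^+u)$ and $\partial_xP^+R(P^\pm v,P^+u)$ denote the sums in $\mathcal S'(\mathbb R^2)$ of the series obtained by applying $P^+$, respectively $\partial_xP^+$, to the individual terms. The norm of a sum of spaces $X_1+X_2$ is the infimum of $\|w_1\|_{X_1}+\|w_2\|_{X_2}$ over decompositions $w=w_1+w_2$ with $w_i\in X_i$. **Proposition.** For either choice of the sign $\pm$, the following hold. In each case the series converges in $\mathcal S'(\mathbb R^2)$, and the norm of the output is bounded by a constant, depending only on $\phi$ and the exponents $s,s',b$, times the product of the norms of $u$ and $v$ in the stated spaces (for an intersection, the sum of the two norms). 1. If $s+s'\ge-\frac12$, $u\in X^{s,\frac12,1}$ and $v\in X^{s',\frac12,1}$, then $\partial_xP^+R(P^\pm v,P^+u)\in X^{s+s',-\frac12,1}$. 2. If $s>\frac14$, $b>\frac12$, $u\in X^{s,b,2}$ and $v\in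 X^{0,\frac12,1}$, then $\partial_xP^+R(P^\pm v,P^+u)\in X^{s,b-1,2}+X^{s,-\frac12,1}$. 3. If $s\in\mathbb R$, $s'\le-\frac12$, $u\in X^{s,\frac12,1}$ and $v\in X^{s',\frac12,1}$, then $P^+(T_{P^\pm v}P^+u)\in X^{s+s'+1,-\frac12,1}$. 4. If $s\in\mathbb R$, $s'\le-\frac12$, $b>\frac12$, $u\in X^{s,b,2}$ and $v\in X^{s',\frac12,1}$, then $P^+(T_{P^\pm v}P^+u)\in X^{s+s'+1,b-1,2}+X^{s+s'+1,-\frac12,1}$. 5. If $s\in\mathbb R$, $u\in X^{s,\frac12,2}$ and $v\in X^{-1,\frac12,2}$, then $P^+(T_{P^\pm v}P^+u)\in X^{s,-\frac12,1}$. 6. If $u\in X^{-\frac12,\frac12,1}$ and $v\in X^{0,\frac12,2}\cap X^{0,\frac14,1}$, then $\partial_xP^+R(P^\pm v,P^+u)\in X^{-\frac12,-\frac12,1}$. -/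

import Mathlib

open MeasureTheory SchwartzMap FourierTransform LineDeriv
open scoped ENNReal NNReal

namespace BenjaminOno

/-- The space-time plane; coordinate `0` is the space variable `x` (dual variable `ξ`), coordinate
`1` is the time variable `t` (dual variable `τ`). -/
abbrev Plane : Type := EuclideanSpace ℝ (Fin 2)

/-- `χ` is the Fourier transform of the function generating the Littlewood-Paley decomposition. -/
structure IsCutoff (χ : 𝓢(ℝ, ℂ)) : Prop where
  eq_one : ∀ ξ : ℝ, |ξ| ≤ 1 → χ ξ = 1
  eq_zero : ∀ ξ : ℝ, 2 < |ξ| → χ ξ = 0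

/-- The tempered distribution `T` is (integration against) the function `g`. -/
def IsFunction (T : 𝓢'(Plane, ℂ)) (g : Plane → ℂ) : Prop :=
  LocallyIntegrable g volume ∧
    ∀ f : 𝓢(Plane, ℂ), Integrable (fun z => g z * f z) volume ∧ T f = ∫ z, g z * f z

/-- `w` is the image of `u` under the Fourier multiplier with symbol `m ξ τ`, i.e. the space-time
Fourier transform of `u` is a function and that of `w` is its product with `m`. The factors `2 * π`
convert the normalisation `exp (-2πi ⟨z, ζ⟩)` of `𝓕` into the frequency variables of
`exp (-i (x ξ + t τ))`. The symbol may be discontinuous. -/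
def IsMultiplier (m : ℝ → ℝ → ℂ) (u w : 𝓢'(Plane, ℂ)) : Prop :=
  ∃ g : Plane → ℂ, IsFunction (𝓕 u) g ∧
    IsFunction (𝓕 w) (fun ζ => m (2 * Real.pi * ζ 0) (2 * Real.pi * ζ 1) * g ζ)

/-- The dyadic index `n : ℕ` stands for the integer `n - 1 ≥ -1`. -/
def idx (n : ℕ) : ℝ := (n : ℝ) - 1

/-- The Littlewood-Paley symbol of `Δ_j` for `j = n - 1`: it is `χ` for `j = -1`
and `χ (ξ / 2 ^ (j + 1)) - χ (ξ / 2 ^ j)` for `j ≥ 0`. -/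
noncomputable def lpSymbol (χ : 𝓢(ℝ, ℂ)) : ℕ → ℝ → ℂ
  | 0, ξ => χ ξ
  | n + 1, ξ => χ (ξ / 2 ^ (n + 1)) - χ (ξ / 2 ^ n)

/-- The symbol of `S_{j-1} = ∑ Δ_{j'}`, `-1 ≤ j' ≤ j - 2`, for `j = n - 1`: it vanishes for `j ≤ 0`
and is `χ (ξ / 2 ^ (j - 1))` for `j ≥ 1`. -/
noncomputable def lowSymbol (χ : 𝓢(ℝ, ℂ)) : ℕ → ℝ → ℂ
  | 0, _ => 0
  | 1, _ => 0
  | n + 2, ξ => χ (ξ / 2 ^ n)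

theorem lowSymbol_eq_sum (χ : 𝓢(ℝ, ℂ)) (n : ℕ) (ξ : ℝ) :
    lowSymbol χ n ξ = ∑ m ∈ Finset.range (n - 1), lpSymbol χ m ξ := by
  match n with
  | 0 => simp [lowSymbol]
  | 1 => simp [lowSymbol]
  | n + 2 =>
    induction n with
    | zero => simp [lowSymbol, lpSymbol]
    | succ k ih =>
      have h : k + 1 + 2 - 1 = (k + 2 - 1) + 1 := by omega
      rw [h, Finset.sum_range_succ, ← ih]
      simp [lowSymbol, lpSymbol]

/-- The symbol of `Δ_{jk}`, localizing `|ξ| ∼ 2 ^ j` and `|τ - ξ |ξ|| ∼ 2 ^ k`: it is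
`ψ_j(ξ) ψ_k(τ - ξ²)` for `ξ ≥ 0` and `ψ_j(ξ) ψ_k(τ + ξ²)` for `ξ ≤ 0`. -/
noncomputable def blockSymbol (χ : 𝓢(ℝ, ℂ)) (n l : ℕ) (ξ τ : ℝ) : ℂ :=
  lpSymbol χ n ξ * lpSymbol χ l (τ - ξ * |ξ|)

/-- The `L²` norm over space-time of `Δ_{jk} u`, `j = n - 1`, `k = l - 1`; it is `∞` if `Δ_{jk} u`
is not in `L²`. -/
noncomputable def blockNorm (χ : 𝓢(ℝ, ℂ)) (n l : ℕ) (u : 𝓢'(Plane, ℂ)) : ℝ≥0∞ :=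
  ⨅ (a : Lp ℂ 2 (volume : Measure Plane))
    (_ : IsMultiplier (blockSymbol χ n l) u (Lp.toTemperedDistribution a)), ‖a‖ₑ

/-- The norm of the conormal space `X^{s,b,q}`: the `ℓ^q` norm over `j, k ≥ -1` of
`2 ^ (j s + k b) ‖Δ_{jk} u‖_{L²}`, with value `∞` outside the space. -/
noncomputable def xNorm (χ : 𝓢(ℝ, ℂ)) (s b : ℝ) (q : ℝ≥0∞) (u : 𝓢'(Plane, ℂ)) : ℝ≥0∞ :=
  eLpNorm (fun p : ℕ × ℕ => (2 : ℝ≥0∞) ^ (idx p.1 * s + idx p.2 * b) * blockNorm χ p.1 p.2 u)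
    q Measure.count

/-- Membership in `X^{s,b,q}`. -/
def MemX (χ : 𝓢(ℝ, ℂ)) (s b : ℝ) (q : ℝ≥0∞) (u : 𝓢'(Plane, ℂ)) : Prop :=
  xNorm χ s b q u < ∞

/-- `w = P^ε u`, where `P^{±1}` is the projection on the frequencies `±ξ ≥ 0`. -/
def IsProj (ε : ℝ) (u w : 𝓢'(Plane, ℂ)) : Prop :=
  IsMultiplier (fun ξ _ => if 0 ≤ ε * ξ then 1 else 0) u w

/-- `W` is the pointwise product of `m₁(D_x) v` and `m₂(D_x) u`, both of which are functions in
`L²` of space-time (so that the product is in `L¹`). -/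
def IsLocalizedProduct (m₁ m₂ : ℝ → ℂ) (v u W : 𝓢'(Plane, ℂ)) : Prop :=
  ∃ a b : Lp ℂ 2 (volume : Measure Plane),
    IsMultiplier (fun ξ _ => m₁ ξ) v (Lp.toTemperedDistribution a) ∧
    IsMultiplier (fun ξ _ => m₂ ξ) u (Lp.toTemperedDistribution b) ∧
    IsFunction W (fun z => a z * b z)

/-- `w = P^+ (T_{P^ε v} P^+ u)`, where `T_v u = ∑_j S_{j-1} v Δ_j u`: the series of the terms
`P^+ (S_{j-1} P^ε v Δ_j P^+ u)` converges to `w` in the space of tempered distributions. -/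
def IsParaproduct (χ : 𝓢(ℝ, ℂ)) (ε : ℝ) (v u w : 𝓢'(Plane, ℂ)) : Prop :=
  ∃ (v₁ u₁ : 𝓢'(Plane, ℂ)) (W Q : ℕ → 𝓢'(Plane, ℂ)), IsProj ε v v₁ ∧ IsProj 1 u u₁ ∧
    (∀ n, IsLocalizedProduct (lowSymbol χ n) (lpSymbol χ n) v₁ u₁ (W n)) ∧
    (∀ n, IsProj 1 (W n) (Q n)) ∧
    HasSum Q w

/-- The pairs of dyadic indices at distance at most one. -/
abbrev NearDiagonal : Type := {p : ℕ × ℕ // |(p.1 : ℤ) - (p.2 : ℤ)| ≤ 1}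

/-- `w = ∂_x P^+ R(P^ε v, P^+ u)`, where `R(v, u) = ∑_{|j - j'| ≤ 1} Δ_j v Δ_{j'} u`: the series of
the terms `∂_x P^+ (Δ_j P^ε v Δ_{j'} P^+ u)` converges to `w` in the space of tempered
distributions. -/
def IsDerivRemainder (χ : 𝓢(ℝ, ℂ)) (ε : ℝ) (v u w : 𝓢'(Plane, ℂ)) : Prop :=
  ∃ (v₁ u₁ : 𝓢'(Plane, ℂ)) (W Q : NearDiagonal → 𝓢'(Plane, ℂ)), IsProj ε v v₁ ∧ IsProj 1 u u₁ ∧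
    (∀ p : NearDiagonal,
      IsLocalizedProduct (lpSymbol χ p.1.1) (lpSymbol χ p.1.2) v₁ u₁ (W p)) ∧
    (∀ p, IsProj 1 (W p) (Q p)) ∧
    HasSum (fun p => ∂_{(EuclideanSpace.single 0 1 : Plane)} (Q p)) w

end BenjaminOno

/-!
Since `P^±` is the sharp projection to a half line, the Fourier transform of every term is a
convolution of functions carried by half planes, and after reflecting the factor `v` in the case of
the sign `-` all three frequencies are positive. There the modulations are `τ - ξ ^ 2`, and if two
of the three points of the dual plane add up to the third, then the corresponding combination of
the modulations is twice the product of the two smaller frequencies. Hence the largest of the three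
modulations dominates that product, and this gain compensates for the derivative.

The dual plane is cut into sharp blocks `ξ ∼ 2 ^ n`, `1 + |τ - ξ ^ 2| ∼ 2 ^ l`. On a triple of
blocks the trilinear form `J` dual to convolution is bounded by the Cauchy-Schwarz inequality in
three ways, according to which variable is frozen; the area of the remaining slice is estimated by
a strip of small height whose width is the trivial one or is read off the resonance relation
(`J_le_kern`). It remains to sum over all triples of blocks the product of this bound with the
symbol. All the exponents are integers, and in each regime the product decays exponentially in a
quadruple of integers that, together with the block of either input, determines the other blocks.
This makes the Schur test applicable (`schur_of_options`, `total_remainder_le`,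
`total_paraproduct_le`, `total_paraproduct_l2_le`, `total_remainder_l2_le`). Low frequencies, where
the frequency itself and not only its inhomogeneous dyadic index may tend to zero, are covered by
the same scheme, because `n` ranges over all integers.

For the paraproduct with opposite signs, the output frequency can be much smaller than that of `u`.
No separation of supports is assumed for the cutoff, but being smooth it vanishes to infinite order
at the ends of its support, and this yields arbitrary polynomial decay of the symbol in that region
(`IsCutoff.exists_lowSymbol_mul_le`).

The norms of the spaces are compared with the sharp blocks in `IsCutoff.tsum_modNorm_le` and
`IsCutoff.tsum_fnorm_le`. For `b > 1 / 2` the square summable norm controls the summable norm with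
exponent `1 / 2` in the modulation (`IsCutoff.exists_tsum_modNorm_half_le`); therefore the outputs
that are claimed to lie in a sum of two spaces lie in the second one, and `0` can be taken for the
first component. Convergence of the series and the formula for its Fourier transform follow from
the same bounds, as they hold for the sums of the absolute values on the Fourier side
(`exists_hasSum_of_temperate`, `IsCutoff.exists_hasSum`).
-/

namespace BenjaminOno

/-! ### Powers of two, `L²` norms and areas of strips -/

/-- The power `2 ^ x` in `[0, ∞]`, where all the estimates take place. -/
noncomputable def pw (x : ℝ) : ℝ≥0∞ := (2 : ℝ≥0∞) ^ x

theorem pw_add (x y : ℝ) : pw (x + y) = pw x * pw y :=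
  ENNReal.rpow_add x y (by norm_num) (by norm_num)

theorem pw_mono {x y : ℝ} (h : x ≤ y) : pw x ≤ pw y :=
  ENNReal.rpow_le_rpow_of_exponent_le (by norm_num) h

theorem pw_ne_top (x : ℝ) : pw x ≠ ∞ := by
  rw [pw, Ne, ENNReal.rpow_eq_top_iff]; norm_num

theorem pw_ne_zero (x : ℝ) : pw x ≠ 0 := (ENNReal.rpow_pos (by norm_num) (by norm_num)).ne'

@[simp] theorem pw_zero : pw 0 = 1 := by simp [pw]

theorem pw_rpow (x y : ℝ) : pw x ^ y = pw (x * y) := (ENNReal.rpow_mul _ _ _).symm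

theorem pw_sq (x : ℝ) : pw x ^ 2 = pw (2 * x) := by
  rw [two_mul, pw_add, sq]

theorem ofReal_two_rpow (x : ℝ) : ENNReal.ofReal (2 ^ x) = pw x := by
  rw [← ENNReal.ofReal_rpow_of_pos (by norm_num)]; simp [pw]

theorem ofReal_two_zpow (n : ℤ) : ENNReal.ofReal (2 ^ n) = pw n := by
  rw [← ofReal_two_rpow, Real.rpow_intCast]

/-- The `L²` norm of a nonnegative function on the plane. -/
noncomputable def l2 (f : Plane → ℝ≥0∞) : ℝ≥0∞ := (∫⁻ z, f z ^ 2) ^ (1 / 2 : ℝ)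

theorem l2_sq (f : Plane → ℝ≥0∞) : l2 f ^ 2 = ∫⁻ z, f z ^ 2 := by
  rw [l2, ← ENNReal.rpow_natCast, ← ENNReal.rpow_mul]; simp

theorem l2_mono {f g : Plane → ℝ≥0∞} (h : ∀ z, f z ≤ g z) : l2 f ≤ l2 g :=
  ENNReal.rpow_le_rpow (lintegral_mono fun z => by gcongr; exact h z) (by norm_num)

theorem l2_const_mul {f : Plane → ℝ≥0∞} (hf : Measurable f) (c : ℝ≥0∞) :
    l2 (fun z => c * f z) = c * l2 f := by
  unfold l2
  simp_rw [mul_pow]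
  rw [lintegral_const_mul _ (hf.pow_const 2), ENNReal.mul_rpow_of_nonneg _ _ (by norm_num),
    ← ENNReal.rpow_natCast, ← ENNReal.rpow_mul]
  simp

theorem lintegral_mul_le_sqrt {α : Type*} [MeasurableSpace α] {μ : Measure α}
    {f g : α → ℝ≥0∞} (hf : AEMeasurable f μ) (hg : AEMeasurable g μ) :
    ∫⁻ x, f x * g x ∂μ ≤ (∫⁻ x, f x ^ 2 ∂μ) ^ (1 / 2 : ℝ) * (∫⁻ x, g x ^ 2 ∂μ) ^ (1 / 2 : ℝ) := by
  have := ENNReal.lintegral_mul_le_Lp_mul_Lq μ Real.HolderConjugate.two_two hf hg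
  simpa using this

theorem l2_add_le {f g : Plane → ℝ≥0∞} (hf : Measurable f) (hg : Measurable g) :
    l2 (fun z => f z + g z) ≤ l2 f + l2 g := by
  have := ENNReal.lintegral_Lp_add_le (μ := volume) hf.aemeasurable hg.aemeasurable
    (p := 2) (by norm_num)
  simpa [l2] using this

theorem l2_tsum_le {ι : Type*} [Countable ι] {f : ι → Plane → ℝ≥0∞} (hf : ∀ i, Measurable (f i)) :
    l2 (fun z => ∑' i, f i z) ≤ ∑' i, l2 (f i) := by
  classical
  have hfin : ∀ s : Finset ι, l2 (fun z => ∑ i ∈ s, f i z) ≤ ∑ i ∈ s, l2 (f i) := by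
    intro s
    induction s using Finset.induction_on with
    | empty => simp [l2]
    | insert a s ha ih =>
      simp only [Finset.sum_insert ha]
      exact (l2_add_le (hf a) (Finset.measurable_sum _ fun i _ => hf i)).trans (by gcongr)
  -- monotone convergence along finite partial sums
  have hsq : (l2 (fun z => ∑' i, f i z)) ^ 2 ≤ (∑' i, l2 (f i)) ^ 2 := by
    rw [l2_sq]
    have h1 : ∀ z, (∑' i, f i z) ^ 2 = ⨆ s : Finset ι, (∑ i ∈ s, f i z) ^ 2 := by
      intro z
      rw [ENNReal.tsum_eq_iSup_sum]
      refine (Monotone.map_iSup_of_continuousAt (f := fun x : ℝ≥0∞ => x ^ 2) ?_ ?_ ?_)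
      · exact (ENNReal.continuous_pow 2).continuousAt
      · intro a b hab; dsimp only; gcongr
      · simp
    simp_rw [h1]
    rw [lintegral_iSup_directed]
    · refine iSup_le fun s => ?_
      rw [← l2_sq (fun z => ∑ i ∈ s, f i z)]
      gcongr
      exact (hfin s).trans (ENNReal.sum_le_tsum s)
    · intro s
      exact ((Finset.measurable_sum _ fun i _ => hf i).pow_const 2).aemeasurable
    · apply Monotone.directed_le
      intro s t hst z
      dsimp only
      gcongr
  exact le_of_sq_le_sq hsq
where
  le_of_sq_le_sq {a b : ℝ≥0∞} (h : a ^ 2 ≤ b ^ 2) : a ≤ b := by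
    by_contra! hlt
    exact absurd h (not_le.mpr (ENNReal.pow_lt_pow_left (by norm_num) hlt))

/-- Cauchy-Schwarz on the slices of a kernel whose slices have small support. -/
theorem lintegral_slice_le {A : Plane → ℝ≥0∞} {G : Plane → Plane → ℝ≥0∞} (hA : Measurable A)
    (hG : Measurable (Function.uncurry G)) {κ : ℝ≥0∞}
    (hκ : ∀ x, A x ≠ 0 → volume {y | G x y ≠ 0} ≤ κ) :
    ∫⁻ x, A x * ∫⁻ y, G x y ≤
      κ ^ (1 / 2 : ℝ) * l2 A * (∫⁻ x, ∫⁻ y, G x y ^ 2) ^ (1 / 2 : ℝ) := by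
  have hGx : ∀ x, Measurable (G x) := fun x => hG.comp measurable_prodMk_left
  have hm : Measurable fun x => ∫⁻ y, G x y ^ 2 :=
    (Measurable.lintegral_prod_right' (f := fun p : Plane × Plane => G p.1 p.2 ^ 2)
      (hG.pow_const 2))
  have h1 : ∀ x, A x * ∫⁻ y, G x y ≤
      κ ^ (1 / 2 : ℝ) * (A x * (∫⁻ y, G x y ^ 2) ^ (1 / 2 : ℝ)) := by
    intro x
    by_cases hx : A x = 0
    · simp [hx]
    set S := {y | G x y ≠ 0}
    have hS : MeasurableSet S := (hGx x) (measurableSet_singleton 0).compl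
    have h2 : ∫⁻ y, G x y = ∫⁻ y, S.indicator 1 y * G x y := by
      congr 1; ext y
      by_cases hy : G x y = 0
      · simp [hy]
      · simp [S, hy]
    have h3 := lintegral_mul_le_sqrt (μ := (volume : Measure Plane)) (f := S.indicator 1) (g := G x)
      ((measurable_const.indicator hS).aemeasurable) (hGx x).aemeasurable
    have h4 : ∫⁻ y, (S.indicator (1 : Plane → ℝ≥0∞) y) ^ 2 = volume S := by
      rw [← lintegral_indicator_one hS]
      congr 1; ext y
      by_cases hy : y ∈ S <;> simp [hy]
    rw [h4, ← h2] at h3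
    calc A x * ∫⁻ y, G x y
        ≤ A x * ((volume S) ^ (1 / 2 : ℝ) * (∫⁻ y, G x y ^ 2) ^ (1 / 2 : ℝ)) := by
          gcongr
      _ ≤ A x * (κ ^ (1 / 2 : ℝ) * (∫⁻ y, G x y ^ 2) ^ (1 / 2 : ℝ)) := by
          gcongr
          exact hκ x hx
      _ = _ := by ring
  have hm' : Measurable fun x => (∫⁻ y, G x y ^ 2) ^ (1 / 2 : ℝ) := hm.pow_const _
  calc ∫⁻ x, A x * ∫⁻ y, G x y
      ≤ ∫⁻ x, κ ^ (1 / 2 : ℝ) * (A x * (∫⁻ y, G x y ^ 2) ^ (1 / 2 : ℝ)) := lintegral_mono h1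
    _ = κ ^ (1 / 2 : ℝ) * ∫⁻ x, (A x * (∫⁻ y, G x y ^ 2) ^ (1 / 2 : ℝ)) :=
        lintegral_const_mul _ (hA.mul hm')
    _ ≤ _ := by
        rw [mul_assoc]
        gcongr
        refine (lintegral_mul_le_sqrt hA.aemeasurable hm'.aemeasurable).trans ?_
        apply le_of_eq
        unfold l2
        congr 3
        ext x
        rw [← ENNReal.rpow_natCast, ← ENNReal.rpow_mul]
        simp

/-- The spatial frequency of a point of the dual plane, in the normalization of `exp (-i x ξ)`. -/
noncomputable def xi (z : Plane) : ℝ := 2 * Real.pi * z 0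

/-- The modulation `τ - ξ |ξ|` of a point of the dual plane. -/
noncomputable def sg (z : Plane) : ℝ := 2 * Real.pi * z 1 - xi z * |xi z|

@[fun_prop] theorem measurable_xi : Measurable xi := by unfold xi; fun_prop
@[fun_prop] theorem measurable_sg : Measurable sg := by unfold sg; fun_prop

theorem measurePreserving_coords :
    MeasurePreserving (fun z : Plane => ((z 0, z 1) : ℝ × ℝ)) volume volume :=
  (volume_preserving_finTwoArrow ℝ).comp (PiLp.volume_preserving_ofLp (Fin 2))

/-- A subset of the strip of half-height `r` around a graph, with horizontal extent `d`,
has area at most `r * d`. -/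
theorem volume_le_of_strip {E : Set Plane} {c : ℝ → ℝ} (hc : Measurable c) {r d : ℝ}
    (hr : 0 ≤ r) (h1 : ∀ z ∈ E, |2 * Real.pi * z 1 - c (xi z)| ≤ r)
    (h2 : ∀ z ∈ E, ∀ w ∈ E, |xi z - xi w| ≤ d) : volume E ≤ ENNReal.ofReal (r * d) := by
  rcases E.eq_empty_or_nonempty with rfl | ⟨z₀, hz₀⟩
  · simp
  have hd : 0 ≤ d := (abs_nonneg _).trans (h2 _ hz₀ _ hz₀)
  have hpi := Real.pi_gt_three
  set x₀ := z₀ 0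
  set δ := d / (2 * Real.pi)
  set ρ := r / (2 * Real.pi)
  set S : Set (ℝ × ℝ) := {p | p.1 ∈ Set.Icc (x₀ - δ) (x₀ + δ) ∧
    p.2 ∈ Set.Icc (c (2 * Real.pi * p.1) / (2 * Real.pi) - ρ)
      (c (2 * Real.pi * p.1) / (2 * Real.pi) + ρ)}
  have hSm : MeasurableSet S := by
    refine MeasurableSet.inter ?_ ?_
    · exact measurable_fst measurableSet_Icc
    · refine MeasurableSet.inter ?_ ?_
      · exact measurableSet_le
          (f := fun p : ℝ × ℝ => c (2 * Real.pi * p.1) / (2 * Real.pi) - ρ)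
          (g := fun p => p.2) (by fun_prop) (by fun_prop)
      · exact measurableSet_le (f := fun p : ℝ × ℝ => p.2)
          (g := fun p : ℝ × ℝ => c (2 * Real.pi * p.1) / (2 * Real.pi) + ρ)
          (by fun_prop) (by fun_prop)
  have hES : E ⊆ (fun z : Plane => ((z 0, z 1) : ℝ × ℝ)) ⁻¹' S := by
    intro z hz
    have a1 := h1 z hz
    have a2 := h2 z hz z₀ hz₀
    have e1 : xi z - xi z₀ = 2 * Real.pi * (z 0 - x₀) := by simp only [xi, x₀]; ring
    rw [e1, abs_mul, abs_of_pos (by positivity)] at a2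
    have a2' : |z 0 - x₀| ≤ δ := by
      rw [le_div_iff₀ (by positivity)]; linarith
    have e2 : 2 * Real.pi * z 1 - c (xi z) =
        2 * Real.pi * (z 1 - c (2 * Real.pi * z 0) / (2 * Real.pi)) := by
      unfold xi
      field_simp
    rw [e2, abs_mul, abs_of_pos (by positivity)] at a1
    have a1' : |z 1 - c (2 * Real.pi * z 0) / (2 * Real.pi)| ≤ ρ := by
      rw [le_div_iff₀ (by positivity)]; linarith
    rw [abs_le] at a1' a2'
    refine ⟨⟨?_, ?_⟩, ?_, ?_⟩ <;> simp only <;> linarith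
  calc volume E ≤ volume ((fun z : Plane => ((z 0, z 1) : ℝ × ℝ)) ⁻¹' S) := measure_mono hES
    _ = volume S := measurePreserving_coords.measure_preimage hSm.nullMeasurableSet
    _ = ∫⁻ x, volume (Prod.mk x ⁻¹' S) := Measure.prod_apply hSm
    _ ≤ ∫⁻ x, (Set.Icc (x₀ - δ) (x₀ + δ)).indicator (fun _ => ENNReal.ofReal (2 * ρ)) x := by
        refine lintegral_mono fun x => ?_
        by_cases hx : x ∈ Set.Icc (x₀ - δ) (x₀ + δ)
        · rw [Set.indicator_of_mem hx]
          refine (measure_mono (t := Set.Icc (c (2 * Real.pi * x) / (2 * Real.pi) - ρ)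
            (c (2 * Real.pi * x) / (2 * Real.pi) + ρ)) ?_).trans ?_
          · intro y hy; exact hy.2
          · rw [Real.volume_Icc]; apply ENNReal.ofReal_le_ofReal; linarith
        · rw [Set.indicator_of_notMem hx]
          have : Prod.mk x ⁻¹' S = ∅ := by
            ext y; simp only [Set.mem_preimage, Set.mem_empty_iff_false, iff_false]
            exact fun h => hx h.1
          simp [this]
    _ = ENNReal.ofReal (2 * ρ) * ENNReal.ofReal (2 * δ) := by
        rw [lintegral_indicator_const measurableSet_Icc, Real.volume_Icc]
        congr 2; ring
    _ ≤ ENNReal.ofReal (r * d) := by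
        rw [← ENNReal.ofReal_mul (by positivity)]
        apply ENNReal.ofReal_le_ofReal
        have : 2 * ρ * (2 * δ) = r * d * (1 / Real.pi ^ 2) := by
          simp only [ρ, δ]; field_simp
        rw [this]
        have h3 : 1 / Real.pi ^ 2 ≤ 1 := by
          rw [div_le_one (by positivity)]; nlinarith
        nlinarith [mul_nonneg hr hd]

/-! ### Dyadic blocks and the trilinear form dual to convolution -/

/-- The index of the dyadic interval `[2 ^ n, 2 ^ (n + 1))` containing `|ξ|`. -/
noncomputable def fn (z : Plane) : ℤ := Int.log 2 |xi z|

/-- The index of the dyadic interval `[2 ^ l, 2 ^ (l + 1))` containing `1 + |τ - ξ |ξ||`. -/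
noncomputable def fl (z : Plane) : ℤ := Int.log 2 (1 + |sg z|)

/-- The region of positive frequencies `ξ ∼ 2 ^ n` and modulations `1 + |τ - ξ ^ 2| ∼ 2 ^ l`. -/
def blk (n l : ℤ) : Set Plane := {z | 0 < xi z ∧ fn z = n ∧ fl z = l}

theorem zpow_fn_le {z : Plane} (hz : xi z ≠ 0) : (2 : ℝ) ^ fn z ≤ |xi z| := by
  have := Int.zpow_log_le_self (b := 2) (r := |xi z|) (by norm_num) (abs_pos.2 hz)
  simpa [fn] using this

theorem lt_zpow_fn (z : Plane) : |xi z| < (2 : ℝ) ^ (fn z + 1) := by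
  have := Int.lt_zpow_succ_log_self (b := 2) (by norm_num) |xi z|
  simpa [fn] using this

theorem zpow_fl_le (z : Plane) : (2 : ℝ) ^ fl z ≤ 1 + |sg z| := by
  have := Int.zpow_log_le_self (b := 2) (r := 1 + |sg z|) (by norm_num) (by positivity)
  simpa [fl] using this

theorem lt_zpow_fl (z : Plane) : 1 + |sg z| < (2 : ℝ) ^ (fl z + 1) := by
  have := Int.lt_zpow_succ_log_self (b := 2) (by norm_num) (1 + |sg z|)
  simpa [fl] using this

theorem fl_nonneg (z : Plane) : 0 ≤ fl z := by
  have h := lt_zpow_fl z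
  have h2 : (2 : ℝ) ^ (0 : ℤ) < 2 ^ (fl z + 1) := by
    rw [zpow_zero]; linarith [abs_nonneg (sg z)]
  have := (zpow_lt_zpow_iff_right₀ (by norm_num : (1 : ℝ) < 2)).1 h2
  omega

theorem measurable_int_log : Measurable fun x : ℝ => Int.log 2 x := by
  have h : Measurable fun x : ℝ =>
      if 1 ≤ x then (Nat.log 2 ⌊x⌋₊ : ℤ) else -(Nat.clog 2 ⌈x⁻¹⌉₊ : ℤ) := by
    refine Measurable.ite (measurableSet_le measurable_const measurable_id) ?_ ?_
    · exact (measurable_from_nat (f := fun n : ℕ => (Nat.log 2 n : ℤ))).comp Nat.measurable_floor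
    · exact (measurable_from_nat (f := fun n : ℕ => -(Nat.clog 2 n : ℤ))).comp
        (Nat.measurable_ceil.comp measurable_inv)
  exact h

@[fun_prop] theorem measurable_fn : Measurable fn :=
  measurable_int_log.comp (by fun_prop : Measurable fun z => |xi z|)

@[fun_prop] theorem measurable_fl : Measurable fl :=
  measurable_int_log.comp (by fun_prop : Measurable fun z => 1 + |sg z|)

theorem measurableSet_blk (n l : ℤ) : MeasurableSet (blk n l) :=
  (measurableSet_lt measurable_const measurable_xi).inter
    ((measurable_fn (measurableSet_singleton n)).inter (measurable_fl (measurableSet_singleton l)))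

theorem xi_bounds {n l : ℤ} {z : Plane} (hz : z ∈ blk n l) :
    (2 : ℝ) ^ n ≤ xi z ∧ xi z < 2 * 2 ^ n := by
  obtain ⟨h0, rfl, rfl⟩ := hz
  have h1 := zpow_fn_le h0.ne'
  have h2 := lt_zpow_fn z
  rw [zpow_add_one₀ (by norm_num), mul_comm] at h2
  rw [abs_of_pos h0] at h1 h2
  exact ⟨h1, h2⟩

theorem sg_bound {n l : ℤ} {z : Plane} (hz : z ∈ blk n l) : |sg z| < 2 * 2 ^ l := by
  obtain ⟨h0, rfl, rfl⟩ := hz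
  have h2 := lt_zpow_fl z
  rw [zpow_add_one₀ (by norm_num), mul_comm] at h2
  linarith

theorem sg_eq {n l : ℤ} {z : Plane} (hz : z ∈ blk n l) :
    sg z = 2 * Real.pi * z 1 - xi z ^ 2 := by
  rw [sg, abs_of_pos hz.1, sq]

@[simp] theorem xi_add (y w : Plane) : xi (y + w) = xi y + xi w := by simp [xi]; ring
@[simp] theorem xi_sub (y w : Plane) : xi (y - w) = xi y - xi w := by simp [xi]; ring
@[simp] theorem xi_neg (y : Plane) : xi (-y) = -xi y := by simp [xi]
@[simp] theorem sg_neg (y : Plane) : sg (-y) = -sg y := by simp [sg]; ring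
@[simp] theorem fn_neg (y : Plane) : fn (-y) = fn y := by simp [fn]
@[simp] theorem fl_neg (y : Plane) : fl (-y) = fl y := by simp [fl]

/-- The trilinear form dual to the convolution. In the lemmas below, the letters `a`, `b`, `c` in
the names of indices refer to the three arguments in this order. -/
noncomputable def J (f g h : Plane → ℝ≥0∞) : ℝ≥0∞ := ∫⁻ y, ∫⁻ w, f y * g w * h (y + w)

theorem J_comm {f g h : Plane → ℝ≥0∞} (hf : Measurable f) (hg : Measurable g)
    (hh : Measurable h) : J f g h = J g f h := by
  unfold J
  rw [lintegral_lintegral_swap]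
  · simp_rw [add_comm, mul_comm]
  · fun_prop

theorem J_eq_conv {f g h : Plane → ℝ≥0∞} (hf : Measurable f) (hg : Measurable g)
    (hh : Measurable h) : J f g h = ∫⁻ z, h z * ∫⁻ y, f y * g (z - y) := by
  have h1 : ∀ y, ∫⁻ w, f y * g w * h (y + w) = ∫⁻ z, f y * g (z - y) * h z := by
    intro y
    rw [← lintegral_sub_right_eq_self (fun w => f y * g w * h (y + w)) y]
    simp
  unfold J
  simp_rw [h1]
  rw [lintegral_lintegral_swap (by fun_prop)]
  congr 1; ext z
  rw [← lintegral_const_mul _ (by fun_prop)]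
  congr 1; ext y; ring

/-- The Cauchy-Schwarz inequality in the variable `y` for fixed `z = y + w`. -/
theorem J_le_of_volume_c {f g h : Plane → ℝ≥0∞} (hf : Measurable f) (hg : Measurable g)
    (hh : Measurable h) {κ : ℝ≥0∞}
    (hκ : ∀ z, h z ≠ 0 → volume {y | f y * g (z - y) ≠ 0} ≤ κ) :
    J f g h ≤ κ ^ (1 / 2 : ℝ) * (l2 f * l2 g * l2 h) := by
  rw [J_eq_conv hf hg hh]
  refine (lintegral_slice_le (G := fun z y => f y * g (z - y)) hh (by fun_prop) hκ).trans ?_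
  have h2 : ∫⁻ z, ∫⁻ y, (f y * g (z - y)) ^ 2 = (∫⁻ z, f z ^ 2) * ∫⁻ z, g z ^ 2 := by
    rw [lintegral_lintegral_swap (by fun_prop)]
    simp_rw [mul_pow]
    have : ∀ y, ∫⁻ z, f y ^ 2 * g (z - y) ^ 2 = f y ^ 2 * ∫⁻ z, g z ^ 2 := by
      intro y
      rw [lintegral_const_mul _ (by fun_prop), lintegral_sub_right_eq_self (fun z => g z ^ 2) y]
    simp_rw [this]
    rw [lintegral_mul_const _ (by fun_prop)]
  rw [h2, ENNReal.mul_rpow_of_nonneg _ _ (by norm_num)]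
  apply le_of_eq
  unfold l2
  ring

/-- The Cauchy-Schwarz inequality in the variable `w` for fixed `y`. -/
theorem J_le_of_volume_a {f g h : Plane → ℝ≥0∞} (hf : Measurable f) (hg : Measurable g)
    (hh : Measurable h) {κ : ℝ≥0∞}
    (hκ : ∀ y, f y ≠ 0 → volume {w | g w * h (y + w) ≠ 0} ≤ κ) :
    J f g h ≤ κ ^ (1 / 2 : ℝ) * (l2 f * l2 g * l2 h) := by
  have h1 : J f g h = ∫⁻ y, f y * ∫⁻ w, g w * h (y + w) := by
    unfold J
    congr 1; ext y
    rw [← lintegral_const_mul _ (by fun_prop)]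
    congr 1; ext w; ring
  rw [h1]
  refine (lintegral_slice_le (G := fun y w => g w * h (y + w)) hf (by fun_prop) hκ).trans ?_
  have h2 : ∫⁻ y, ∫⁻ w, (g w * h (y + w)) ^ 2 = (∫⁻ z, g z ^ 2) * ∫⁻ z, h z ^ 2 := by
    rw [lintegral_lintegral_swap (by fun_prop)]
    simp_rw [mul_pow]
    have : ∀ w, ∫⁻ y, g w ^ 2 * h (y + w) ^ 2 = g w ^ 2 * ∫⁻ z, h z ^ 2 := by
      intro w
      rw [lintegral_const_mul _ (by fun_prop), lintegral_add_right_eq_self (fun z => h z ^ 2) w]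
    simp_rw [this]
    rw [lintegral_mul_const _ (by fun_prop)]
  rw [h2, ENNReal.mul_rpow_of_nonneg _ _ (by norm_num)]
  apply le_of_eq
  unfold l2
  ring

theorem volume_le_min_strip {E : Set Plane} {c c' : ℝ → ℝ} (hc : Measurable c)
    (hc' : Measurable c') {l l' : ℤ} {d : ℝ}
    (h1 : ∀ z ∈ E, |2 * Real.pi * z 1 - c (xi z)| ≤ 2 * 2 ^ l)
    (h1' : ∀ z ∈ E, |2 * Real.pi * z 1 - c' (xi z)| ≤ 2 * 2 ^ l')
    (h2 : ∀ z ∈ E, ∀ w ∈ E, |xi z - xi w| ≤ d) :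
    volume E ≤ ENNReal.ofReal (2 * 2 ^ (min l l') * d) := by
  rcases min_choice l l' with h | h <;> rw [h]
  · exact volume_le_of_strip hc (by positivity) h1 h2
  · exact volume_le_of_strip hc' (by positivity) h1' h2

/-- For fixed `z`, both `y ∈ blk na la` and `z - y ∈ blk nb lb` confine `y` to a strip around a
graph over `xi y`; the thinner one counts. -/
theorem volume_c_le {E : Set Plane} {na la nb lb : ℤ} {d : ℝ} (z : Plane)
    (hE : ∀ y ∈ E, y ∈ blk na la ∧ z - y ∈ blk nb lb)
    (h2 : ∀ y ∈ E, ∀ w ∈ E, |xi y - xi w| ≤ d) :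
    volume E ≤ ENNReal.ofReal (2 * 2 ^ (min la lb) * d) := by
  refine volume_le_min_strip (c := fun x => x ^ 2)
    (c' := fun x => 2 * Real.pi * z 1 - (xi z - x) ^ 2) (by fun_prop) (by fun_prop) ?_ ?_ h2
  · intro y hy
    have := (sg_bound (hE y hy).1).le
    rwa [sg_eq (hE y hy).1] at this
  · intro y hy
    have := (sg_bound (hE y hy).2).le
    rw [sg_eq (hE y hy).2, xi_sub] at this
    rw [abs_le] at this ⊢
    simp only [PiLp.sub_apply] at this
    constructor <;> nlinarith [this.1, this.2]

/-- For fixed `y`, both `w ∈ blk nb lb` and `y + w ∈ blk nc lc` confine `w` to a strip around a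
graph over `xi w`; the thinner one counts. -/
theorem volume_a_le {E : Set Plane} {nb lb nc lc : ℤ} {d : ℝ} (y : Plane)
    (hE : ∀ w ∈ E, w ∈ blk nb lb ∧ y + w ∈ blk nc lc)
    (h2 : ∀ z ∈ E, ∀ w ∈ E, |xi z - xi w| ≤ d) :
    volume E ≤ ENNReal.ofReal (2 * 2 ^ (min lb lc) * d) := by
  refine volume_le_min_strip (c := fun x => x ^ 2)
    (c' := fun x => (xi y + x) ^ 2 - 2 * Real.pi * y 1) (by fun_prop) (by fun_prop) ?_ ?_ h2
  · intro w hw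
    have := (sg_bound (hE w hw).1).le
    rwa [sg_eq (hE w hw).1] at this
  · intro w hw
    have := (sg_bound (hE w hw).2).le
    rw [sg_eq (hE w hw).2, xi_add] at this
    rw [abs_le] at this ⊢
    simp only [PiLp.add_apply] at this
    constructor <;> nlinarith [this.1, this.2]

theorem abs_xi_sub_le {n l l' : ℤ} {y w : Plane} (hy : y ∈ blk n l) (hw : w ∈ blk n l') :
    |xi y - xi w| ≤ 2 ^ n := by
  have a := xi_bounds hy
  have b := xi_bounds hw
  rw [abs_le]; constructor <;> linarith [a.1, a.2, b.1, b.2]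

/-! ### Bounds of the trilinear form on dyadic blocks -/

theorem ofReal_sqrt_le {x : ℝ} {k : ℤ} (hx : x ≤ 2 ^ ((k : ℝ) / 2 + 6)) :
    ENNReal.ofReal x ^ (1 / 2 : ℝ) ≤ pw ((k : ℝ) / 4 + 3) := by
  calc ENNReal.ofReal x ^ (1 / 2 : ℝ) ≤ ENNReal.ofReal (2 ^ ((k : ℝ) / 2 + 6)) ^ (1 / 2 : ℝ) := by
        gcongr
    _ = _ := by rw [ofReal_two_rpow, pw_rpow]; congr 1; ring

theorem ofReal_sqrt_le_of_zpow {e k : ℤ} (h : 2 * e ≤ k + 12) {x : ℝ} (hx : x ≤ 2 ^ e) :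
    ENNReal.ofReal x ^ (1 / 2 : ℝ) ≤ pw ((k : ℝ) / 4 + 3) := by
  apply ofReal_sqrt_le
  refine hx.trans ?_
  rw [← Real.rpow_intCast]
  apply Real.rpow_le_rpow_of_exponent_le (by norm_num)
  have : (2 * e : ℝ) ≤ k + 12 := by exact_mod_cast h
  linarith

/-- `f` lives on a single dyadic block. -/
def OnBlk (f : Plane → ℝ≥0∞) (n l : ℤ) : Prop := ∀ z, f z ≠ 0 → z ∈ blk n l

section
variable {f g h : Plane → ℝ≥0∞} (hf : Measurable f) (hg : Measurable g) (hh : Measurable h)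
  {na nb nc la lb lc : ℤ} (ha : OnBlk f na la) (hb : OnBlk g nb lb) (hc : OnBlk h nc lc)
include hf hg hh ha hb hc

/-- The bound obtained by freezing `z = y + w`, if the width of the slices is at most `d`. The
exponent `k` counts quarters, so that all the exponents are integers; `12` leaves room for the
constants. -/
theorem J_le_c {d : ℝ} {e k : ℤ} (hek : 2 * e ≤ k + 12) (hd : 2 * 2 ^ (min la lb) * d ≤ 2 ^ e)
    (hw : ∀ z ∈ blk nc lc, ∀ y y', y ∈ blk na la → z - y ∈ blk nb lb → y' ∈ blk na la →
      z - y' ∈ blk nb lb → |xi y - xi y'| ≤ d) :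
    J f g h ≤ pw ((k : ℝ) / 4 + 3) * (l2 f * l2 g * l2 h) := by
  refine (J_le_of_volume_c hf hg hh (κ := ENNReal.ofReal (2 * 2 ^ (min la lb) * d)) ?_).trans ?_
  · intro z hz
    refine volume_c_le (na := na) (nb := nb) z (fun y hy => ?_) (fun y hy w hw' => ?_)
    · exact ⟨ha _ (left_ne_zero_of_mul hy), hb _ (right_ne_zero_of_mul hy)⟩
    · exact hw z (hc z hz) y w (ha _ (left_ne_zero_of_mul hy)) (hb _ (right_ne_zero_of_mul hy))
        (ha _ (left_ne_zero_of_mul hw')) (hb _ (right_ne_zero_of_mul hw'))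
  · gcongr
    exact ofReal_sqrt_le_of_zpow hek hd

/-- The bound obtained by freezing the first variable, if the width of the slices is at most `d`.
-/
theorem J_le_a {d : ℝ} {e k : ℤ} (hek : 2 * e ≤ k + 12) (hd : 2 * 2 ^ (min lb lc) * d ≤ 2 ^ e)
    (hw : ∀ y ∈ blk na la, ∀ w w', w ∈ blk nb lb → y + w ∈ blk nc lc → w' ∈ blk nb lb →
      y + w' ∈ blk nc lc → |xi w - xi w'| ≤ d) :
    J f g h ≤ pw ((k : ℝ) / 4 + 3) * (l2 f * l2 g * l2 h) := by
  refine (J_le_of_volume_a hf hg hh (κ := ENNReal.ofReal (2 * 2 ^ (min lb lc) * d)) ?_).trans ?_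
  · intro z hz
    refine volume_a_le (nb := nb) (nc := nc) z (fun y hy => ?_) (fun y hy w hw' => ?_)
    · exact ⟨hb _ (left_ne_zero_of_mul hy), hc _ (right_ne_zero_of_mul hy)⟩
    · exact hw z (ha z hz) y w (hb _ (left_ne_zero_of_mul hy)) (hc _ (right_ne_zero_of_mul hy))
        (hb _ (left_ne_zero_of_mul hw')) (hc _ (right_ne_zero_of_mul hw'))
  · gcongr
    exact ofReal_sqrt_le_of_zpow hek hd

/-- The width of a slice is at most that of the narrower one of the two blocks. -/
theorem J_le_c_trivial :
    J f g h ≤ pw (((2 * (min na nb + min la lb) : ℤ) : ℝ) / 4 + 3) * (l2 f * l2 g * l2 h) := by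
  refine J_le_c hf hg hh ha hb hc (d := 2 ^ (min na nb)) (e := 1 + min la lb + min na nb)
    (by omega) ?_ ?_
  · rw [zpow_add₀ (by norm_num), zpow_add₀ (by norm_num), zpow_one]
  · intro z _ y y' h1 h2 h3 h4
    rcases min_choice na nb with h | h <;> rw [h]
    · exact abs_xi_sub_le h1 h3
    · have := abs_xi_sub_le h4 h2
      simpa using this

theorem J_le_a_trivial :
    J f g h ≤ pw (((2 * (nb + min lb lc) : ℤ) : ℝ) / 4 + 3) * (l2 f * l2 g * l2 h) := by
  refine J_le_a hf hg hh ha hb hc (d := 2 ^ nb) (e := 1 + min lb lc + nb) (by omega) ?_ ?_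
  · rw [zpow_add₀ (by norm_num), zpow_add₀ (by norm_num), zpow_one]
  · intro z _ y y' h1 h2 h3 h4
    exact abs_xi_sub_le h1 h3

/-- For fixed `y` the resonance relation is affine in `xi w`, with slope `2 * xi y`. -/
theorem J_le_a_slope :
    J f g h ≤ pw (((2 * (lb + lc - na) : ℤ) : ℝ) / 4 + 3) * (l2 f * l2 g * l2 h) := by
  refine J_le_a hf hg hh ha hb hc (d := 4 * 2 ^ (max lb lc) / 2 ^ na) (e := 3 + lb + lc - na)
    (by omega) ?_ ?_
  · apply le_of_eq
    have h1 : (2 : ℝ) ^ (min lb lc) * 2 ^ (max lb lc) = 2 ^ (lb + lc) := by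
      rw [← zpow_add₀ (by norm_num), min_add_max]
    rw [show (3 : ℤ) + lb + lc - na = 3 + (lb + lc) - na by ring, zpow_sub₀ (by norm_num),
      zpow_add₀ (by norm_num), ← h1]
    norm_num; ring
  · intro y hy w w' h1 h2 h3 h4
    have ey := xi_bounds hy
    have a1 := sg_bound h1
    have a2 := sg_bound h2
    have a3 := sg_bound h3
    have a4 := sg_bound h4
    have m1 : (2 : ℝ) ^ lb ≤ 2 ^ (max lb lc) :=
      zpow_le_zpow_right₀ (by norm_num) (le_max_left _ _)
    have m2 : (2 : ℝ) ^ lc ≤ 2 ^ (max lb lc) :=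
      zpow_le_zpow_right₀ (by norm_num) (le_max_right _ _)
    rw [sg_eq h1] at a1
    rw [sg_eq h2, xi_add] at a2
    rw [sg_eq h3] at a3
    rw [sg_eq h4, xi_add] at a4
    simp only [PiLp.add_apply] at a2 a4
    have hp : (0 : ℝ) < 2 ^ na := by positivity
    have key : |xi w - xi w'| * (2 * xi y) ≤ 8 * 2 ^ (max lb lc) := by
      rw [← abs_of_pos (by linarith : 0 < 2 * xi y), ← abs_mul]
      rw [abs_lt] at a1 a2 a3 a4
      rw [abs_le]
      constructor <;> nlinarith [a1.1, a2.1, a3.1, a4.1, a1.2, a2.2, a3.2, a4.2]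
    rw [le_div_iff₀ hp]
    nlinarith [abs_nonneg (xi w - xi w')]

omit hf hg hh ha hb hc in
/-- For fixed `z` the sum of the modulations of `y` and `z - y` is a constant minus
`(2 * xi y - xi z) ^ 2 / 2`. -/
theorem abs_sq_sub_sq_le {z y y' : Plane} (h1 : y ∈ blk na la) (h2 : z - y ∈ blk nb lb)
    (h3 : y' ∈ blk na la) (h4 : z - y' ∈ blk nb lb) :
    |(2 * xi y - xi z) ^ 2 - (2 * xi y' - xi z) ^ 2| ≤ 16 * 2 ^ (max la lb) := by
  have a1 := sg_bound h1
  have a2 := sg_bound h2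
  have a3 := sg_bound h3
  have a4 := sg_bound h4
  have m1 : (2 : ℝ) ^ la ≤ 2 ^ (max la lb) :=
    zpow_le_zpow_right₀ (by norm_num) (le_max_left _ _)
  have m2 : (2 : ℝ) ^ lb ≤ 2 ^ (max la lb) :=
    zpow_le_zpow_right₀ (by norm_num) (le_max_right _ _)
  rw [sg_eq h1] at a1
  rw [sg_eq h2, xi_sub] at a2
  rw [sg_eq h3] at a3
  rw [sg_eq h4, xi_sub] at a4
  simp only [PiLp.sub_apply] at a2 a4
  rw [abs_lt] at a1 a2 a3 a4
  rw [abs_le]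
  constructor <;> nlinarith [a1.1, a2.1, a3.1, a4.1, a1.2, a2.2, a3.2, a4.2]

/-- For separated frequencies the difference `xi y - xi (z - y)` has a sign and is of the size of
the largest frequency, so that the resonance relation determines `xi y` precisely. -/
theorem J_le_c_separated (hs : na + 2 ≤ nb ∨ nb + 2 ≤ na) (hnc : nc ≤ max na nb + 1) :
    J f g h ≤ pw (((2 * (la + lb - nc) : ℤ) : ℝ) / 4 + 3) * (l2 f * l2 g * l2 h) := by
  refine J_le_c hf hg hh ha hb hc (d := 32 * 2 ^ (max la lb) / 2 ^ nc) (e := 6 + la + lb - nc)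
    (by omega) ?_ ?_
  · apply le_of_eq
    have h1 : (2 : ℝ) ^ (min la lb) * 2 ^ (max la lb) = 2 ^ (la + lb) := by
      rw [← zpow_add₀ (by norm_num), min_add_max]
    rw [show (6 : ℤ) + la + lb - nc = 6 + (la + lb) - nc by ring, zpow_sub₀ (by norm_num),
      zpow_add₀ (by norm_num), ← h1]
    norm_num; ring
  · intro z hz y y' h1 h2 h3 h4
    have key := abs_sq_sub_sq_le h1 h2 h3 h4
    have hp : (0 : ℝ) < 2 ^ nc := by positivity
    rw [le_div_iff₀ hp]
    have e1 := xi_bounds h1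
    have e2 := xi_bounds h2
    have e3 := xi_bounds h3
    have e4 := xi_bounds h4
    rw [xi_sub] at e2 e4
    -- both summands have the same sign, which depends on the larger one of the two frequencies
    have hsum : (2 : ℝ) ^ nc / 4 ≤ |(2 * xi y - xi z) + (2 * xi y' - xi z)| := by
      rcases hs with hs | hs
      · have m1 : (2 : ℝ) ^ (na + 2) ≤ 2 ^ nb := zpow_le_zpow_right₀ (by norm_num) hs
        have m2 : (2 : ℝ) ^ nc ≤ 2 ^ (nb + 1) :=
          zpow_le_zpow_right₀ (by norm_num) (by omega)
        rw [zpow_add₀ (by norm_num)] at m1 m2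
        norm_num at m1 m2
        rw [le_abs]; right; linarith [e1.2, e2.1, e3.2, e4.1]
      · have m1 : (2 : ℝ) ^ (nb + 2) ≤ 2 ^ na := zpow_le_zpow_right₀ (by norm_num) hs
        have m2 : (2 : ℝ) ^ nc ≤ 2 ^ (na + 1) :=
          zpow_le_zpow_right₀ (by norm_num) (by omega)
        rw [zpow_add₀ (by norm_num)] at m1 m2
        norm_num at m1 m2
        rw [le_abs]; left; linarith [e1.1, e2.2, e3.1, e4.2]
    have hfac : (2 * xi y - xi z) ^ 2 - (2 * xi y' - xi z) ^ 2 =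
        2 * (xi y - xi y') * ((2 * xi y - xi z) + (2 * xi y' - xi z)) := by ring
    rw [hfac, abs_mul, abs_mul, abs_two] at key
    have := mul_le_mul_of_nonneg_left hsum (abs_nonneg (xi y - xi y'))
    linarith

omit hc in
/-- Without separation of the frequencies, the quadratic resonance relation determines `xi y` up to
the square root of the modulations. -/
theorem J_le_c_sqrt :
    J f g h ≤ pw (((2 * min la lb + max la lb : ℤ) : ℝ) / 4 + 3) * (l2 f * l2 g * l2 h) := by
  set s : ℝ := Real.sqrt (16 * 2 ^ (max la lb)) / 2
  have hs0 : 0 ≤ s := by positivity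
  refine (J_le_of_volume_c hf hg hh (κ := ENNReal.ofReal (2 * (2 * 2 ^ (min la lb) * s))) ?_).trans ?_
  · intro z hz
    -- the two signs of `xi y - xi (z - y)` are treated separately
    set E := {y | f y * g (z - y) ≠ 0}
    have hE : ∀ y ∈ E, y ∈ blk na la ∧ z - y ∈ blk nb lb := fun y hy =>
      ⟨ha _ (left_ne_zero_of_mul hy), hb _ (right_ne_zero_of_mul hy)⟩
    have hcov : E ⊆ (E ∩ {y | 0 ≤ 2 * xi y - xi z}) ∪ (E ∩ {y | 2 * xi y - xi z ≤ 0}) := by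
      intro y hy
      rcases le_total 0 (2 * xi y - xi z) with h0 | h0
      · exact Or.inl ⟨hy, h0⟩
      · exact Or.inr ⟨hy, h0⟩
    have hwid : ∀ y ∈ E, ∀ y' ∈ E, 0 ≤ (2 * xi y - xi z) * (2 * xi y' - xi z) →
        |xi y - xi y'| ≤ s := by
      intro y hy y' hy' hsign
      have key := abs_sq_sub_sq_le (hE y hy).1 (hE y hy).2 (hE y' hy').1 (hE y' hy').2
      have h5 : (2 * (xi y - xi y')) ^ 2 ≤ 16 * 2 ^ (max la lb) := by
        refine le_trans ?_ key
        rw [le_abs]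
        rcases le_total ((2 * xi y' - xi z) ^ 2) ((2 * xi y - xi z) ^ 2) with h6 | h6
        · left
          have : |2 * xi y' - xi z| ≤ |2 * xi y - xi z| := sq_le_sq.1 h6
          have h7 : (2 * xi y' - xi z) ^ 2 ≤ (2 * xi y - xi z) * (2 * xi y' - xi z) := by
            rw [← abs_of_nonneg hsign, abs_mul, ← sq_abs]
            nlinarith [abs_nonneg (2 * xi y' - xi z)]
          nlinarith
        · right
          have : |2 * xi y - xi z| ≤ |2 * xi y' - xi z| := sq_le_sq.1 h6
          have h7 : (2 * xi y - xi z) ^ 2 ≤ (2 * xi y - xi z) * (2 * xi y' - xi z) := by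
            rw [← abs_of_nonneg hsign, abs_mul, ← sq_abs (2 * xi y - xi z)]
            nlinarith [abs_nonneg (2 * xi y - xi z)]
          nlinarith
      have h8 := Real.abs_le_sqrt h5
      rw [abs_mul, abs_two] at h8
      simp only [s]; linarith
    refine (measure_mono hcov).trans ((measure_union_le _ _).trans ?_)
    rw [two_mul, ENNReal.ofReal_add (by positivity) (by positivity)]
    refine add_le_add ?_ ?_
    · exact volume_c_le z (fun y hy => hE y hy.1)
        (fun y hy y' hy' => hwid y hy.1 y' hy'.1 (mul_nonneg hy.2 hy'.2))
    · exact volume_c_le z (fun y hy => hE y hy.1)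
        (fun y hy y' hy' => hwid y hy.1 y' hy'.1 (mul_nonneg_of_nonpos_of_nonpos hy.2 hy'.2))
  · gcongr
    apply ofReal_sqrt_le
    have h1 : s = 2 * 2 ^ (((max la lb : ℤ) : ℝ) / 2) := by
      simp only [s]
      rw [Real.sqrt_mul (by norm_num), show (16 : ℝ) = 4 ^ 2 by norm_num,
        Real.sqrt_sq (by norm_num), Real.sqrt_eq_rpow, ← Real.rpow_intCast,
        ← Real.rpow_mul (by norm_num)]
      ring_nf
    have h2 : (2 : ℝ) * (2 * 2 ^ (min la lb) * s) =
        2 ^ (((2 * min la lb + max la lb : ℤ) : ℝ) / 2 + 3) := by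
      rw [h1, ← Real.rpow_intCast, Real.rpow_add (by norm_num),
        show ((2 * min la lb + max la lb : ℤ) : ℝ) / 2 =
          ((min la lb : ℤ) : ℝ) + ((max la lb : ℤ) : ℝ) / 2 by push_cast; ring,
        Real.rpow_add (by norm_num)]
      norm_num; ring
    rw [h2]
    exact Real.rpow_le_rpow_of_exponent_le (by norm_num) (by linarith)

end

theorem J_le_b_trivial {f g h : Plane → ℝ≥0∞} (hf : Measurable f) (hg : Measurable g)
    (hh : Measurable h) {na nb nc la lb lc : ℤ} (ha : OnBlk f na la) (hb : OnBlk g nb lb)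
    (hc : OnBlk h nc lc) :
    J f g h ≤ pw (((2 * (na + min la lc) : ℤ) : ℝ) / 4 + 3) * (l2 f * l2 g * l2 h) := by
  rw [J_comm hf hg hh, mul_comm (l2 f)]
  exact J_le_a_trivial hg hf hh hb ha hc

theorem J_le_b_slope {f g h : Plane → ℝ≥0∞} (hf : Measurable f) (hg : Measurable g)
    (hh : Measurable h) {na nb nc la lb lc : ℤ} (ha : OnBlk f na la) (hb : OnBlk g nb lb)
    (hc : OnBlk h nc lc) :
    J f g h ≤ pw (((2 * (la + lc - nb) : ℤ) : ℝ) / 4 + 3) * (l2 f * l2 g * l2 h) := by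
  rw [J_comm hf hg hh, mul_comm (l2 f)]
  exact J_le_a_slope hg hf hh hb ha hc

/-- The frequency and resonance constraints under which blocks interact. -/
structure Interact (na nb nc la lb lc : ℤ) : Prop where
  le_nc : max na nb ≤ nc
  nc_le : nc ≤ max na nb + 1
  la_nonneg : 0 ≤ la
  lb_nonneg : 0 ≤ lb
  lc_nonneg : 0 ≤ lc
  resonance : na + nb - 1 ≤ max la (max lb lc)

/-- The bound `resonance` expresses the identity `(ξ + η) ^ 2 - ξ ^ 2 - η ^ 2 = 2 * ξ * η`. -/
theorem interact_of_mem {na nb nc la lb lc : ℤ} {y w : Plane} (hy : y ∈ blk na la)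
    (hw : w ∈ blk nb lb) (hyw : y + w ∈ blk nc lc) : Interact na nb nc la lb lc := by
  have e1 := xi_bounds hy
  have e2 := xi_bounds hw
  have e3 := xi_bounds hyw
  have a1 := sg_bound hy
  have a2 := sg_bound hw
  have a3 := sg_bound hyw
  rw [sg_eq hy] at a1
  rw [sg_eq hw] at a2
  rw [sg_eq hyw, xi_add] at a3
  simp only [PiLp.add_apply] at a3
  rw [xi_add] at e3
  have pa : (0 : ℝ) < 2 ^ na := by positivity
  have pb : (0 : ℝ) < 2 ^ nb := by positivity
  have lt_of {m k : ℤ} (h : (2 : ℝ) ^ m < 2 ^ k) : m < k :=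
    (zpow_lt_zpow_iff_right₀ (by norm_num : (1 : ℝ) < 2)).1 h
  have two_mul_zpow (m : ℤ) : (2 : ℝ) * 2 ^ m = 2 ^ (m + 1) := by
    rw [zpow_add_one₀ (by norm_num), mul_comm]
  refine ⟨?_, ?_, hy.2.2 ▸ fl_nonneg y, hw.2.2 ▸ fl_nonneg w, hyw.2.2 ▸ fl_nonneg _, ?_⟩
  · have h1 : na < nc + 1 := lt_of (by rw [← two_mul_zpow]; linarith [e1.1, e2.1, e3.2])
    have h2 : nb < nc + 1 := lt_of (by rw [← two_mul_zpow]; linarith [e1.1, e2.1, e3.2])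
    omega
  · have m1 : (2 : ℝ) ^ na ≤ 2 ^ (max na nb) :=
      zpow_le_zpow_right₀ (by norm_num) (le_max_left _ _)
    have m2 : (2 : ℝ) ^ nb ≤ 2 ^ (max na nb) :=
      zpow_le_zpow_right₀ (by norm_num) (le_max_right _ _)
    have : nc < max na nb + 1 + 1 := lt_of (by
      rw [← two_mul_zpow, ← two_mul_zpow]; linarith [e1.2, e2.2, e3.1])
    omega
  · set L := max la (max lb lc)
    have m1 : (2 : ℝ) ^ la ≤ 2 ^ L := zpow_le_zpow_right₀ (by norm_num) (by omega)
    have m2 : (2 : ℝ) ^ lb ≤ 2 ^ L := zpow_le_zpow_right₀ (by norm_num) (by omega)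
    have m3 : (2 : ℝ) ^ lc ≤ 2 ^ L := zpow_le_zpow_right₀ (by norm_num) (by omega)
    have : na + nb + 1 < L + 1 + 1 + 1 := lt_of (by
      rw [← two_mul_zpow, ← two_mul_zpow, ← two_mul_zpow, ← two_mul_zpow,
        zpow_add₀ (by norm_num)]
      rw [abs_lt] at a1 a2 a3
      have := mul_le_mul e1.1 e2.1 pb.le (pa.le.trans e1.1)
      nlinarith [a1.1, a1.2, a2.1, a2.2, a3.1, a3.2])
    omega

/-- Four times the binary logarithm of a bound for the norm of the trilinear form on given blocks,
up to a constant. The last entry is new only for separated frequencies; otherwise it repeats the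
fourth. -/
def kraw (na nb nc la lb lc : ℤ) : ℤ :=
  min (2 * (min na nb + min la (min lb lc))) (min (2 * (lb + lc - na)) (min (2 * (la + lc - nb))
    (min (2 * min la lb + max la lb)
      (if na + 2 ≤ nb ∨ nb + 2 ≤ na then 2 * (la + lb - nc) else 2 * min la lb + max la lb))))

/-- The normalization of `kraw` for functions weighted by the square roots of their
modulations. -/
def kexp (na nb nc la lb lc : ℤ) : ℤ := kraw na nb nc la lb lc - 2 * (la + lb + lc)

open Classical in
/-- A bound for the norm of the trilinear form on given blocks, up to a constant, for functions
normalized by the square roots of their modulations. It is zero if the blocks do not interact. -/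
noncomputable def kern (na nb nc la lb lc : ℤ) : ℝ≥0∞ :=
  if Interact na nb nc la lb lc then pw ((kexp na nb nc la lb lc : ℝ) / 4) else 0

/-- The bound of the trilinear form on dyadic blocks. -/
theorem J_le_kern {f g h : Plane → ℝ≥0∞} (hf : Measurable f) (hg : Measurable g)
    (hh : Measurable h) {na nb nc la lb lc : ℤ} (ha : OnBlk f na la) (hb : OnBlk g nb lb)
    (hc : OnBlk h nc lc) :
    J f g h ≤ 8 * kern na nb nc la lb lc * (pw ((la : ℝ) / 2) * l2 f) *
      (pw ((lb : ℝ) / 2) * l2 g) * (pw ((lc : ℝ) / 2) * l2 h) := by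
  by_cases hI : Interact na nb nc la lb lc
  · set k := kexp na nb nc la lb lc + 2 * (la + lb + lc) with hk
    have key : J f g h ≤ pw ((k : ℝ) / 4 + 3) * (l2 f * l2 g * l2 h) := by
      have h1 := J_le_c_trivial hf hg hh ha hb hc
      have h2 := J_le_a_trivial hf hg hh ha hb hc
      have h3 := J_le_b_trivial hf hg hh ha hb hc
      have h4 := J_le_a_slope hf hg hh ha hb hc
      have h5 := J_le_b_slope hf hg hh ha hb hc
      have h6 := J_le_c_sqrt hf hg hh ha hb
      have h7 := fun hs => J_le_c_separated hf hg hh ha hb hc hs hI.nc_le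
      have hk' : k = kraw na nb nc la lb lc := by rw [hk, kexp]; ring
      rw [hk']
      set P : ℤ → Prop := fun m => J f g h ≤ pw ((m : ℝ) / 4 + 3) * (l2 f * l2 g * l2 h)
      have h0 : P (2 * (min na nb + min la (min lb lc))) := by
        rcases le_total na nb with hab | hab
        · rw [min_eq_left hab] at h1 ⊢
          rcases le_total lb lc with hbc | hbc
          · rwa [min_eq_left hbc]
          · rwa [min_eq_right hbc]
        · rw [min_eq_right hab] at h1 ⊢
          rcases le_total la lc with hac | hac
          · rw [min_left_comm, min_eq_left hac, min_comm]
            exact h1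
          · rw [min_left_comm, min_eq_right hac]
            exact h2
      refine min_rec' P h0 (min_rec' P h4 (min_rec' P h5 (min_rec' P h6 ?_)))
      split_ifs with hs
      · exact h7 hs
      · exact h6
    refine key.trans (le_of_eq ?_)
    rw [kern, if_pos hI]
    have : ((k : ℝ) / 4 + 3) = 3 + (kexp na nb nc la lb lc : ℝ) / 4 + la / 2 + lb / 2 + lc / 2 := by
      rw [hk]; push_cast; ring
    rw [this, pw_add, pw_add, pw_add, pw_add]
    have h8 : pw 3 = 8 := by
      rw [pw, show (3 : ℝ) = ((3 : ℕ) : ℝ) by norm_num, ENNReal.rpow_natCast]; norm_num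
    rw [h8]; ring
  · have : J f g h = 0 := by
      have h0 : ∀ y w, f y * g w * h (y + w) = 0 := by
        intro y w
        by_contra hne
        exact hI (interact_of_mem (ha y (left_ne_zero_of_mul (left_ne_zero_of_mul hne)))
          (hb w (right_ne_zero_of_mul (left_ne_zero_of_mul hne))) (hc _ (right_ne_zero_of_mul hne)))
      simp [J, h0]
    rw [this]; exact zero_le

/-! ### Arithmetic of the dyadic exponents -/

/-- The upper bounds on `kexp`, one for each of the ways to apply the Cauchy-Schwarz inequality. -/
structure KBounds (na nb nc la lb lc t : ℤ) : Prop where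
  a_ab : t ≤ 2 * (na - la - lb)
  a_ac : t ≤ 2 * (na - la - lc)
  a_bc : t ≤ 2 * (na - lb - lc)
  b_ab : t ≤ 2 * (nb - la - lb)
  b_ac : t ≤ 2 * (nb - la - lc)
  b_bc : t ≤ 2 * (nb - lb - lc)
  slope_a : t ≤ -2 * (la + na)
  slope_b : t ≤ -2 * (lb + nb)
  sqrt_a : t ≤ -2 * lc - la
  sqrt_b : t ≤ -2 * lc - lb
  sep : t ≤ -2 * (lc + nc) ∨ (na ≤ nb + 1 ∧ nb ≤ na + 1)

theorem kbounds (na nb nc la lb lc : ℤ) :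
    KBounds na nb nc la lb lc (kexp na nb nc la lb lc) := by
  have h1 : kraw na nb nc la lb lc ≤ 2 * (min na nb + min la (min lb lc)) := min_le_left _ _
  have h2 : kraw na nb nc la lb lc ≤ 2 * (lb + lc - na) :=
    (min_le_right _ _).trans (min_le_left _ _)
  have h3 : kraw na nb nc la lb lc ≤ 2 * (la + lc - nb) :=
    (min_le_right _ _).trans ((min_le_right _ _).trans (min_le_left _ _))
  have h4 : kraw na nb nc la lb lc ≤ 2 * min la lb + max la lb :=
    (min_le_right _ _).trans ((min_le_right _ _).trans ((min_le_right _ _).trans (min_le_left _ _)))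
  have h5 : kraw na nb nc la lb lc ≤
      (if na + 2 ≤ nb ∨ nb + 2 ≤ na then 2 * (la + lb - nc) else 2 * min la lb + max la lb) :=
    (min_le_right _ _).trans
      ((min_le_right _ _).trans ((min_le_right _ _).trans (min_le_right _ _)))
  have hk : kexp na nb nc la lb lc = kraw na nb nc la lb lc - 2 * (la + lb + lc) := rfl
  generalize kraw na nb nc la lb lc = k at *
  generalize kexp na nb nc la lb lc = t at *
  refine ⟨?_, ?_, ?_, ?_, ?_, ?_, ?_, ?_, ?_, ?_, ?_⟩
  all_goals omega

theorem abs_le_add {x c : ℤ} (hc : 0 ≤ c) (h : -c ≤ x) : |x| ≤ x + 2 * c := by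
  rcases abs_cases x with ⟨h1, _⟩ | ⟨h1, _⟩ <;> omega

theorem abs_le_sub {x c : ℤ} (hc : 0 ≤ c) (h : x ≤ c) : |x| ≤ 2 * c - x := by
  rcases abs_cases x with ⟨h1, _⟩ | ⟨h1, _⟩ <;> omega

theorem abs_le_const {x : ℤ} (c : ℤ) (h : -c ≤ x) (h' : x ≤ c) : |x| ≤ c := abs_le.2 ⟨h, h'⟩

/-- The size of a quadruple of integers. Quadruples stand for the differences of dyadic indices in
which a bound decays; unused entries are zero. -/
def nrm (a : ℤ × ℤ × ℤ × ℤ) : ℤ := |a.1| + |a.2.1| + |a.2.2.1| + |a.2.2.2|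

theorem near_of_high {n1 n2 : ℤ} (h1 : max n1 0 ≤ max n2 0 + 3) (h2 : max n2 0 ≤ max n1 0 + 3)
    (hlow : ¬(n1 ≤ 3 ∧ n2 ≤ 3)) : n1 ≤ n2 + 3 ∧ n2 ≤ n1 + 3 ∧ 1 ≤ n1 ∧ 1 ≤ n2 := by omega

/-- Decay for the remainder with frequencies of equal sign, where the largest frequency is that of
the output. `w / 4` is the exponent of the symbol and `t / 4` that of `kern`. The alternatives
correspond to low frequencies, to a large modulation of the output, and to a large modulation of an
input. The constants are far from optimal. -/
theorem remainder_pos {n1 n2 n l1 l2 l t w c : ℤ} (hI : Interact n1 n2 n l1 l2 l)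
    (ht : KBounds n1 n2 n l1 l2 l t) (h1 : max n1 0 ≤ max n2 0 + 3) (h2 : max n2 0 ≤ max n1 0 + 3)
    (hw : w ≤ 4 * n - 2 * max n 0 + 2 * max n2 0 + c) :
    16 * (w + t) + nrm (n1, n2, n, l) ≤ 16 * c + 2000 ∨
    16 * (w + t) + nrm (l - 2 * n1, n1 - n2, n - n2, 0) ≤ 16 * c + 2000 ∨
    16 * (w + t) + nrm (l, n1 - n2, n - n2, 0) ≤ 16 * c + 2000 := by
  obtain ⟨i1, i2, i3, i4, i5, i6⟩ := hI
  obtain ⟨t1, t2, t3, t4, t5, t6, t7, t8, t9, t10, t11⟩ := ht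
  have hp := le_max_left n 0
  have hp0 := le_max_right n 0
  simp only [nrm, abs_zero]
  have al : |l| ≤ l := (abs_of_nonneg i5).le
  by_cases hlow : n1 ≤ 3 ∧ n2 ≤ 3
  · left
    have a1 := abs_le_sub (x := n1) (c := 3) (by norm_num) hlow.1
    have a2 := abs_le_sub (x := n2) (c := 3) (by norm_num) hlow.2
    have a3 := abs_le_sub (x := n) (c := 4) (by norm_num) (by omega)
    have : max n2 0 ≤ 3 := by omega
    rcases le_total n1 n2 with h | h
    · have : n ≤ n2 + 1 := by omega
      have : n2 ≤ n := by omega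
      linarith
    · have : n ≤ n1 + 1 := by omega
      have : n1 ≤ n := by omega
      linarith
  right
  obtain ⟨b1, b2, b3, b4⟩ := near_of_high h1 h2 hlow
  have e1 : n1 ≤ n ∧ n2 ≤ n ∧ n ≤ n1 + 4 ∧ n ≤ n2 + 4 := by omega
  have a1 := abs_le_const (x := n1 - n2) 3 (by omega) (by omega)
  have a2 := abs_le_const (x := n - n2) 4 (by omega) (by omega)
  have e2 : max n2 0 = n2 := by omega
  have e3 : max n 0 = n := by omega
  rw [e2, e3] at hw
  rcases le_max_iff.1 i6 with h | h
  · right; linarith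
  rcases le_max_iff.1 h with h | h
  · right; linarith
  · left
    have a3 := abs_le_add (x := l - 2 * n1) (c := 4) (by norm_num) (by omega)
    rcases t11 with h' | h'
    · linarith
    · have := t9
      linarith

/-- Decay for the remainder with frequencies of opposite signs: the largest frequency is that of
`u`, so that the indices of `u` and of the output are interchanged in `Interact`. -/
theorem remainder_neg {n1 n2 n l1 l2 l t w c : ℤ} (hI : Interact n1 n n2 l1 l l2)
    (ht : KBounds n1 n n2 l1 l l2 t) (h1 : max n1 0 ≤ max n2 0 + 3) (h2 : max n2 0 ≤ max n1 0 + 3)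
    (hw : w ≤ 4 * n - 2 * max n 0 + 2 * max n2 0 + c) :
    16 * (w + t) + nrm (n, n1 - n2, l, 0) ≤ 16 * c + 2000 ∨
    16 * (w + t) + nrm (n, n1 - n2, l - n2 - n, 0) ≤ 16 * c + 2000 ∨
    16 * (w + t) + nrm (n - n2, n1 - n2, l, 0) ≤ 16 * c + 2000 := by
  obtain ⟨i1, i2, i3, i4, i5, i6⟩ := hI
  obtain ⟨t1, t2, t3, t4, t5, t6, t7, t8, t9, t10, t11⟩ := ht
  have hp0 := le_max_right n 0
  simp only [nrm, abs_zero]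
  have al : |l| ≤ l := (abs_of_nonneg i4).le
  by_cases hlow : n1 ≤ 3 ∧ n2 ≤ 3
  · left
    have a1 := abs_le_sub (x := n1 - n2) (c := 0) (by norm_num) (by omega)
    have a3 := abs_le_sub (x := n) (c := 3) (by norm_num) (by omega)
    have : max n2 0 ≤ 3 := by omega
    rcases le_total n1 n with h | h
    · have : n2 ≤ n + 1 := by omega
      have : n ≤ 3 := by omega
      linarith
    · have : n2 ≤ n1 + 1 := by omega
      linarith
  obtain ⟨b1, b2, b3, b4⟩ := near_of_high h1 h2 hlow
  have e1 : n ≤ n2 := by omega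
  have a1 := abs_le_const (x := n1 - n2) 3 (by omega) (by omega)
  have e2 : max n2 0 = n2 := by omega
  rw [e2] at hw
  rcases le_or_gt 0 n with hn | hn
  · have e3 : max n 0 = n := by omega
    rw [e3] at hw
    have a2 : |n| ≤ n := (abs_of_nonneg hn).le
    rcases le_max_iff.1 i6 with h | h
    · left; linarith
    rcases le_max_iff.1 h with h | h
    · right; left
      have a3 := abs_le_add (x := l - n2 - n) (c := 4) (by norm_num) (by omega)
      linarith
    · rcases t11 with h' | h'
      · left; linarith
      · right; right
        have a3 := abs_le_const (x := n - n2) 4 (by omega) (by omega)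
        linarith
  · have a2 := abs_le_sub (x := n) (c := 0) (by norm_num) (by omega)
    rcases le_max_iff.1 i6 with h | h
    · left; linarith
    rcases le_max_iff.1 h with h | h
    · right; left
      have a3 := abs_le_add (x := l - n2 - n) (c := 4) (by norm_num) (by omega)
      linarith
    · left; linarith

/-- Decay for the paraproduct with frequencies of equal sign. The alternatives correspond to the
position of the largest modulation and to the sign of `n1`. -/
theorem paraproduct_pos {n1 n2 n l1 l2 l t w c : ℤ} (hI : Interact n1 n2 n l1 l2 l)
    (ht : KBounds n1 n2 n l1 l2 l t) (h1 : 1 ≤ n2) (h2 : n1 ≤ n2 + 1)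
    (hw : w ≤ 2 * n2 + 2 * max n1 0 - 40 * (n2 - n) + c) :
    16 * (w + t) + nrm (n2 - n1, l - n1 - n2, n - n2, 0) ≤ 16 * c + 2000 ∨
    16 * (w + t) + nrm (l1 - n1 - n2, l, n - n2, 0) ≤ 16 * c + 2000 ∨
    16 * (w + t) + nrm (l2 - n1 - n2, l, n - n2, 0) ≤ 16 * c + 2000 ∨
    16 * (w + t) + nrm (n2 - n1, l, n - n2, 0) ≤ 16 * c + 2000 ∨
    16 * (w + t) + nrm (n1 + n2, l, n - n2, 0) ≤ 16 * c + 2000 := by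
  obtain ⟨i1, i2, i3, i4, i5, i6⟩ := hI
  obtain ⟨t1, t2, t3, t4, t5, t6, t7, t8, t9, t10, t11⟩ := ht
  simp only [nrm, abs_zero]
  have al : |l| ≤ l := (abs_of_nonneg i5).le
  have e1 : n2 ≤ n ∧ n ≤ n2 + 2 := by omega
  have a1 := abs_le_const (x := n - n2) 2 (by omega) (by omega)
  have a2 := abs_le_add (x := n2 - n1) (c := 1) (by norm_num) (by omega)
  rcases le_or_gt 0 n1 with hn | hn
  · have e3 : max n1 0 = n1 := by omega
    rw [e3] at hw
    rcases le_max_iff.1 i6 with h | h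
    · right; left
      have a3 := abs_le_add (x := l1 - n1 - n2) (c := 1) (by norm_num) (by omega)
      linarith
    rcases le_max_iff.1 h with h | h
    · right; right; right; left
      linarith
    · left
      have a3 := abs_le_add (x := l - n1 - n2) (c := 1) (by norm_num) (by omega)
      rcases t11 with h' | h'
      · linarith
      · have := t9
        linarith
  · have e3 : max n1 0 = 0 := by omega
    rw [e3] at hw
    by_cases h : n1 + n2 - 1 ≤ l1
    · right; left
      have a3 := abs_le_add (x := l1 - n1 - n2) (c := 1) (by norm_num) (by omega)
      linarith
    by_cases h' : n1 + n2 - 1 ≤ l2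
    · right; right; left
      have a3 := abs_le_add (x := l2 - n1 - n2) (c := 1) (by norm_num) (by omega)
      linarith
    · right; right; right; right
      have := t11.resolve_right (by omega)
      have a3 := abs_le_add (x := n1 + n2) (c := 0) (by norm_num) (by omega)
      have : n1 + n2 - 1 ≤ l := by omega
      linarith

/-- Decay for the paraproduct with frequencies of opposite signs. The output frequency may be much
smaller than that of `u`; the term `40 * (n2 - n)` of the weight compensates for all losses in `n2
- n`. -/
theorem paraproduct_neg {n1 n2 n l1 l2 l t w c : ℤ} (hI : Interact n1 n n2 l1 l l2)
    (ht : KBounds n1 n n2 l1 l l2 t) (h1 : 1 ≤ n2)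
    (hw : w ≤ 2 * n2 + 2 * max n1 0 - 40 * (n2 - n) + c) :
    16 * (w + t) + nrm (n2 - n1, l - n1 - n, n - n2, 0) ≤ 16 * c + 2000 ∨
    16 * (w + t) + nrm (l1 - n1 - n2, l, n - n2, 0) ≤ 16 * c + 2000 ∨
    16 * (w + t) + nrm (l2 - n1 - n2, l, n - n2, 0) ≤ 16 * c + 2000 ∨
    16 * (w + t) + nrm (n2 - n1, l, n - n2, 0) ≤ 16 * c + 2000 ∨
    16 * (w + t) + nrm (n1 + n2, l, n - n2, 0) ≤ 16 * c + 2000 := by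
  obtain ⟨i1, i2, i3, i4, i5, i6⟩ := hI
  obtain ⟨t1, t2, t3, t4, t5, t6, t7, t8, t9, t10, t11⟩ := ht
  simp only [nrm, abs_zero]
  have al : |l| ≤ l := (abs_of_nonneg i4).le
  have e1 : n ≤ n2 ∧ n1 ≤ n2 := by omega
  have a1 := abs_le_sub (x := n - n2) (c := 0) (by norm_num) (by omega)
  have a2 := abs_le_add (x := n2 - n1) (c := 0) (by norm_num) (by omega)
  rcases le_or_gt 0 n1 with hn | hn
  · have e3 : max n1 0 = n1 := by omega
    rw [e3] at hw
    rcases le_max_iff.1 i6 with h | h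
    · right; left
      have a3 := abs_le_add (x := l1 - n1 - n2) (c := n2 - n + 1) (by omega) (by omega)
      linarith
    rcases le_max_iff.1 h with h | h
    · left
      have a3 := abs_le_add (x := l - n1 - n) (c := 1) (by norm_num) (by omega)
      linarith
    · right; right; right; left
      rcases t11 with h' | h'
      · linarith
      · have := t10
        linarith
  · have e3 : max n1 0 = 0 := by omega
    rw [e3] at hw
    have e4 : n2 ≤ n + 1 := by omega
    by_cases h : n1 + n2 - 2 ≤ l1
    · right; left
      have a3 := abs_le_add (x := l1 - n1 - n2) (c := 2) (by norm_num) (by omega)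
      linarith
    by_cases h' : n1 + n2 - 2 ≤ l2
    · right; right; left
      have a3 := abs_le_add (x := l2 - n1 - n2) (c := 2) (by norm_num) (by omega)
      linarith
    · right; right; right; right
      have a3 := abs_le_add (x := n1 + n2) (c := 0) (by norm_num) (by omega)
      have : n1 + n2 - 2 ≤ l := by omega
      linarith

/-- Decay for the paraproduct with frequencies of equal sign and `v` of regularity `-1`. Here the
quadruples have to determine also the modulations of the inputs. -/
theorem paraproduct_l2_pos {n1 n2 n l1 l2 l t w c : ℤ} (hI : Interact n1 n2 n l1 l2 l)
    (ht : KBounds n1 n2 n l1 l2 l t) (h1 : 1 ≤ n2) (h2 : n1 ≤ n2 + 1)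
    (hw : w ≤ 4 * max n1 0 - 40 * (n2 - n) + c) :
    16 * (w + t) + nrm (n1 - n2, l1 - l2, l, n - n2) ≤ 16 * c + 2000 ∨
    16 * (w + t) + nrm (n1 - n2, l - n1 - n2, l1 - l2, n - n2) ≤ 16 * c + 2000 ∨
    16 * (w + t) + nrm (n1 - n2, l1 - l2 - n1 - n2, l, n - n2) ≤ 16 * c + 2000 ∨
    16 * (w + t) + nrm (n1 - n2, l2 - l1 - n1 - n2, l, n - n2) ≤ 16 * c + 2000 := by
  obtain ⟨i1, i2, i3, i4, i5, i6⟩ := hI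
  obtain ⟨t1, t2, t3, t4, t5, t6, t7, t8, t9, t10, t11⟩ := ht
  simp only [nrm]
  have al : |l| ≤ l := (abs_of_nonneg i5).le
  have e1 : n2 ≤ n ∧ n ≤ n2 + 2 := by omega
  have a1 := abs_le_const (x := n - n2) 2 (by omega) (by omega)
  have a2 := abs_le_sub (x := n1 - n2) (c := 1) (by norm_num) (by omega)
  have a4 : |l1 - l2| ≤ l1 + l2 := abs_le.2 ⟨by omega, by omega⟩
  rcases le_or_gt 0 n1 with hn | hn
  · have e3 : max n1 0 = n1 := by omega
    rw [e3] at hw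
    right
    rcases le_max_iff.1 i6 with h | h
    · right; left
      have a3 : |l1 - l2 - n1 - n2| ≤ (l1 - n1 - n2) + 2 + l2 := abs_le.2 ⟨by omega, by omega⟩
      linarith
    rcases le_max_iff.1 h with h | h
    · right; right
      have a3 : |l2 - l1 - n1 - n2| ≤ (l2 - n1 - n2) + 2 + l1 := abs_le.2 ⟨by omega, by omega⟩
      linarith
    · left
      have a3 := abs_le_add (x := l - n1 - n2) (c := 1) (by norm_num) (by omega)
      rcases t11 with h' | h'
      · linarith
      · have := t9
        linarith
  · have e3 : max n1 0 = 0 := by omega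
    rw [e3] at hw
    left
    rcases le_max_iff.1 i6 with h | h
    · linarith
    rcases le_max_iff.1 h with h | h <;> linarith

/-- Decay for the paraproduct with frequencies of opposite signs and `v` of regularity `-1`. -/
theorem paraproduct_l2_neg {n1 n2 n l1 l2 l t w c : ℤ} (hI : Interact n1 n n2 l1 l l2)
    (ht : KBounds n1 n n2 l1 l l2 t) (h1 : 1 ≤ n2)
    (hw : w ≤ 4 * max n1 0 - 40 * (n2 - n) + c) :
    16 * (w + t) + nrm (n1 - n2, l1 - l2, l, n - n2) ≤ 16 * c + 2000 ∨
    16 * (w + t) + nrm (n1 - n2, l - n1 - n, l1 - l2, n - n2) ≤ 16 * c + 2000 ∨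
    16 * (w + t) + nrm (n1 - n2, l1 - l2 - n1 - n2, l, n - n2) ≤ 16 * c + 2000 ∨
    16 * (w + t) + nrm (n1 - n2, l2 - l1 - n1 - n2, l, n - n2) ≤ 16 * c + 2000 := by
  obtain ⟨i1, i2, i3, i4, i5, i6⟩ := hI
  obtain ⟨t1, t2, t3, t4, t5, t6, t7, t8, t9, t10, t11⟩ := ht
  simp only [nrm]
  have al : |l| ≤ l := (abs_of_nonneg i4).le
  have e1 : n ≤ n2 ∧ n1 ≤ n2 := by omega
  have a1 := abs_le_sub (x := n - n2) (c := 0) (by norm_num) (by omega)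
  have a2 := abs_le_sub (x := n1 - n2) (c := 0) (by norm_num) (by omega)
  have a4 : |l1 - l2| ≤ l1 + l2 := abs_le.2 ⟨by omega, by omega⟩
  rcases le_or_gt 0 n1 with hn | hn
  · have e3 : max n1 0 = n1 := by omega
    rw [e3] at hw
    right
    rcases le_max_iff.1 i6 with h | h
    · right; left
      have a3 : |l1 - l2 - n1 - n2| ≤ (l1 - n1 - n2) + 2 * (n2 - n + 1) + l2 :=
        abs_le.2 ⟨by omega, by omega⟩
      linarith
    rcases le_max_iff.1 h with h | h
    · left
      have a3 := abs_le_add (x := l - n1 - n) (c := 1) (by norm_num) (by omega)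
      linarith
    · right; right
      have a3 : |l2 - l1 - n1 - n2| ≤ (l2 - n1 - n2) + 2 * (n2 - n + 1) + l1 :=
        abs_le.2 ⟨by omega, by omega⟩
      rcases t11 with h' | h'
      · linarith
      · have := t9
        linarith
  · have e3 : max n1 0 = 0 := by omega
    rw [e3] at hw
    have e4 : n2 ≤ n + 1 := by omega
    left
    rcases le_max_iff.1 i6 with h | h
    · linarith
    rcases le_max_iff.1 h with h | h <;> linarith

/-- Decay for the remainder with frequencies of equal sign, also in the modulation of `v`. -/
theorem remainder_l2_pos {n1 n2 n l1 l2 l t w c : ℤ} (hI : Interact n1 n2 n l1 l2 l)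
    (ht : KBounds n1 n2 n l1 l2 l t) (h1 : max n1 0 ≤ max n2 0 + 3) (h2 : max n2 0 ≤ max n1 0 + 3)
    (hw : w ≤ 4 * n - 2 * max n 0 + 2 * max n2 0 + c) :
    16 * (w + t) + nrm (n1 - n2, n - n2, l, l1) ≤ 16 * c + 2000 ∨
    16 * (w + t) + nrm (l - 2 * n1, l1, n1 - n2, n - n2) ≤ 16 * c + 2000 ∨
    16 * (w + t) + nrm (l1 - 2 * n1, l, n1 - n2, n - n2) ≤ 16 * c + 2000 := by
  obtain ⟨i1, i2, i3, i4, i5, i6⟩ := hI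
  obtain ⟨t1, t2, t3, t4, t5, t6, t7, t8, t9, t10, t11⟩ := ht
  have hp := le_max_left n 0
  have hp0 := le_max_right n 0
  simp only [nrm]
  have al : |l| ≤ l := (abs_of_nonneg i5).le
  have al1 : |l1| ≤ l1 := (abs_of_nonneg i3).le
  by_cases hlow : n1 ≤ 3 ∧ n2 ≤ 3
  · left
    have : max n2 0 ≤ 3 := by omega
    rcases le_total n1 n2 with h | h
    · have a1 := abs_le_sub (x := n1 - n2) (c := 0) (by norm_num) (by omega)
      have a2 := abs_le_const (x := n - n2) 1 (by omega) (by omega)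
      have : n ≤ n2 + 1 := by omega
      linarith
    · have a1 := abs_le_add (x := n1 - n2) (c := 0) (by norm_num) (by omega)
      have a2 := abs_le_add (x := n - n2) (c := 0) (by norm_num) (by omega)
      have : n ≤ n1 + 1 := by omega
      linarith
  obtain ⟨b1, b2, b3, b4⟩ := near_of_high h1 h2 hlow
  have e1 : n1 ≤ n ∧ n2 ≤ n ∧ n ≤ n1 + 4 ∧ n ≤ n2 + 4 := by omega
  have a1 := abs_le_const (x := n1 - n2) 3 (by omega) (by omega)
  have a2 := abs_le_const (x := n - n2) 4 (by omega) (by omega)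
  have e2 : max n2 0 = n2 := by omega
  have e3 : max n 0 = n := by omega
  rw [e2, e3] at hw
  rcases le_max_iff.1 i6 with h | h
  · right; right
    have a3 := abs_le_add (x := l1 - 2 * n1) (c := 4) (by norm_num) (by omega)
    linarith
  rcases le_max_iff.1 h with h | h
  · left; linarith
  · right; left
    have a3 := abs_le_add (x := l - 2 * n1) (c := 4) (by norm_num) (by omega)
    rcases t11 with h' | h'
    · linarith
    · have := t9
      linarith

/-- Decay for the remainder with frequencies of opposite signs, also in the modulation of `v`. In
the first alternative the decay only determines `n` in terms of `l1`, but there is an additional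
gain of `2 ^ (-l1 / 4)`; this is where summability of `v` with the exponent `1 / 4` is used. -/
theorem remainder_l2_neg {n1 n2 n l1 l2 l t w c : ℤ} (hI : Interact n1 n n2 l1 l l2)
    (ht : KBounds n1 n n2 l1 l l2 t) (h1 : max n1 0 ≤ max n2 0 + 3) (h2 : max n2 0 ≤ max n1 0 + 3)
    (hw : w ≤ 4 * n - 2 * max n 0 + 2 * max n2 0 + c) :
    16 * (w + t + l1) + nrm (2 * n - l1, l - n2 - n, n1 - n2, 0) ≤ 16 * c + 2000 ∨
    16 * (w + t) + nrm (n, l, l1, n1 - n2) ≤ 16 * c + 2000 ∨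
    16 * (w + t) + nrm (l1 - n2 - n, n, l, n1 - n2) ≤ 16 * c + 2000 ∨
    16 * (w + t) + nrm (n - n2, l, l1, n1 - n2) ≤ 16 * c + 2000 ∨
    16 * (w + t) + nrm (n, l - n2 - n, l1, n1 - n2) ≤ 16 * c + 2000 := by
  obtain ⟨i1, i2, i3, i4, i5, i6⟩ := hI
  obtain ⟨t1, t2, t3, t4, t5, t6, t7, t8, t9, t10, t11⟩ := ht
  have hp0 := le_max_right n 0
  simp only [nrm, abs_zero]
  have al : |l| ≤ l := (abs_of_nonneg i4).le
  have al1 : |l1| ≤ l1 := (abs_of_nonneg i3).le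
  by_cases hlow : n1 ≤ 3 ∧ n2 ≤ 3
  · right; left
    have a1 := abs_le_sub (x := n1 - n2) (c := 0) (by norm_num) (by omega)
    have a3 := abs_le_sub (x := n) (c := 3) (by norm_num) (by omega)
    have : max n2 0 ≤ 3 := by omega
    rcases le_total n1 n with h | h
    · have : n2 ≤ n + 1 := by omega
      have : n ≤ 3 := by omega
      linarith
    · have : n2 ≤ n1 + 1 := by omega
      linarith
  obtain ⟨b1, b2, b3, b4⟩ := near_of_high h1 h2 hlow
  have e1 : n ≤ n2 := by omega
  have a1 := abs_le_const (x := n1 - n2) 3 (by omega) (by omega)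
  have e2 : max n2 0 = n2 := by omega
  rw [e2] at hw
  rcases le_or_gt 0 n with hn | hn
  · have e3 : max n 0 = n := by omega
    rw [e3] at hw
    have a2 : |n| ≤ n := (abs_of_nonneg hn).le
    rcases le_max_iff.1 i6 with h | h
    · right; right; left
      have a3 := abs_le_add (x := l1 - n2 - n) (c := 4) (by norm_num) (by omega)
      linarith
    rcases le_max_iff.1 h with h | h
    · left
      have a3 := abs_le_add (x := l - n2 - n) (c := 4) (by norm_num) (by omega)
      rcases abs_cases (2 * n - l1) with ⟨h5, _⟩ | ⟨h5, _⟩ <;> linarith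
    · rcases t11 with h' | h'
      · right; left; linarith
      · right; right; right; left
        have a3 := abs_le_const (x := n - n2) 4 (by omega) (by omega)
        linarith
  · have a2 := abs_le_sub (x := n) (c := 0) (by norm_num) (by omega)
    rcases le_max_iff.1 i6 with h | h
    · right; right; left
      have a3 := abs_le_add (x := l1 - n2 - n) (c := 4) (by norm_num) (by omega)
      linarith
    rcases le_max_iff.1 h with h | h
    · right; right; right; right
      have a3 := abs_le_add (x := l - n2 - n) (c := 4) (by norm_num) (by omega)
      linarith
    · right; left; linarith

/-! ### The Schur test and summation over blocks -/

/-- The `ℓ²` norm of a family in `[0, ∞]`. -/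
noncomputable def s2 {ι : Type*} (f : ι → ℝ≥0∞) : ℝ≥0∞ := (∑' i, f i ^ 2) ^ (1 / 2 : ℝ)

theorem tsum_mul_le_s2 {ι : Type*} (f g : ι → ℝ≥0∞) : ∑' i, f i * g i ≤ s2 f * s2 g := by
  rw [ENNReal.tsum_eq_iSup_sum]
  refine iSup_le fun s => ?_
  have := ENNReal.inner_le_Lp_mul_Lq s f g Real.HolderConjugate.two_two
  refine this.trans ?_
  simp only [ENNReal.rpow_ofNat]
  unfold s2
  gcongr
  · exact ENNReal.sum_le_tsum s
  · exact ENNReal.sum_le_tsum s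

theorem s2_mul_left {ι : Type*} (c : ℝ≥0∞) (f : ι → ℝ≥0∞) : s2 (fun i => c * f i) = c * s2 f := by
  unfold s2
  simp_rw [mul_pow]
  rw [ENNReal.tsum_mul_left, ENNReal.mul_rpow_of_nonneg _ _ (by norm_num), ← ENNReal.rpow_natCast,
    ← ENNReal.rpow_mul]
  simp

theorem sqrt_mul_sqrt (a : ℝ≥0∞) : a ^ (1 / 2 : ℝ) * a ^ (1 / 2 : ℝ) = a := by
  rw [← ENNReal.rpow_add_of_nonneg _ _ (by norm_num) (by norm_num)]; norm_num

/-- The Schur test. -/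
theorem schur {X Y : Type*} (K : X → Y → ℝ≥0∞) {c : ℝ≥0∞} (h1 : ∀ x, ∑' y, K x y ≤ c)
    (h2 : ∀ y, ∑' x, K x y ≤ c) (f : X → ℝ≥0∞) (g : Y → ℝ≥0∞) :
    ∑' x, ∑' y, K x y * f x * g y ≤ c * s2 f * s2 g := by
  have h3 : ∑' x, ∑' y, K x y * f x * g y = ∑' p : X × Y,
      (K p.1 p.2 ^ (1 / 2 : ℝ) * f p.1) * (K p.1 p.2 ^ (1 / 2 : ℝ) * g p.2) := by
    rw [ENNReal.tsum_prod (f := fun x y =>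
      (K x y ^ (1 / 2 : ℝ) * f x) * (K x y ^ (1 / 2 : ℝ) * g y))]
    congr 1; ext x; congr 1; ext y
    calc K x y * f x * g y = (K x y ^ (1 / 2 : ℝ) * K x y ^ (1 / 2 : ℝ)) * f x * g y := by
          rw [sqrt_mul_sqrt]
      _ = _ := by ring
  have hsq (a b : ℝ≥0∞) : (a ^ (1 / 2 : ℝ) * b) ^ 2 = a * b ^ 2 := by
    rw [mul_pow, sq (a ^ (1 / 2 : ℝ)), sqrt_mul_sqrt]
  rw [h3]
  refine (tsum_mul_le_s2 _ _).trans ?_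
  have h4 : s2 (fun p : X × Y => K p.1 p.2 ^ (1 / 2 : ℝ) * f p.1) ≤ c ^ (1 / 2 : ℝ) * s2 f := by
    unfold s2
    rw [← ENNReal.mul_rpow_of_nonneg _ _ (by norm_num), ← ENNReal.tsum_mul_left]
    simp_rw [hsq]
    rw [ENNReal.tsum_prod (f := fun x y => K x y * f x ^ 2)]
    gcongr with x
    rw [ENNReal.tsum_mul_right]
    gcongr
    exact h1 x
  have h5 : s2 (fun p : X × Y => K p.1 p.2 ^ (1 / 2 : ℝ) * g p.2) ≤ c ^ (1 / 2 : ℝ) * s2 g := by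
    unfold s2
    rw [← ENNReal.mul_rpow_of_nonneg _ _ (by norm_num), ← ENNReal.tsum_mul_left]
    simp_rw [hsq]
    rw [ENNReal.tsum_prod (f := fun x y => K x y * g y ^ 2), ENNReal.tsum_comm]
    gcongr with y
    rw [ENNReal.tsum_mul_right]
    gcongr
    exact h2 y
  calc _ ≤ (c ^ (1 / 2 : ℝ) * s2 f) * (c ^ (1 / 2 : ℝ) * s2 g) := mul_le_mul' h4 h5
    _ = (c ^ (1 / 2 : ℝ) * c ^ (1 / 2 : ℝ)) * s2 f * s2 g := by ring
    _ = _ := by rw [sqrt_mul_sqrt]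

/-- Exponential decay in all four variables. -/
noncomputable def q4 (a : ℤ × ℤ × ℤ × ℤ) : ℝ≥0∞ := pw (-(nrm a : ℝ) / 64)

theorem tsum_pw_neg_lt_top {a : ℝ} (ha : 0 < a) : ∑' n : ℕ, pw (-(a * n)) < ∞ := by
  have h1 : ∀ n : ℕ, pw (-(a * n)) = pw (-a) ^ n := by
    intro n
    rw [← ENNReal.rpow_natCast, pw_rpow]; congr 1; ring
  simp_rw [h1]
  rw [ENNReal.tsum_geometric]
  have : pw (-a) < 1 := by
    have h2 : (2 : ℝ) ^ (-a) < 1 := Real.rpow_lt_one_of_one_lt_of_neg (by norm_num) (by linarith)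
    rw [← ofReal_two_rpow, ENNReal.ofReal_lt_one]; exact h2
  rw [ENNReal.inv_lt_top]
  exact tsub_pos_of_lt this

theorem tsum_pw_neg_abs_lt_top {a : ℝ} (ha : 0 < a) : ∑' k : ℤ, pw (-(a * |(k : ℝ)|)) < ∞ := by
  have hsurj : Function.Surjective fun p : Bool × ℕ => if p.1 then (p.2 : ℤ) else -(p.2 : ℤ) := by
    intro k
    rcases le_total 0 k with h | h
    · exact ⟨(true, k.toNat), by simp [h]⟩
    · exact ⟨(false, (-k).toNat), by simp [h]⟩
  refine (ENNReal.tsum_le_tsum_comp_of_surjective hsurj _).trans_lt ?_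
  rw [ENNReal.tsum_prod (f := fun (b : Bool) (n : ℕ) =>
    pw (-(a * |(((if b then (n : ℤ) else -(n : ℤ)) : ℤ) : ℝ)|)))]
  rw [tsum_bool]
  have := tsum_pw_neg_lt_top ha
  simp only [Bool.false_eq_true, if_false, if_true]
  push_cast
  simp only [abs_neg, Nat.abs_cast]
  exact ENNReal.add_lt_top.2 ⟨this, this⟩

theorem tsum_q4_lt_top : ∑' a, q4 a < ∞ := by
  set S := ∑' k : ℤ, pw (-((1 / 64) * |(k : ℝ)|)) with hS
  have h1 : ∑' a, q4 a = S * (S * (S * S)) := by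
    have h2 : ∀ a, q4 a = pw (-((1 / 64) * |(a.1 : ℝ)|)) * (pw (-((1 / 64) * |(a.2.1 : ℝ)|)) *
        (pw (-((1 / 64) * |(a.2.2.1 : ℝ)|)) * pw (-((1 / 64) * |(a.2.2.2 : ℝ)|)))) := by
      intro a
      rw [← pw_add, ← pw_add, ← pw_add, q4, nrm]
      congr 1; push_cast; ring
    simp_rw [h2]
    rw [ENNReal.tsum_prod', ← ENNReal.tsum_mul_right]
    congr 1; ext x
    dsimp only
    rw [ENNReal.tsum_mul_left, ENNReal.tsum_prod', ← ENNReal.tsum_mul_right]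
    congr 2; ext y
    dsimp only
    rw [ENNReal.tsum_mul_left, ENNReal.tsum_prod', ← ENNReal.tsum_mul_right]
    congr 2; ext z
    dsimp only
    rw [ENNReal.tsum_mul_left]
  have hfin : S < ∞ := tsum_pw_neg_abs_lt_top (by norm_num)
  rw [h1]
  exact ENNReal.mul_lt_top hfin (ENNReal.mul_lt_top hfin (ENNReal.mul_lt_top hfin hfin))

theorem tsum_le_of_options {Z : Type*} {m : ℕ} (K : Z → ℝ≥0∞) (ψ : Fin m → Z → ℤ × ℤ × ℤ × ℤ)
    (hψ : ∀ i, Function.Injective (ψ i)) {c : ℝ≥0∞} (h : ∀ p, ∃ i, K p ≤ c * q4 (ψ i p)) :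
    ∑' z, K z ≤ c * m * ∑' a, q4 a := by
  have h' : ∀ p, K p ≤ ∑ i, c * q4 (ψ i p) := by
    intro p
    obtain ⟨i, hi⟩ := h p
    exact hi.trans (Finset.single_le_sum (f := fun i => c * q4 (ψ i p))
      (fun _ _ => zero_le) (Finset.mem_univ i))
  calc ∑' p, K p ≤ ∑' p, ∑ i, c * q4 (ψ i p) := ENNReal.tsum_le_tsum h'
    _ = ∑ i, ∑' p, c * q4 (ψ i p) := Summable.tsum_finsetSum fun _ _ => ENNReal.summable
    _ ≤ ∑ i : Fin m, c * ∑' a, q4 a := by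
        refine Finset.sum_le_sum fun i _ => ?_
        rw [ENNReal.tsum_mul_left]
        gcongr
        exact ENNReal.tsum_comp_le_tsum_of_injective (hψ i) q4
    _ = _ := by
        rw [Finset.sum_const, Finset.card_univ, Fintype.card_fin, nsmul_eq_mul]; ring

/-- The Schur test for a kernel bounded by finitely many exponentially decaying terms, each of
which is indexed injectively by the summation variables. -/
theorem schur_of_options {X Y O : Type*} {m : ℕ} (φ : Fin m → X → Y → O → ℤ × ℤ × ℤ × ℤ)
    (inj1 : ∀ i x, Function.Injective fun p : Y × O => φ i x p.1 p.2)
    (inj2 : ∀ i y, Function.Injective fun p : X × O => φ i p.1 y p.2)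
    (K : X → Y → O → ℝ≥0∞) {c : ℝ≥0∞} (hK : ∀ x y o, ∃ i, K x y o ≤ c * q4 (φ i x y o))
    (f : X → ℝ≥0∞) (g : Y → ℝ≥0∞) :
    ∑' x, ∑' y, ∑' o, K x y o * f x * g y ≤ c * m * (∑' a, q4 a) * s2 f * s2 g := by
  simp_rw [ENNReal.tsum_mul_right]
  refine schur (fun x y => ∑' o, K x y o) (fun x => ?_) (fun y => ?_) f g
  · rw [← ENNReal.tsum_prod (f := fun y o => K x y o)]
    exact tsum_le_of_options _ (fun i (p : Y × O) => φ i x p.1 p.2) (fun i => inj1 i x)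
      (fun p => hK x p.1 p.2)
  · rw [← ENNReal.tsum_prod (f := fun x o => K x y o)]
    exact tsum_le_of_options _ (fun i (p : X × O) => φ i p.1 y p.2) (fun i => inj2 i y)
      (fun p => hK p.1 y p.2)

/-- The kernel for the block `(n, l)` of the output in terms of the blocks `(n1, l1)` of `v` and
`(n2, l2)` of `u`. For positive `ξ`-frequencies of `v` the output carries the largest frequency,
for negative ones `u` does. -/
noncomputable def kernS (pos : Bool) (n1 n2 n l1 l2 l : ℤ) : ℝ≥0∞ :=
  if pos then kern n1 n2 n l1 l2 l else kern n1 n n2 l1 l l2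

/-- Turns a bound for integer exponents into exponential decay; the factor `64` is `16 * 4`. -/
theorem mul_kern_le {na nb nc la lb lc : ℤ} {W : ℝ≥0∞} {w c : ℤ} {a : ℤ × ℤ × ℤ × ℤ} {r : ℝ}
    (hW : W ≤ pw ((w : ℝ) / 4)) (h : 16 * (w + kexp na nb nc la lb lc) + nrm a ≤ 16 * c + 2000)
    (hr : (16 * c + 2000 : ℝ) / 64 = r) :
    W * kern na nb nc la lb lc ≤ pw r * q4 a := by
  have h1 : kern na nb nc la lb lc ≤ pw ((kexp na nb nc la lb lc : ℝ) / 4) := by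
    unfold kern; split_ifs
    · exact le_rfl
    · exact zero_le
  refine (mul_le_mul' hW h1).trans ?_
  rw [q4, ← pw_add, ← pw_add]
  apply pw_mono
  have : (16 * (w + kexp na nb nc la lb lc) + nrm a : ℝ) ≤ 16 * c + 2000 := by exact_mod_cast h
  rw [← hr]; linarith

theorem interact_of_kern_ne_zero {na nb nc la lb lc : ℤ} (h : kern na nb nc la lb lc ≠ 0) :
    Interact na nb nc la lb lc := by
  by_contra hI
  exact h (by rw [kern, if_neg hI])

/-- The weights occurring for the remainder: `n1`, `n2` and `n` are the frequency indices of `v`,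
of `u` and of the output. The constraint on `n` holds for all interacting blocks. -/
def RemWeight (c : ℤ) (W : ℤ → ℤ → ℤ → ℝ≥0∞) : Prop :=
  ∀ n1 n2 n, n ≤ max n1 n2 + 1 → W n1 n2 n ≠ 0 →
    max n1 0 ≤ max n2 0 + 3 ∧ max n2 0 ≤ max n1 0 + 3 ∧
    W n1 n2 n ≤ pw (((4 * n - 2 * max n 0 + 2 * max n2 0 + c : ℤ) : ℝ) / 4)

/-- The weights occurring for the paraproduct, at the critical regularity `-1 / 2` of `v`. The
factor `2 ^ (-10 * (n2 - n))` comes from the vanishing of the cutoff to infinite order. -/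
def ParaWeight (c : ℤ) (W : ℤ → ℤ → ℤ → ℝ≥0∞) : Prop :=
  ∀ n1 n2 n, n ≤ max n1 n2 + 1 → W n1 n2 n ≠ 0 → 1 ≤ n2 ∧ n1 ≤ n2 + 1 ∧
    W n1 n2 n ≤ pw (((2 * n2 + 2 * max n1 0 - 40 * (n2 - n) + c : ℤ) : ℝ) / 4)

/-- The weights occurring for the paraproduct, at regularity `-1` of `v`. -/
def ParaWeight' (c : ℤ) (W : ℤ → ℤ → ℤ → ℝ≥0∞) : Prop :=
  ∀ n1 n2 n, n ≤ max n1 n2 + 1 → W n1 n2 n ≠ 0 → 1 ≤ n2 ∧ n1 ≤ n2 + 1 ∧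
    W n1 n2 n ≤ pw (((4 * max n1 0 - 40 * (n2 - n) + c : ℤ) : ℝ) / 4)

/-- The sum over all triples of blocks that controls the output norm, where `F` and `G` are the
weighted norms of `v` and `u` on the blocks. -/
noncomputable def total (pos : Bool) (W : ℤ → ℤ → ℤ → ℝ≥0∞) (F G : ℤ → ℤ → ℝ≥0∞) : ℝ≥0∞ :=
  ∑' l1, ∑' l2, ∑' n1, ∑' n2, ∑' o : ℤ × ℤ,
    W n1 n2 o.1 * kernS pos n1 n2 o.1 l1 l2 o.2 * F n1 l1 * G n2 l2

/-- For inputs that are summable in their modulations, it suffices to sum over the frequencies for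
fixed modulations of the inputs. -/
theorem total_le_of_forall {pos : Bool} {W : ℤ → ℤ → ℤ → ℝ≥0∞} {C : ℝ≥0∞}
    (h : ∀ l1 l2 (f g : ℤ → ℝ≥0∞), ∑' n1, ∑' n2, ∑' o : ℤ × ℤ,
      W n1 n2 o.1 * kernS pos n1 n2 o.1 l1 l2 o.2 * f n1 * g n2 ≤ C * s2 f * s2 g)
    (F G : ℤ → ℤ → ℝ≥0∞) :
    total pos W F G ≤ C * (∑' l, s2 fun n => F n l) * ∑' l, s2 fun n => G n l := by
  calc total pos W F G
      ≤ ∑' l1, ∑' l2, C * (s2 fun n => F n l1) * s2 fun n => G n l2 :=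
        ENNReal.tsum_le_tsum fun l1 => ENNReal.tsum_le_tsum fun l2 => h l1 l2 _ _
    _ = _ := by
        simp_rw [ENNReal.tsum_mul_left, ENNReal.tsum_mul_right, ENNReal.tsum_mul_left]

theorem zero_le_option {m : ℕ} [NeZero m] {c : ℝ≥0∞} (a : Fin m → ℤ × ℤ × ℤ × ℤ) :
    ∃ i, (0 : ℝ≥0∞) ≤ c * q4 (a i) := ⟨0, zero_le⟩

/-- Summation over the blocks for the remainder, with both factors summable in the modulation. -/
theorem total_remainder_le (c : ℤ) : ∃ C : ℝ≥0∞, C < ∞ ∧ ∀ (pos : Bool) (W), RemWeight c W →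
    ∀ F G, total pos W F G ≤ C * (∑' l, s2 fun n => F n l) * ∑' l, s2 fun n => G n l := by
  refine ⟨pw ((16 * c + 2000 : ℝ) / 64) * (3 : ℕ) * ∑' a, q4 a,
    ENNReal.mul_lt_top (ENNReal.mul_lt_top (pw_ne_top _).lt_top (by simp)) tsum_q4_lt_top, ?_⟩
  intro pos W hW F G
  refine total_le_of_forall (fun l1 l2 f g => ?_) F G
  cases pos
  · refine schur_of_options (m := 3) (fun i n1 n2 (o : ℤ × ℤ) => ![(o.1, n1 - n2, o.2, 0),
      (o.1, n1 - n2, o.2 - n2 - o.1, 0), (o.1 - n2, n1 - n2, o.2, 0)] i) ?_ ?_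
      (fun n1 n2 o => W n1 n2 o.1 * kernS false n1 n2 o.1 l1 l2 o.2) ?_ f g
    · rintro i n1 ⟨n2, n, l⟩ ⟨n2', n', l'⟩ h
      fin_cases i <;> simp [Prod.ext_iff] at h ⊢ <;> omega
    · rintro i n2 ⟨n1, n, l⟩ ⟨n1', n', l'⟩ h
      fin_cases i <;> simp [Prod.ext_iff] at h ⊢ <;> omega
    · rintro n1 n2 ⟨n, l⟩
      by_cases h0 : W n1 n2 n * kernS false n1 n2 n l1 l2 l = 0
      · rw [h0]; exact zero_le_option _
      have hI := interact_of_kern_ne_zero (right_ne_zero_of_mul h0)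
      obtain ⟨b1, b2, b3⟩ := hW n1 n2 n (by have := hI.le_nc; omega) (left_ne_zero_of_mul h0)
      rcases remainder_neg hI (kbounds _ _ _ _ _ _) b1 b2 le_rfl with h | h | h
      · exact ⟨0, mul_kern_le b3 h rfl⟩
      · exact ⟨1, mul_kern_le b3 h rfl⟩
      · exact ⟨2, mul_kern_le b3 h rfl⟩
  · refine schur_of_options (m := 3) (fun i n1 n2 (o : ℤ × ℤ) => ![(n1, n2, o.1, o.2),
      (o.2 - 2 * n1, n1 - n2, o.1 - n2, 0), (o.2, n1 - n2, o.1 - n2, 0)] i) ?_ ?_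
      (fun n1 n2 o => W n1 n2 o.1 * kernS true n1 n2 o.1 l1 l2 o.2) ?_ f g
    · rintro i n1 ⟨n2, n, l⟩ ⟨n2', n', l'⟩ h
      fin_cases i <;> simp [Prod.ext_iff] at h ⊢ <;> omega
    · rintro i n2 ⟨n1, n, l⟩ ⟨n1', n', l'⟩ h
      fin_cases i <;> simp [Prod.ext_iff] at h ⊢ <;> omega
    · rintro n1 n2 ⟨n, l⟩
      by_cases h0 : W n1 n2 n * kernS true n1 n2 n l1 l2 l = 0
      · rw [h0]; exact zero_le_option _
      have hI := interact_of_kern_ne_zero (right_ne_zero_of_mul h0)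
      obtain ⟨b1, b2, b3⟩ := hW n1 n2 n hI.nc_le (left_ne_zero_of_mul h0)
      rcases remainder_pos hI (kbounds _ _ _ _ _ _) b1 b2 le_rfl with h | h | h
      · exact ⟨0, mul_kern_le b3 h rfl⟩
      · exact ⟨1, mul_kern_le b3 h rfl⟩
      · exact ⟨2, mul_kern_le b3 h rfl⟩

/-- Summation over the blocks for the paraproduct, with both factors summable in the modulation. -/
theorem total_paraproduct_le (c : ℤ) : ∃ C : ℝ≥0∞, C < ∞ ∧ ∀ (pos : Bool) (W), ParaWeight c W →
    ∀ F G, total pos W F G ≤ C * (∑' l, s2 fun n => F n l) * ∑' l, s2 fun n => G n l := by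
  refine ⟨pw ((16 * c + 2000 : ℝ) / 64) * (5 : ℕ) * ∑' a, q4 a,
    ENNReal.mul_lt_top (ENNReal.mul_lt_top (pw_ne_top _).lt_top (by simp)) tsum_q4_lt_top, ?_⟩
  intro pos W hW F G
  refine total_le_of_forall (fun l1 l2 f g => ?_) F G
  cases pos
  · refine schur_of_options (m := 5) (fun i n1 n2 (o : ℤ × ℤ) =>
      ![(n2 - n1, o.2 - n1 - o.1, o.1 - n2, 0), (l1 - n1 - n2, o.2, o.1 - n2, 0),
        (l2 - n1 - n2, o.2, o.1 - n2, 0), (n2 - n1, o.2, o.1 - n2, 0),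
        (n1 + n2, o.2, o.1 - n2, 0)] i) ?_ ?_
      (fun n1 n2 o => W n1 n2 o.1 * kernS false n1 n2 o.1 l1 l2 o.2) ?_ f g
    · rintro i n1 ⟨n2, n, l⟩ ⟨n2', n', l'⟩ h
      fin_cases i <;> simp [Prod.ext_iff] at h ⊢ <;> omega
    · rintro i n2 ⟨n1, n, l⟩ ⟨n1', n', l'⟩ h
      fin_cases i <;> simp [Prod.ext_iff] at h ⊢ <;> omega
    · rintro n1 n2 ⟨n, l⟩
      by_cases h0 : W n1 n2 n * kernS false n1 n2 n l1 l2 l = 0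
      · rw [h0]; exact zero_le_option _
      have hI := interact_of_kern_ne_zero (right_ne_zero_of_mul h0)
      obtain ⟨b1, b2, b3⟩ := hW n1 n2 n (by have := hI.le_nc; omega) (left_ne_zero_of_mul h0)
      rcases paraproduct_neg hI (kbounds _ _ _ _ _ _) b1 le_rfl with h | h | h | h | h
      · exact ⟨0, mul_kern_le b3 h rfl⟩
      · exact ⟨1, mul_kern_le b3 h rfl⟩
      · exact ⟨2, mul_kern_le b3 h rfl⟩
      · exact ⟨3, mul_kern_le b3 h rfl⟩
      · exact ⟨4, mul_kern_le b3 h rfl⟩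
  · refine schur_of_options (m := 5) (fun i n1 n2 (o : ℤ × ℤ) =>
      ![(n2 - n1, o.2 - n1 - n2, o.1 - n2, 0), (l1 - n1 - n2, o.2, o.1 - n2, 0),
        (l2 - n1 - n2, o.2, o.1 - n2, 0), (n2 - n1, o.2, o.1 - n2, 0),
        (n1 + n2, o.2, o.1 - n2, 0)] i) ?_ ?_
      (fun n1 n2 o => W n1 n2 o.1 * kernS true n1 n2 o.1 l1 l2 o.2) ?_ f g
    · rintro i n1 ⟨n2, n, l⟩ ⟨n2', n', l'⟩ h
      fin_cases i <;> simp [Prod.ext_iff] at h ⊢ <;> omega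
    · rintro i n2 ⟨n1, n, l⟩ ⟨n1', n', l'⟩ h
      fin_cases i <;> simp [Prod.ext_iff] at h ⊢ <;> omega
    · rintro n1 n2 ⟨n, l⟩
      by_cases h0 : W n1 n2 n * kernS true n1 n2 n l1 l2 l = 0
      · rw [h0]; exact zero_le_option _
      have hI := interact_of_kern_ne_zero (right_ne_zero_of_mul h0)
      obtain ⟨b1, b2, b3⟩ := hW n1 n2 n hI.nc_le (left_ne_zero_of_mul h0)
      rcases paraproduct_pos hI (kbounds _ _ _ _ _ _) b1 b2 le_rfl with h | h | h | h | h
      · exact ⟨0, mul_kern_le b3 h rfl⟩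
      · exact ⟨1, mul_kern_le b3 h rfl⟩
      · exact ⟨2, mul_kern_le b3 h rfl⟩
      · exact ⟨3, mul_kern_le b3 h rfl⟩
      · exact ⟨4, mul_kern_le b3 h rfl⟩

theorem total_eq_tsum_prod (pos : Bool) (W : ℤ → ℤ → ℤ → ℝ≥0∞) (F G : ℤ → ℤ → ℝ≥0∞) :
    total pos W F G = ∑' x : ℤ × ℤ, ∑' y : ℤ × ℤ, ∑' o : ℤ × ℤ,
      W x.1 y.1 o.1 * kernS pos x.1 y.1 o.1 x.2 y.2 o.2 * F x.1 x.2 * G y.1 y.2 := by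
  have h1 (n1 l1 : ℤ) : ∑' y : ℤ × ℤ, ∑' o : ℤ × ℤ,
      W n1 y.1 o.1 * kernS pos n1 y.1 o.1 l1 y.2 o.2 * F n1 l1 * G y.1 y.2 =
      ∑' l2, ∑' n2, ∑' o : ℤ × ℤ,
      W n1 n2 o.1 * kernS pos n1 n2 o.1 l1 l2 o.2 * F n1 l1 * G n2 l2 := by
    rw [ENNReal.tsum_prod', ENNReal.tsum_comm]
  symm
  rw [ENNReal.tsum_prod']
  simp_rw [h1]
  rw [ENNReal.tsum_comm]
  unfold total
  congr 1; ext l1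
  rw [ENNReal.tsum_comm]

/-- Summation over the blocks for the paraproduct, with both factors square summable in the
modulation. -/
theorem total_paraproduct_l2_le (c : ℤ) : ∃ C : ℝ≥0∞, C < ∞ ∧ ∀ (pos : Bool) (W),
    ParaWeight' c W → ∀ F G, total pos W F G ≤
      C * s2 (fun p : ℤ × ℤ => F p.1 p.2) * s2 fun p : ℤ × ℤ => G p.1 p.2 := by
  refine ⟨pw ((16 * c + 2000 : ℝ) / 64) * (4 : ℕ) * ∑' a, q4 a,
    ENNReal.mul_lt_top (ENNReal.mul_lt_top (pw_ne_top _).lt_top (by simp)) tsum_q4_lt_top, ?_⟩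
  intro pos W hW F G
  rw [total_eq_tsum_prod]
  cases pos
  · refine schur_of_options (m := 4) (fun i (x y o : ℤ × ℤ) =>
      ![(x.1 - y.1, x.2 - y.2, o.2, o.1 - y.1), (x.1 - y.1, o.2 - x.1 - o.1, x.2 - y.2, o.1 - y.1),
        (x.1 - y.1, x.2 - y.2 - x.1 - y.1, o.2, o.1 - y.1),
        (x.1 - y.1, y.2 - x.2 - x.1 - y.1, o.2, o.1 - y.1)] i) ?_ ?_
      (fun x y o => W x.1 y.1 o.1 * kernS false x.1 y.1 o.1 x.2 y.2 o.2) ?_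
      (fun p => F p.1 p.2) (fun p => G p.1 p.2)
    · rintro i ⟨n1, l1⟩ ⟨⟨n2, l2⟩, n, l⟩ ⟨⟨n2', l2'⟩, n', l'⟩ h
      fin_cases i <;> simp [Prod.ext_iff] at h ⊢ <;> omega
    · rintro i ⟨n1, l1⟩ ⟨⟨n2, l2⟩, n, l⟩ ⟨⟨n2', l2'⟩, n', l'⟩ h
      fin_cases i <;> simp [Prod.ext_iff] at h ⊢ <;> omega
    · rintro ⟨n1, l1⟩ ⟨n2, l2⟩ ⟨n, l⟩
      by_cases h0 : W n1 n2 n * kernS false n1 n2 n l1 l2 l = 0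
      · simp only [h0]; exact zero_le_option _
      have hI := interact_of_kern_ne_zero (right_ne_zero_of_mul h0)
      obtain ⟨b1, b2, b3⟩ := hW n1 n2 n (by have := hI.le_nc; omega) (left_ne_zero_of_mul h0)
      rcases paraproduct_l2_neg hI (kbounds _ _ _ _ _ _) b1 le_rfl with h | h | h | h
      · exact ⟨0, mul_kern_le b3 h rfl⟩
      · exact ⟨1, mul_kern_le b3 h rfl⟩
      · exact ⟨2, mul_kern_le b3 h rfl⟩
      · exact ⟨3, mul_kern_le b3 h rfl⟩
  · refine schur_of_options (m := 4) (fun i (x y o : ℤ × ℤ) =>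
      ![(x.1 - y.1, x.2 - y.2, o.2, o.1 - y.1), (x.1 - y.1, o.2 - x.1 - y.1, x.2 - y.2, o.1 - y.1),
        (x.1 - y.1, x.2 - y.2 - x.1 - y.1, o.2, o.1 - y.1),
        (x.1 - y.1, y.2 - x.2 - x.1 - y.1, o.2, o.1 - y.1)] i) ?_ ?_
      (fun x y o => W x.1 y.1 o.1 * kernS true x.1 y.1 o.1 x.2 y.2 o.2) ?_
      (fun p => F p.1 p.2) (fun p => G p.1 p.2)
    · rintro i ⟨n1, l1⟩ ⟨⟨n2, l2⟩, n, l⟩ ⟨⟨n2', l2'⟩, n', l'⟩ h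
      fin_cases i <;> simp [Prod.ext_iff] at h ⊢ <;> omega
    · rintro i ⟨n1, l1⟩ ⟨⟨n2, l2⟩, n, l⟩ ⟨⟨n2', l2'⟩, n', l'⟩ h
      fin_cases i <;> simp [Prod.ext_iff] at h ⊢ <;> omega
    · rintro ⟨n1, l1⟩ ⟨n2, l2⟩ ⟨n, l⟩
      by_cases h0 : W n1 n2 n * kernS true n1 n2 n l1 l2 l = 0
      · simp only [h0]; exact zero_le_option _
      have hI := interact_of_kern_ne_zero (right_ne_zero_of_mul h0)
      obtain ⟨b1, b2, b3⟩ := hW n1 n2 n hI.nc_le (left_ne_zero_of_mul h0)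
      rcases paraproduct_l2_pos hI (kbounds _ _ _ _ _ _) b1 b2 le_rfl with h | h | h | h
      · exact ⟨0, mul_kern_le b3 h rfl⟩
      · exact ⟨1, mul_kern_le b3 h rfl⟩
      · exact ⟨2, mul_kern_le b3 h rfl⟩
      · exact ⟨3, mul_kern_le b3 h rfl⟩

/-! ### Summation over blocks for the remainder with a square summable factor -/

/-- The variant of `mul_kern_le` with an additional gain `2 ^ (-e / 4)`. -/
theorem mul_kern_le_gain {na nb nc la lb lc : ℤ} {W : ℝ≥0∞} {w c e : ℤ} {a : ℤ × ℤ × ℤ × ℤ} {r : ℝ}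
    (hW : W ≤ pw ((w : ℝ) / 4))
    (h : 16 * (w + kexp na nb nc la lb lc + e) + nrm a ≤ 16 * c + 2000)
    (hr : (16 * c + 2000 : ℝ) / 64 = r) :
    W * kern na nb nc la lb lc ≤ pw r * pw (-(e : ℝ) / 4) * q4 a := by
  have hW' : W * pw ((e : ℝ) / 4) ≤ pw (((w + e : ℤ) : ℝ) / 4) := by
    refine (mul_le_mul' hW le_rfl).trans (le_of_eq ?_)
    rw [← pw_add]; congr 1; push_cast; ring
  have := mul_kern_le hW' (by linarith : 16 * ((w + e) + kexp na nb nc la lb lc) + nrm a ≤ _) hr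
  calc W * kern na nb nc la lb lc
      = pw (-(e : ℝ) / 4) * (W * pw ((e : ℝ) / 4) * kern na nb nc la lb lc) := by
        have h1 : pw (-(e : ℝ) / 4) * pw ((e : ℝ) / 4) = 1 := by
          rw [← pw_add, ← pw_zero]; congr 1; ring
        calc W * kern na nb nc la lb lc = 1 * (W * kern na nb nc la lb lc) := (one_mul _).symm
          _ = _ := by rw [← h1]; ring
    _ ≤ pw (-(e : ℝ) / 4) * (pw r * q4 a) := by gcongr
    _ = _ := by ring

/-- The kernel is split into a part to which the Schur test applies jointly in the frequency and
the modulation of `v`, and a part where it applies for fixed modulation `l1` only, with the gain `2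
^ (-l1 / 4)`. -/
theorem tsum_kern_le_of_split {C : ℝ≥0∞} {W : ℤ → ℤ → ℤ → ℝ≥0∞} {pos : Bool} {m : ℕ} (l2 : ℤ)
    (φ : Fin m → ℤ × ℤ → ℤ → ℤ × ℤ → ℤ × ℤ × ℤ × ℤ)
    (inj1 : ∀ i x, Function.Injective fun p : ℤ × ℤ × ℤ => φ i x p.1 p.2)
    (inj2 : ∀ i y, Function.Injective fun p : (ℤ × ℤ) × ℤ × ℤ => φ i p.1 y p.2)
    (hK : ∀ n1 l1 n2 n l, (∃ i, W n1 n2 n * kernS pos n1 n2 n l1 l2 l ≤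
        C * q4 (φ i (n1, l1) n2 (n, l))) ∨
      W n1 n2 n * kernS pos n1 n2 n l1 l2 l ≤ C * pw (-(l1 : ℝ) / 4) *
        q4 (2 * n - l1, l - n2 - n, n1 - n2, 0)) (hm : 0 < m)
    (F : ℤ → ℤ → ℝ≥0∞) (g : ℤ → ℝ≥0∞) :
    ∑' l1, ∑' n1, ∑' n2, ∑' o : ℤ × ℤ,
      W n1 n2 o.1 * kernS pos n1 n2 o.1 l1 l2 o.2 * F n1 l1 * g n2 ≤
    C * (m + 1 : ℕ) * (∑' a, q4 a) *
      (s2 (fun p : ℤ × ℤ => F p.1 p.2) + ∑' l : ℤ, pw (-(l : ℝ) / 4) * s2 fun n => F n l) * s2 g := by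
  classical
  set K : ℤ → ℤ → ℤ → ℤ × ℤ → ℝ≥0∞ := fun l1 n1 n2 o =>
    W n1 n2 o.1 * kernS pos n1 n2 o.1 l1 l2 o.2
  set P : ℤ → ℤ → ℤ → ℤ × ℤ → Prop := fun l1 n1 n2 o =>
    ∃ i, K l1 n1 n2 o ≤ C * q4 (φ i (n1, l1) n2 o)
  set Q := ∑' a, q4 a
  have hB : ∑' l1, ∑' n1, ∑' n2, ∑' o, (if P l1 n1 n2 o then K l1 n1 n2 o else 0) * F n1 l1 * g n2 ≤
      C * m * Q * s2 (fun p : ℤ × ℤ => F p.1 p.2) * s2 g := by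
    rw [ENNReal.tsum_comm, ← ENNReal.tsum_prod (f := fun n1 l1 => ∑' n2, ∑' o,
      (if P l1 n1 n2 o then K l1 n1 n2 o else 0) * F n1 l1 * g n2)]
    refine schur_of_options φ inj1 inj2
      (fun x n2 o => if P x.2 x.1 n2 o then K x.2 x.1 n2 o else 0) ?_
      (fun p : ℤ × ℤ => F p.1 p.2) g
    intro x y o
    split_ifs with h
    · exact h
    · exact ⟨⟨0, hm⟩, zero_le⟩
  have hA : ∀ l1, ∑' n1, ∑' n2, ∑' o, (if P l1 n1 n2 o then 0 else K l1 n1 n2 o) * F n1 l1 * g n2 ≤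
      (C * pw (-(l1 : ℝ) / 4)) * (1 : ℕ) * Q * (s2 fun n => F n l1) * s2 g := by
    intro l1
    refine schur_of_options (m := 1) (fun _ n1 n2 (o : ℤ × ℤ) =>
      (2 * o.1 - l1, o.2 - n2 - o.1, n1 - n2, 0)) ?_ ?_
      (fun n1 n2 o => if P l1 n1 n2 o then 0 else K l1 n1 n2 o) ?_ (fun n => F n l1) g
    · rintro i n1 ⟨n2, n, l⟩ ⟨n2', n', l'⟩ h
      simp [Prod.ext_iff] at h ⊢; omega
    · rintro i n2 ⟨n1, n, l⟩ ⟨n1', n', l'⟩ h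
      simp [Prod.ext_iff] at h ⊢; omega
    · rintro n1 n2 ⟨n, l⟩
      refine ⟨0, ?_⟩
      dsimp only
      split_ifs with h
      · exact zero_le
      · exact (hK n1 l1 n2 n l).resolve_left h
  clear_value Q
  calc ∑' l1, ∑' n1, ∑' n2, ∑' o, K l1 n1 n2 o * F n1 l1 * g n2
      = ∑' l1, ∑' n1, ∑' n2, ∑' o, (if P l1 n1 n2 o then K l1 n1 n2 o else 0) * F n1 l1 * g n2 +
        ∑' l1, ∑' n1, ∑' n2, ∑' o, (if P l1 n1 n2 o then 0 else K l1 n1 n2 o) * F n1 l1 * g n2 := by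
        simp_rw [← ENNReal.tsum_add]
        congr! 8 with l1 n1 n2 o
        split_ifs <;> simp
    _ ≤ C * m * Q * s2 (fun p : ℤ × ℤ => F p.1 p.2) * s2 g +
        ∑' l1 : ℤ, (C * pw (-(l1 : ℝ) / 4)) * (1 : ℕ) * Q * (s2 fun n => F n l1) * s2 g :=
        add_le_add hB (ENNReal.tsum_le_tsum hA)
    _ = C * m * Q * s2 (fun p : ℤ × ℤ => F p.1 p.2) * s2 g +
        C * Q * (∑' l : ℤ, pw (-(l : ℝ) / 4) * s2 fun n => F n l) * s2 g := by
        rw [← ENNReal.tsum_mul_left, ← ENNReal.tsum_mul_right]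
        congr 1
        refine tsum_congr fun l1 => ?_
        push_cast; ring
    _ ≤ C * (m + 1 : ℕ) * Q * s2 (fun p : ℤ × ℤ => F p.1 p.2) * s2 g +
        C * (m + 1 : ℕ) * Q * (∑' l : ℤ, pw (-(l : ℝ) / 4) * s2 fun n => F n l) * s2 g := by
        have h1 : (m : ℝ≥0∞) ≤ (m + 1 : ℕ) := by push_cast; exact le_self_add
        have h2 : (1 : ℝ≥0∞) ≤ (m + 1 : ℕ) := by push_cast; exact le_add_self
        gcongr
        exact le_mul_of_one_le_right' h2
    _ = _ := by ring

/-- Summation over the blocks for the remainder, with `v` square summable in the modulation. -/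
theorem total_remainder_l2_le (c : ℤ) : ∃ C : ℝ≥0∞, C < ∞ ∧ ∀ (pos : Bool) (W), RemWeight c W →
    ∀ F G, total pos W F G ≤ C *
      (s2 (fun p : ℤ × ℤ => F p.1 p.2) + ∑' l : ℤ, pw (-(l : ℝ) / 4) * s2 fun n => F n l) *
      ∑' l, s2 fun n => G n l := by
  refine ⟨pw ((16 * c + 2000 : ℝ) / 64) * (4 + 1 : ℕ) * ∑' a, q4 a,
    ENNReal.mul_lt_top (ENNReal.mul_lt_top (pw_ne_top _).lt_top (by simp)) tsum_q4_lt_top, ?_⟩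
  intro pos W hW F G
  unfold total
  rw [ENNReal.tsum_comm, ← ENNReal.tsum_mul_left]
  refine ENNReal.tsum_le_tsum fun l2 => ?_
  cases pos
  · refine tsum_kern_le_of_split (m := 4) l2 (fun i (x : ℤ × ℤ) n2 (o : ℤ × ℤ) =>
      ![(o.1, o.2, x.2, x.1 - n2), (x.2 - n2 - o.1, o.1, o.2, x.1 - n2),
        (o.1 - n2, o.2, x.2, x.1 - n2), (o.1, o.2 - n2 - o.1, x.2, x.1 - n2)] i) ?_ ?_ ?_
      (by norm_num) F (fun n => G n l2)
    · rintro i ⟨n1, l1⟩ ⟨n2, n, l⟩ ⟨n2', n', l'⟩ h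
      fin_cases i <;> simp [Prod.ext_iff] at h ⊢ <;> omega
    · rintro i n2 ⟨⟨n1, l1⟩, n, l⟩ ⟨⟨n1', l1'⟩, n', l'⟩ h
      fin_cases i <;> simp [Prod.ext_iff] at h ⊢ <;> omega
    · intro n1 l1 n2 n l
      by_cases h0 : W n1 n2 n * kernS false n1 n2 n l1 l2 l = 0
      · rw [h0]; exact Or.inr zero_le
      have hI := interact_of_kern_ne_zero (right_ne_zero_of_mul h0)
      obtain ⟨b1, b2, b3⟩ := hW n1 n2 n (by have := hI.le_nc; omega) (left_ne_zero_of_mul h0)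
      rcases remainder_l2_neg hI (kbounds _ _ _ _ _ _) b1 b2 le_rfl with h | h | h | h | h
      · exact Or.inr (mul_kern_le_gain b3 h rfl)
      · exact Or.inl ⟨0, mul_kern_le b3 h rfl⟩
      · exact Or.inl ⟨1, mul_kern_le b3 h rfl⟩
      · exact Or.inl ⟨2, mul_kern_le b3 h rfl⟩
      · exact Or.inl ⟨3, mul_kern_le b3 h rfl⟩
  · refine tsum_kern_le_of_split (m := 4) l2 (fun i (x : ℤ × ℤ) n2 (o : ℤ × ℤ) =>
      ![(x.1 - n2, o.1 - n2, o.2, x.2), (o.2 - 2 * x.1, x.2, x.1 - n2, o.1 - n2),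
        (x.2 - 2 * x.1, o.2, x.1 - n2, o.1 - n2), (x.1 - n2, o.1 - n2, o.2, x.2)] i) ?_ ?_ ?_
      (by norm_num) F (fun n => G n l2)
    · rintro i ⟨n1, l1⟩ ⟨n2, n, l⟩ ⟨n2', n', l'⟩ h
      fin_cases i <;> simp [Prod.ext_iff] at h ⊢ <;> omega
    · rintro i n2 ⟨⟨n1, l1⟩, n, l⟩ ⟨⟨n1', l1'⟩, n', l'⟩ h
      fin_cases i <;> simp [Prod.ext_iff] at h ⊢ <;> omega
    · intro n1 l1 n2 n l
      by_cases h0 : W n1 n2 n * kernS true n1 n2 n l1 l2 l = 0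
      · rw [h0]; exact Or.inr zero_le
      have hI := interact_of_kern_ne_zero (right_ne_zero_of_mul h0)
      obtain ⟨b1, b2, b3⟩ := hW n1 n2 n hI.nc_le (left_ne_zero_of_mul h0)
      left
      rcases remainder_l2_pos hI (kbounds _ _ _ _ _ _) b1 b2 le_rfl with h | h | h
      · exact ⟨0, mul_kern_le b3 h rfl⟩
      · exact ⟨1, mul_kern_le b3 h rfl⟩
      · exact ⟨2, mul_kern_le b3 h rfl⟩

/-! ### From the trilinear form to convolutions -/

theorem volume_blk_lt_top (n l : ℤ) : volume (blk n l) < ∞ := by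
  refine (volume_le_of_strip (c := fun x => x ^ 2) (r := 2 * 2 ^ l) (d := 2 ^ n) (by fun_prop)
    (by positivity) (fun z hz => ?_) (fun z hz w hw => abs_xi_sub_le hz hw)).trans_lt
    ENNReal.ofReal_lt_top
  have := (sg_bound hz).le
  rwa [sg_eq hz] at this

/-- The argument of the second factor of a convolution in which the first one is possibly
reflected. -/
def shift (pos : Bool) (z y : Plane) : Plane := if pos then z - y else z + y

@[fun_prop] theorem measurable_shift (pos : Bool) :
    Measurable fun p : Plane × Plane => shift pos p.1 p.2 := by
  cases pos <;> simp only [shift] <;> norm_num <;> fun_prop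

theorem measurable_shift_right (pos : Bool) (z : Plane) : Measurable (shift pos z) :=
  (measurable_shift pos).comp measurable_prodMk_left

theorem lintegral_mul_shift_le (pos : Bool) {f g : Plane → ℝ≥0∞} (hf : Measurable f)
    (hg : Measurable g) (z : Plane) : ∫⁻ y, f y * g (shift pos z y) ≤ l2 f * l2 g := by
  refine (lintegral_mul_le_sqrt hf.aemeasurable
    (hg.comp (measurable_shift_right pos z)).aemeasurable).trans (le_of_eq ?_)
  unfold l2
  congr 2
  cases pos
  · simpa [shift] using lintegral_add_left_eq_self (fun x => g x ^ 2) z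
  · simpa [shift] using lintegral_sub_left_eq_self (fun x => g x ^ 2) z

/-- Cancellation of `x` in `[0, ∞]`, which has to be finite unless the claim is trivial. -/
theorem le_of_sq_le_mul {x A : ℝ≥0∞} (h : x ^ 2 ≤ A * x) (hx : A ≠ 0 → A ≠ ∞ → x ≠ ∞) :
    x ≤ A := by
  rcases eq_or_ne A 0 with rfl | h0
  · simpa using h
  rcases eq_or_ne A ∞ with rfl | h1
  · exact le_top
  rcases eq_or_ne x 0 with rfl | h2
  · exact zero_le
  rw [sq] at h
  exact (ENNReal.mul_le_mul_iff_left h2 (hx h0 h1)).1 h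

/-- The norm of the output on a block for inputs carried by single blocks, by duality. -/
theorem l2_blk_conv_le (pos : Bool) {f g : Plane → ℝ≥0∞} (hf : Measurable f) (hg : Measurable g)
    {n1 n2 l1 l2' : ℤ} (n l : ℤ) (ha : OnBlk f n1 l1) (hb : OnBlk g n2 l2') :
    pw (-(l : ℝ) / 2) * l2 ((blk n l).indicator fun z => ∫⁻ y, f y * g (shift pos z y)) ≤
      8 * kernS pos n1 n2 n l1 l2' l * (pw ((l1 : ℝ) / 2) * l2 f) * (pw ((l2' : ℝ) / 2) * l2 g) := by
  set c : Plane → ℝ≥0∞ := fun z => ∫⁻ y, f y * g (shift pos z y)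
  have hcm : Measurable c :=
    Measurable.lintegral_prod_right' (f := fun p : Plane × Plane => f p.2 * g (shift pos p.1 p.2))
      (by fun_prop)
  set h := (blk n l).indicator c
  have hh : Measurable h := hcm.indicator (measurableSet_blk n l)
  have hc : OnBlk h n l := fun z hz => by
    by_contra hne
    exact hz (Set.indicator_of_notMem hne _)
  set A := 8 * kernS pos n1 n2 n l1 l2' l * (pw ((l1 : ℝ) / 2) * l2 f) *
    (pw ((l2' : ℝ) / 2) * l2 g) with hA
  have hsq : l2 h ^ 2 = ∫⁻ z, h z * c z := by
    rw [l2_sq]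
    congr 1; ext z
    by_cases hz : z ∈ blk n l
    · simp [h, hz, sq]
    · simp [h, hz]
  -- the squared norm is the trilinear form evaluated at the output itself, which takes the second
  -- place if `v` is reflected
  have hJ : l2 h ^ 2 ≤ (A * pw ((l : ℝ) / 2)) * l2 h := by
    cases pos
    · have h1 : l2 h ^ 2 = J f h g := by
        rw [hsq, J_comm hf hh hg, J]
        congr 1; ext z
        rw [← lintegral_const_mul _ (by
          exact hf.mul (hg.comp (measurable_shift_right false z)))]
        congr 1; ext y
        simp [shift]; ring
      rw [h1]
      refine (J_le_kern hf hh hg ha hc hb).trans (le_of_eq ?_)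
      simp only [hA, kernS]
      norm_num; ring
    · have h1 : l2 h ^ 2 = J f g h := by
        rw [hsq, J_eq_conv hf hg hh]
        simp [c, shift]
      rw [h1]
      refine (J_le_kern hf hg hh ha hb hc).trans (le_of_eq ?_)
      simp only [hA, kernS]
      norm_num; ring
  have hle : l2 h ≤ A * pw ((l : ℝ) / 2) := by
    refine le_of_sq_le_mul hJ fun h0 h1 => ?_
    -- a block has finite area and a convolution is bounded, so that the norm of the output is finite
    have hf1 : l2 f ≠ ∞ := by
      intro htop
      apply h1
      rw [ENNReal.mul_eq_top]
      right
      refine ⟨?_, pw_ne_zero _⟩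
      simp only [hA] at h0 ⊢
      have a1 := left_ne_zero_of_mul h0
      have a2 := right_ne_zero_of_mul a1
      have a3 := left_ne_zero_of_mul (left_ne_zero_of_mul a1)
      rw [htop, ENNReal.mul_top (pw_ne_zero _), ENNReal.mul_top a3, ENNReal.top_mul a2]
    have hg1 : l2 g ≠ ∞ := by
      intro htop
      apply h1
      rw [ENNReal.mul_eq_top]
      right
      refine ⟨?_, pw_ne_zero _⟩
      simp only [hA] at h0 ⊢
      have a1 := left_ne_zero_of_mul (left_ne_zero_of_mul h0)
      rw [htop, ENNReal.mul_top (pw_ne_zero _), ENNReal.mul_top a1]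
    have hb2 : ∫⁻ z, h z ^ 2 ≤ (l2 f * l2 g) ^ 2 * volume (blk n l) := by
      calc ∫⁻ z, h z ^ 2 ≤ ∫⁻ z, (blk n l).indicator (fun _ => (l2 f * l2 g) ^ 2) z := by
            refine lintegral_mono fun z => ?_
            by_cases hz : z ∈ blk n l
            · simp only [h, Set.indicator_of_mem hz]
              gcongr
              exact lintegral_mul_shift_le pos hf hg z
            · simp [h, hz]
        _ = _ := lintegral_indicator_const (measurableSet_blk n l) _
    have hfin : ∫⁻ z, h z ^ 2 < ∞ := hb2.trans_lt (ENNReal.mul_lt_top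
      (ENNReal.pow_lt_top (ENNReal.mul_lt_top hf1.lt_top hg1.lt_top)) (volume_blk_lt_top n l))
    unfold l2
    exact ENNReal.rpow_ne_top_of_nonneg (by norm_num) hfin.ne
  calc pw (-(l : ℝ) / 2) * l2 h ≤ pw (-(l : ℝ) / 2) * (A * pw ((l : ℝ) / 2)) := by gcongr
    _ = (pw (-(l : ℝ) / 2) * pw ((l : ℝ) / 2)) * A := by ring
    _ = A := by
        rw [← pw_add, show -(l : ℝ) / 2 + (l : ℝ) / 2 = 0 by ring, pw_zero, one_mul]

/-- A convolution with a multiplier depending on the dyadic indices of the three frequencies. -/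
noncomputable def bconv (pos : Bool) (μ : ℤ → ℤ → ℤ → ℝ≥0∞) (f g : Plane → ℝ≥0∞) (z : Plane) :
    ℝ≥0∞ :=
  ∫⁻ y, μ (fn y) (fn (shift pos z y)) (fn z) * (f y * g (shift pos z y))

theorem tsum_indicator_blk {f : Plane → ℝ≥0∞} (hf : ∀ z, f z ≠ 0 → 0 < xi z) (z : Plane) :
    f z = ∑' p : ℤ × ℤ, (blk p.1 p.2).indicator f z := by
  rw [tsum_eq_single (fn z, fl z)]
  · by_cases h0 : f z = 0
    · by_cases h : z ∈ blk (fn z) (fl z) <;> simp [h, h0]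
    · rw [Set.indicator_of_mem]
      exact ⟨hf z h0, rfl, rfl⟩
  · rintro ⟨n, l⟩ hne
    apply Set.indicator_of_notMem
    rintro ⟨_, h1, h2⟩
    exact hne (Prod.ext h1.symm h2.symm)

theorem onBlk_indicator (f : Plane → ℝ≥0∞) (n l : ℤ) : OnBlk ((blk n l).indicator f) n l :=
  fun z hz => by
    by_contra hne
    exact hz (Set.indicator_of_notMem hne _)

/-- The norm of the output on a block is bounded by the sum over the blocks of the inputs. -/
theorem l2_blk_bconv_le (pos : Bool) (μ : ℤ → ℤ → ℤ → ℝ≥0∞) {f g : Plane → ℝ≥0∞}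
    (hf : Measurable f) (hg : Measurable g) (hf0 : ∀ z, f z ≠ 0 → 0 < xi z)
    (hg0 : ∀ z, g z ≠ 0 → 0 < xi z) (n l : ℤ) :
    pw (-(l : ℝ) / 2) * l2 ((blk n l).indicator (bconv pos μ f g)) ≤
      8 * ∑' l1, ∑' l2', ∑' n1, ∑' n2, μ n1 n2 n * kernS pos n1 n2 n l1 l2' l *
        (pw ((l1 : ℝ) / 2) * l2 ((blk n1 l1).indicator f)) *
        (pw ((l2' : ℝ) / 2) * l2 ((blk n2 l2').indicator g)) := by
  set F : ℤ × ℤ → Plane → ℝ≥0∞ := fun p => (blk p.1 p.2).indicator f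
  set G : ℤ × ℤ → Plane → ℝ≥0∞ := fun p => (blk p.1 p.2).indicator g
  have hF : ∀ p, Measurable (F p) := fun p => hf.indicator (measurableSet_blk _ _)
  have hG : ∀ p, Measurable (G p) := fun p => hg.indicator (measurableSet_blk _ _)
  set c : (ℤ × ℤ) × ℤ × ℤ → Plane → ℝ≥0∞ := fun r =>
    (blk n l).indicator fun z => ∫⁻ y, F r.1 y * G r.2 (shift pos z y)
  have hcm : ∀ r, Measurable (c r) := fun r =>
    (Measurable.lintegral_prod_right'
      (f := fun p : Plane × Plane => F r.1 p.2 * G r.2 (shift pos p.1 p.2))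
      (((hF r.1).comp measurable_snd).mul ((hG r.2).comp (measurable_shift pos)))).indicator
      (measurableSet_blk _ _)
  have hpt : ∀ z, (blk n l).indicator (bconv pos μ f g) z ≤
      ∑' r : (ℤ × ℤ) × ℤ × ℤ, μ r.1.1 r.2.1 n * c r z := by
    intro z
    by_cases hz : z ∈ blk n l
    swap
    · rw [Set.indicator_of_notMem hz]; exact zero_le
    have hfnz : fn z = n := hz.2.1
    rw [Set.indicator_of_mem hz, bconv]
    have h1 : ∀ y, μ (fn y) (fn (shift pos z y)) (fn z) * (f y * g (shift pos z y)) =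
        ∑' r : (ℤ × ℤ) × ℤ × ℤ, μ r.1.1 r.2.1 n * (F r.1 y * G r.2 (shift pos z y)) := by
      intro y
      rw [ENNReal.tsum_prod', tsum_indicator_blk hf0 y, tsum_indicator_blk hg0 (shift pos z y),
        hfnz, ← ENNReal.tsum_mul_right, ← ENNReal.tsum_mul_left]
      refine tsum_congr fun p => ?_
      rw [← ENNReal.tsum_mul_left, ← ENNReal.tsum_mul_left]
      refine tsum_congr fun q => ?_
      by_cases h2 : F p y = 0
      · simp only [F] at h2; simp [F, h2]
      by_cases h3 : G q (shift pos z y) = 0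
      · simp only [G] at h3; simp [G, h3]
      have h4 := (onBlk_indicator f p.1 p.2 y h2).2.1
      have h5 := (onBlk_indicator g q.1 q.2 _ h3).2.1
      simp only [h4, h5, F, G]
    simp_rw [h1]
    rw [lintegral_tsum]
    · refine ENNReal.tsum_le_tsum fun r => ?_
      rw [lintegral_const_mul (f := fun y => F r.1 y * G r.2 (shift pos z y)) _
        ((hF r.1).mul ((hG r.2).comp (measurable_shift_right pos z)))]
      simp only [c, Set.indicator_of_mem hz]
      exact le_rfl
    · intro r
      exact (((hF r.1).mul ((hG r.2).comp (measurable_shift_right pos z))).const_mul _).aemeasurable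
  calc pw (-(l : ℝ) / 2) * l2 ((blk n l).indicator (bconv pos μ f g))
      ≤ pw (-(l : ℝ) / 2) * ∑' r : (ℤ × ℤ) × ℤ × ℤ, μ r.1.1 r.2.1 n * l2 (c r) := by
        gcongr
        refine (l2_mono hpt).trans ((l2_tsum_le fun r => (hcm r).const_mul _).trans ?_)
        refine ENNReal.tsum_le_tsum fun r => ?_
        rw [l2_const_mul (hcm r)]
    _ ≤ ∑' r : (ℤ × ℤ) × ℤ × ℤ, 8 * (μ r.1.1 r.2.1 n * kernS pos r.1.1 r.2.1 n r.1.2 r.2.2 l *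
        (pw ((r.1.2 : ℝ) / 2) * l2 (F r.1)) * (pw ((r.2.2 : ℝ) / 2) * l2 (G r.2))) := by
        rw [← ENNReal.tsum_mul_left]
        refine ENNReal.tsum_le_tsum fun r => ?_
        have := l2_blk_conv_le pos (hF r.1) (hG r.2) n l (onBlk_indicator f r.1.1 r.1.2)
          (onBlk_indicator g r.2.1 r.2.2)
        calc _ = μ r.1.1 r.2.1 n * (pw (-(l : ℝ) / 2) * l2 (c r)) := by ring
          _ ≤ _ := mul_le_mul' le_rfl this
          _ = _ := by ring
    _ = _ := by
        have h1 (k : ℤ × ℤ → ℝ≥0∞) : ∑' b : ℤ × ℤ, k b = ∑' l2, ∑' n2, k (n2, l2) := by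
          rw [ENNReal.tsum_prod', ENNReal.tsum_comm]
        rw [ENNReal.tsum_mul_left, ENNReal.tsum_prod', h1]
        congr 1
        refine tsum_congr fun l1 => ?_
        rw [tsum_congr fun n1 => h1 _, ENNReal.tsum_comm]

/-- The weighted sum of the block norms of a convolution is bounded by the corresponding sum over
all triples of blocks. -/
theorem tsum_l2_blk_bconv_le (pos : Bool) (μ : ℤ → ℤ → ℤ → ℝ≥0∞) {f g : Plane → ℝ≥0∞}
    (hf : Measurable f) (hg : Measurable g) (hf0 : ∀ z, f z ≠ 0 → 0 < xi z)
    (hg0 : ∀ z, g z ≠ 0 → 0 < xi z) (ω : ℤ → ℝ≥0∞) (α β : ℤ → ℝ) :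
    ∑' o : ℤ × ℤ, ω o.1 * (pw (-(o.2 : ℝ) / 2) *
      l2 ((blk o.1 o.2).indicator (bconv pos μ f g))) ≤
    8 * total pos (fun n1 n2 n => ω n * μ n1 n2 n * pw (-α n1) * pw (-β n2))
      (fun n l => pw (α n) * (pw ((l : ℝ) / 2) * l2 ((blk n l).indicator f)))
      (fun n l => pw (β n) * (pw ((l : ℝ) / 2) * l2 ((blk n l).indicator g))) := by
  calc _ ≤ ∑' o : ℤ × ℤ, ω o.1 * (8 * ∑' l1, ∑' l2', ∑' n1, ∑' n2,
        μ n1 n2 o.1 * kernS pos n1 n2 o.1 l1 l2' o.2 *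
        (pw ((l1 : ℝ) / 2) * l2 ((blk n1 l1).indicator f)) *
        (pw ((l2' : ℝ) / 2) * l2 ((blk n2 l2').indicator g))) := by
        refine ENNReal.tsum_le_tsum fun o => ?_
        refine mul_le_mul' le_rfl ?_
        exact l2_blk_bconv_le pos μ hf hg hf0 hg0 o.1 o.2
    _ = _ := by
        have cancel (x : ℝ) : pw (-x) * pw x = 1 := by rw [← pw_add]; simp
        unfold total
        simp_rw [← ENNReal.tsum_mul_left]
        rw [ENNReal.tsum_comm]
        refine tsum_congr fun l1 => ?_
        rw [ENNReal.tsum_comm]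
        refine tsum_congr fun l2' => ?_
        rw [ENNReal.tsum_comm]
        refine tsum_congr fun n1 => ?_
        rw [ENNReal.tsum_comm]
        refine tsum_congr fun n2 => ?_
        refine tsum_congr fun o => ?_
        set A := l2 ((blk n1 l1).indicator f)
        set B := l2 ((blk n2 l2').indicator g)
        calc _ = (pw (-α n1) * pw (α n1)) * (pw (-β n2) * pw (β n2)) *
              (ω o.1 * (8 * (μ n1 n2 o.1 * kernS pos n1 n2 o.1 l1 l2' o.2 *
              (pw ((l1 : ℝ) / 2) * A) * (pw ((l2' : ℝ) / 2) * B)))) := by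
              rw [cancel, cancel, one_mul, one_mul]
          _ = _ := by ring

/-! ### The Littlewood-Paley symbols -/

variable {χ : 𝓢(ℝ, ℂ)}

theorem IsCutoff.lpSymbol_succ_ne_zero (hχ : IsCutoff χ) {n : ℕ} {ξ : ℝ}
    (h : lpSymbol χ (n + 1) ξ ≠ 0) : 2 ^ n < |ξ| ∧ |ξ| ≤ 2 ^ (n + 2) := by
  constructor
  · by_contra! h1
    apply h
    have h2 : |ξ| ≤ 2 ^ (n + 1) := h1.trans (pow_le_pow_right₀ (by norm_num) (by omega))
    rw [lpSymbol, hχ.eq_one, hχ.eq_one, sub_self]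
    · rw [abs_div, abs_of_pos (by positivity : (0:ℝ) < 2 ^ n), div_le_one (by positivity)]
      exact h1
    · rw [abs_div, abs_of_pos (by positivity : (0:ℝ) < 2 ^ (n + 1)), div_le_one (by positivity)]
      exact h2
  · by_contra! h1
    apply h
    rw [lpSymbol, hχ.eq_zero, hχ.eq_zero, sub_self]
    · rw [abs_div, abs_of_pos (by positivity : (0:ℝ) < 2 ^ n), lt_div_iff₀ (by positivity)]
      refine lt_of_le_of_lt ?_ h1
      rw [pow_add]; nlinarith [show (0:ℝ) < 2 ^ n by positivity]
    · rw [abs_div, abs_of_pos (by positivity : (0:ℝ) < 2 ^ (n + 1)), lt_div_iff₀ (by positivity)]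
      refine lt_of_le_of_lt (le_of_eq ?_) h1
      ring

theorem IsCutoff.lpSymbol_zero_ne_zero (hχ : IsCutoff χ) {ξ : ℝ} (h : lpSymbol χ 0 ξ ≠ 0) :
    |ξ| ≤ 2 := by
  by_contra! h1
  exact h (hχ.eq_zero ξ h1)

theorem int_log_le_of_le {x : ℝ} (hx : 0 < x) {k : ℤ} (h : x < 2 ^ (k + 1)) :
    Int.log 2 x ≤ k := by
  have := (Int.lt_zpow_iff_log_lt (b := 2) (by norm_num) hx (x := k + 1)).1 (by exact_mod_cast h)
  omega

theorem le_int_log_of_le {x : ℝ} (hx : 0 < x) {k : ℤ} (h : 2 ^ k ≤ x) : k ≤ Int.log 2 x :=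
  (Int.zpow_le_iff_le_log (b := 2) (by norm_num) hx).1 (by exact_mod_cast h)

/-- On the support of the symbol of `Δ_j` the dyadic index of the frequency is close to `j`. -/
theorem IsCutoff.near_of_lpSymbol_ne_zero (hχ : IsCutoff χ) {p : ℕ} {ξ : ℝ} (h0 : ξ ≠ 0)
    (h : lpSymbol χ p ξ ≠ 0) :
    (p : ℤ) ≤ max (Int.log 2 |ξ|) 0 + 1 ∧ max (Int.log 2 |ξ|) 0 ≤ p + 1 := by
  have hp : 0 < |ξ| := abs_pos.2 h0
  cases p with
  | zero =>
    have := int_log_le_of_le hp (k := 1) ((hχ.lpSymbol_zero_ne_zero h).trans_lt (by norm_num))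
    omega
  | succ n =>
    obtain ⟨h1, h2⟩ := hχ.lpSymbol_succ_ne_zero h
    have a1 := le_int_log_of_le hp (k := n) (by rw [zpow_natCast]; exact h1.le)
    have a2 := int_log_le_of_le hp (k := n + 2) (h2.trans_lt (by
      rw [← zpow_natCast]; exact zpow_lt_zpow_right₀ (by norm_num) (by push_cast; omega)))
    push_cast; omega

/-- The analogue of `IsCutoff.near_of_lpSymbol_ne_zero` for the modulation, where the sharp index
is that of `1 + |σ|`. -/
theorem IsCutoff.near_of_lpSymbol_ne_zero' (hχ : IsCutoff χ) {r : ℕ} {σ : ℝ}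
    (h : lpSymbol χ r σ ≠ 0) :
    (r : ℤ) ≤ Int.log 2 (1 + |σ|) + 1 ∧ Int.log 2 (1 + |σ|) ≤ r + 1 := by
  have hp : 0 < 1 + |σ| := by positivity
  cases r with
  | zero =>
    have a1 := int_log_le_of_le hp (k := 1) (by
      have := hχ.lpSymbol_zero_ne_zero h; norm_num; linarith)
    have a2 := le_int_log_of_le hp (k := 0) (by simp)
    push_cast; omega
  | succ n =>
    obtain ⟨h1, h2⟩ := hχ.lpSymbol_succ_ne_zero h
    have a1 := le_int_log_of_le hp (k := n) (by rw [zpow_natCast]; linarith)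
    have a2 := int_log_le_of_le hp (k := n + 2) (by
      have : (1 : ℝ) < 2 ^ (n + 2) := one_lt_pow₀ (by norm_num) (by omega)
      have h3 : (2 : ℝ) ^ ((n : ℤ) + 2 + 1) = 2 ^ (n + 2) + 2 ^ (n + 2) := by
        rw [show (n : ℤ) + 2 + 1 = ((n + 3 : ℕ) : ℤ) by push_cast; ring, zpow_natCast]; ring
      linarith)
    push_cast; omega

/-- A bound for the symbols of the Littlewood-Paley projections. -/
theorem exists_norm_lpSymbol_le (χ : 𝓢(ℝ, ℂ)) : ∃ K : ℝ≥0, ∀ p ξ, ‖lpSymbol χ p ξ‖ₑ ≤ K := by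
  obtain ⟨C, hC0, hC⟩ := χ.decay 0 0
  simp only [pow_zero, one_mul, norm_iteratedFDeriv_zero] at hC
  refine ⟨(C + C).toNNReal, fun p ξ => ?_⟩
  rw [← ofReal_norm]
  refine ENNReal.ofReal_le_ofReal ?_
  cases p with
  | zero => exact (hC _).trans (by linarith)
  | succ n => exact (norm_sub_le _ _).trans (add_le_add (hC _) (hC _))

theorem tsum_le_three_mul {f : ℕ → ℝ≥0∞} {K : ℝ≥0∞} {m : ℤ}
    (h : ∀ p : ℕ, f p ≠ 0 → (p : ℤ) ≤ m + 1 ∧ m ≤ p + 1) (hK : ∀ p, f p ≤ K) :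
    ∑' p, f p ≤ 3 * K := by
  classical
  have hs : ∀ p ∉ Finset.Icc (m.toNat - 1) (m.toNat - 1 + 2), f p = 0 := by
    intro p hp
    by_contra h0
    obtain ⟨h1, h2⟩ := h p h0
    apply hp
    rw [Finset.mem_Icc]; omega
  rw [tsum_eq_sum hs]
  refine (Finset.sum_le_card_nsmul _ _ K fun p _ => hK p).trans (le_of_eq ?_)
  rw [Nat.card_Icc, show m.toNat - 1 + 2 + 1 - (m.toNat - 1) = 3 by omega]
  simp

theorem IsCutoff.tsum_norm_lpSymbol_le (hχ : IsCutoff χ) {K : ℝ≥0}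
    (hK : ∀ p ξ, ‖lpSymbol χ p ξ‖ₑ ≤ K) {ξ : ℝ} (h0 : ξ ≠ 0) :
    ∑' p, ‖lpSymbol χ p ξ‖ₑ ≤ 3 * K :=
  tsum_le_three_mul (m := max (Int.log 2 |ξ|) 0)
    (fun _ hp => hχ.near_of_lpSymbol_ne_zero h0 (by simpa using hp)) fun p => hK p ξ

/-- At each frequency one of the Littlewood-Paley symbols is bounded below, since at most three of
them do not vanish and their sum is `1`. -/
theorem IsCutoff.exists_le_norm_lpSymbol (hχ : IsCutoff χ) (ξ : ℝ) :
    ∃ p, 1 / 3 ≤ ‖lpSymbol χ p ξ‖ := by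
  obtain ⟨N, hN⟩ := pow_unbounded_of_one_lt |ξ| (one_lt_two (α := ℝ))
  have hsum : ∑ m ∈ Finset.range (N + 1), lpSymbol χ m ξ = 1 := by
    have := lowSymbol_eq_sum χ (N + 2) ξ
    rw [show N + 2 - 1 = N + 1 by omega] at this
    rw [← this, lowSymbol]
    apply hχ.eq_one
    rw [abs_div, abs_of_pos (by positivity : (0:ℝ) < 2 ^ N), div_le_one (by positivity)]
    exact hN.le
  by_contra! h
  classical
  set m := Int.log 2 (1 + |ξ|)
  have hcard : ((Finset.range (N + 1)).filter fun p => lpSymbol χ p ξ ≠ 0).card ≤ 3 := by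
    have : ((Finset.range (N + 1)).filter fun p => lpSymbol χ p ξ ≠ 0) ⊆
        Finset.Icc (m.toNat - 1) (m.toNat - 1 + 2) := by
      intro p hp
      obtain ⟨h1, h2⟩ := hχ.near_of_lpSymbol_ne_zero' (Finset.mem_filter.1 hp).2
      rw [Finset.mem_Icc]; omega
    refine (Finset.card_le_card this).trans ?_
    rw [Nat.card_Icc]; omega
  rw [← Finset.sum_filter_ne_zero] at hsum
  have hne : ((Finset.range (N + 1)).filter fun p => lpSymbol χ p ξ ≠ 0).Nonempty := by
    by_contra hem
    rw [Finset.not_nonempty_iff_eq_empty] at hem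
    simp [hem] at hsum
  have : (1 : ℝ) < 1 := by
    calc (1 : ℝ) = ‖∑ m ∈ Finset.range (N + 1) with lpSymbol χ m ξ ≠ 0, lpSymbol χ m ξ‖ := by
          rw [hsum]; simp
      _ ≤ ∑ m ∈ Finset.range (N + 1) with lpSymbol χ m ξ ≠ 0, ‖lpSymbol χ m ξ‖ := norm_sum_le _ _
      _ < ∑ m ∈ Finset.range (N + 1) with lpSymbol χ m ξ ≠ 0, (1 / 3 : ℝ) :=
          Finset.sum_lt_sum_of_nonempty hne fun p _ => h p
      _ ≤ 1 := by
          rw [Finset.sum_const, nsmul_eq_mul]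
          have : (((Finset.range (N + 1)).filter fun p => lpSymbol χ p ξ ≠ 0).card : ℝ) ≤ 3 := by
            exact_mod_cast hcard
          linarith
  exact lt_irrefl _ this

/-- A smooth function that vanishes on a half line vanishes to infinite order at its end. -/
theorem exists_norm_le_pow_of_eq_zero (P : ℕ) : ∀ f : ℝ → ℂ, ContDiff ℝ (⊤ : ℕ∞) f →
    (∀ t < 0, f t = 0) → ∃ C : ℝ, 0 ≤ C ∧ ∀ t ∈ Set.Icc (0 : ℝ) 2, ‖f t‖ ≤ C * t ^ P := by
  induction P with
  | zero =>
    intro f hf _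
    obtain ⟨C, hC⟩ := isCompact_Icc.exists_bound_of_continuousOn
      (hf.continuous.continuousOn (s := Set.Icc (0 : ℝ) 2))
    exact ⟨max C 0, le_max_right _ _, fun t ht => by
      simpa using Or.inl (hC t ht)⟩
  | succ P ih =>
    intro f hf h0
    obtain ⟨hd, hf'⟩ := contDiff_infty_iff_deriv.1 hf
    obtain ⟨C, hC0, hC⟩ := ih (deriv f) hf' (fun t ht => by
      have : f =ᶠ[nhds t] fun _ => 0 := by
        filter_upwards [Iio_mem_nhds ht] with s hs using h0 s hs
      rw [this.deriv_eq]; simp)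
    have hz : f 0 = 0 := by
      have h1 : Filter.Tendsto f (nhdsWithin 0 (Set.Iio 0)) (nhds (f 0)) :=
        (hf.continuous.tendsto 0).mono_left nhdsWithin_le_nhds
      have h2 : Filter.Tendsto f (nhdsWithin 0 (Set.Iio 0)) (nhds 0) :=
        tendsto_const_nhds.congr' (by
          filter_upwards [self_mem_nhdsWithin] with t ht using (h0 t ht).symm)
      exact tendsto_nhds_unique h1 h2
    refine ⟨C, hC0, fun t ht => ?_⟩
    have := norm_image_sub_le_of_norm_deriv_le_segment' (f := f) (f' := deriv f) (a := 0) (b := t)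
      (C := C * t ^ P) (fun x _ => (hd x).hasDerivAt.hasDerivWithinAt)
      (fun x hx => (hC x ⟨hx.1, hx.2.le.trans ht.2⟩).trans (by
        have := hx.1; have := hx.2; gcongr)) t ⟨ht.1, le_rfl⟩
    rw [hz, sub_zero, sub_zero] at this
    rw [pow_succ, ← mul_assoc]; exact this

/-- The cutoff vanishes to infinite order at the endpoints of its support. -/
theorem IsCutoff.exists_norm_le_pow (hχ : IsCutoff χ) (P : ℕ) :
    ∃ C : ℝ, 0 ≤ C ∧ ∀ x, |x| ≤ 2 → ‖χ x‖ ≤ C * (2 - |x|) ^ P := by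
  obtain ⟨C1, h1, hC1⟩ := exists_norm_le_pow_of_eq_zero P (fun t => χ (2 - t))
    ((χ.smooth ⊤).comp (by fun_prop)) fun t ht => hχ.eq_zero _ (by
      rw [abs_of_pos (by linarith)]; linarith)
  obtain ⟨C2, h2, hC2⟩ := exists_norm_le_pow_of_eq_zero P (fun t => χ (t - 2))
    ((χ.smooth ⊤).comp (by fun_prop)) fun t ht => hχ.eq_zero _ (by
      rw [abs_of_neg (by linarith)]; linarith)
  refine ⟨C1 + C2, by positivity, fun x hx => ?_⟩
  have hnn : 0 ≤ (2 - |x|) ^ P := pow_nonneg (by linarith) P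
  rw [add_mul]
  rcases le_total 0 x with h | h
  · have := hC1 (2 - x) ⟨by rw [abs_of_nonneg h] at hx; linarith, by linarith⟩
    rw [sub_sub_cancel] at this
    rw [abs_of_nonneg h] at hnn ⊢
    have : 0 ≤ C2 * (2 - x) ^ P := by positivity
    linarith
  · have := hC2 (2 + x) ⟨by rw [abs_of_nonpos h] at hx; linarith, by linarith⟩
    rw [add_sub_cancel_left] at this
    rw [abs_of_nonpos h, sub_neg_eq_add] at hnn ⊢
    have : 0 ≤ C1 * (2 + x) ^ P := by positivity
    linarith

theorem IsCutoff.lowSymbol_ne_zero (hχ : IsCutoff χ) {n : ℕ} {ξ : ℝ}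
    (h : lowSymbol χ (n + 2) ξ ≠ 0) : |ξ| ≤ 2 ^ (n + 1) := by
  by_contra! h1
  apply h
  rw [lowSymbol, hχ.eq_zero]
  rw [abs_div, abs_of_pos (by positivity : (0:ℝ) < 2 ^ n), lt_div_iff₀ (by positivity)]
  refine lt_of_le_of_lt (le_of_eq ?_) h1
  ring

/-- Decay of the symbol of the paraproduct where the output frequency is small. -/
theorem IsCutoff.exists_lowSymbol_mul_le (hχ : IsCutoff χ) (P : ℕ) : ∃ C : ℝ≥0,
    ∀ (p : ℕ) (ξ₁ ξ₂ : ℝ), 0 < ξ₂ → 0 < ξ₁ + ξ₂ → lowSymbol χ p ξ₁ ≠ 0 → lpSymbol χ p ξ₂ ≠ 0 →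
      2 ≤ p ∧ |ξ₁| < ξ₂ ∧ 2 < ξ₂ ∧
      ‖lowSymbol χ p ξ₁‖ₑ ≤ C * pw (P * (Int.log 2 (ξ₁ + ξ₂) - Int.log 2 ξ₂)) := by
  obtain ⟨C, hC0, hC⟩ := hχ.exists_norm_le_pow P
  refine ⟨(C * 16 ^ P).toNNReal, fun p ξ₁ ξ₂ h2 h12 hlow hlp => ?_⟩
  match p with
  | 0 => simp [lowSymbol] at hlow
  | 1 => simp [lowSymbol] at hlow
  | n + 2 =>
    have a1 := hχ.lowSymbol_ne_zero hlow
    obtain ⟨a2, a3⟩ := hχ.lpSymbol_succ_ne_zero hlp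
    rw [abs_of_pos h2] at a2 a3
    have hn : (0 : ℝ) < 2 ^ n := by positivity
    refine ⟨by omega, a1.trans_lt a2, lt_of_le_of_lt ?_ a2, ?_⟩
    · calc (2 : ℝ) = 2 ^ 1 := by norm_num
        _ ≤ 2 ^ (n + 1) := pow_le_pow_right₀ (by norm_num) (by omega)
    · set N := Int.log 2 (ξ₁ + ξ₂)
      set M := Int.log 2 ξ₂
      have b1 : ξ₁ + ξ₂ < 2 ^ (N + 1) := by
        exact_mod_cast Int.lt_zpow_succ_log_self (b := 2) (by norm_num) (ξ₁ + ξ₂)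
      have b2 : (2 : ℝ) ^ M ≤ ξ₂ := by
        exact_mod_cast Int.zpow_log_le_self (b := 2) (by norm_num) h2
      have hx : |ξ₁ / 2 ^ n| = |ξ₁| / 2 ^ n := by rw [abs_div, abs_of_pos hn]
      have c1 : |ξ₁| / 2 ^ n ≤ 2 := by
        rw [div_le_iff₀ hn]; rw [pow_succ] at a1; linarith
      -- the distance to the end of the support is at most `(ξ₁ + ξ₂) / 2 ^ n`, as `2 ^ (n + 1) < ξ₂`
      have c2 : 2 - |ξ₁| / 2 ^ n ≤ 16 * 2 ^ (N - M) := by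
        have d1 : 2 - |ξ₁| / 2 ^ n ≤ (ξ₁ + ξ₂) / 2 ^ n := by
          rw [le_div_iff₀ hn, sub_mul, div_mul_cancel₀ _ hn.ne']
          rw [pow_succ] at a2
          linarith [neg_abs_le ξ₁]
        have d2 : (2 : ℝ) ^ M ≤ 8 * 2 ^ n := b2.trans (a3.trans (le_of_eq (by ring)))
        have d3 : (ξ₁ + ξ₂) / 2 ^ n ≤ 16 * 2 ^ (N - M) := by
          rw [div_le_iff₀ hn, zpow_sub₀ (by norm_num)]
          rw [zpow_add_one₀ (by norm_num)] at b1
          have hM : (0 : ℝ) < 2 ^ M := by positivity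
          have hN : (0 : ℝ) < 2 ^ N := by positivity
          rw [mul_div_assoc', div_mul_eq_mul_div, le_div_iff₀ hM]
          calc (ξ₁ + ξ₂) * 2 ^ M ≤ (2 ^ N * 2) * (8 * 2 ^ n) := by gcongr
            _ = _ := by ring
        exact d1.trans d3
      have key : ‖lowSymbol χ (n + 2) ξ₁‖ ≤ (C * 16 ^ P) * (2 : ℝ) ^ ((P : ℝ) * ((N : ℝ) - M)) := by
        rw [lowSymbol]
        refine (hC _ (by rw [hx]; exact c1)).trans ?_
        rw [hx, mul_assoc]
        have e1 : (2 : ℝ) ^ ((P : ℝ) * ((N : ℝ) - M)) = (2 ^ (N - M)) ^ P := by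
          rw [mul_comm, Real.rpow_mul_natCast (by norm_num), ← Int.cast_sub, Real.rpow_intCast]
        rw [e1, ← mul_pow]
        have : 0 ≤ 2 - |ξ₁| / 2 ^ n := by linarith
        gcongr
      rw [← ofReal_norm]
      refine (ENNReal.ofReal_le_ofReal key).trans (le_of_eq ?_)
      rw [ENNReal.ofReal_mul (by positivity), ofReal_two_rpow]
      rfl

/-! ### The symbols of the remainder and of the paraproduct -/

/-- The exponent of the weight of order `s` at the dyadic frequency `n`, which is inhomogeneous. -/
noncomputable def inh (s : ℝ) (n : ℤ) : ℝ := s * ((max n 0 : ℤ) : ℝ)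

/-- A bound for the symbol of `∂ₓ R` in terms of the dyadic frequencies. The factor `2 ^ (n + 1)`
bounds the frequency of the output. -/
noncomputable def remMul (K : ℝ≥0) (n1 n2 n : ℤ) : ℝ≥0∞ :=
  if max n1 0 ≤ max n2 0 + 3 ∧ max n2 0 ≤ max n1 0 + 3 then K * pw (n + 1) else 0

/-- A bound for the symbol of the paraproduct in terms of the dyadic frequencies. -/
noncomputable def paraMul (K : ℝ≥0) (P : ℕ) (n1 n2 n : ℤ) : ℝ≥0∞ :=
  if 1 ≤ n2 ∧ n1 ≤ n2 + 1 then K * pw (P * (n - n2)) else 0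

theorem exists_le_pw (K : ℝ≥0) : ∃ k : ℤ, (K : ℝ≥0∞) ≤ pw k := by
  obtain ⟨N, hN⟩ := pow_unbounded_of_one_lt K (one_lt_two (α := ℝ≥0))
  refine ⟨N, ?_⟩
  rw [pw, Int.cast_natCast, ENNReal.rpow_natCast]
  exact_mod_cast hN.le

/-- The hypothesis `-1 / 2 ≤ s + s'` makes the weight of the output admissible where its frequency
is small. -/
theorem exists_remWeight (K : ℝ≥0) {s s' : ℝ} (h : -(1 / 2) ≤ s + s') : ∃ c, RemWeight c
    fun n1 n2 n => pw (inh (s + s') n) * remMul K n1 n2 n * pw (-inh s' n1) * pw (-inh s n2) := by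
  obtain ⟨k, hk⟩ := exists_le_pw K
  obtain ⟨c, hc⟩ := exists_int_gt (4 * (3 * |s'| + 4 * (s + s' + 1 / 2) + k + 1))
  refine ⟨c, fun n1 n2 n hn h0 => ?_⟩
  have h1 := right_ne_zero_of_mul (left_ne_zero_of_mul (left_ne_zero_of_mul h0))
  have h2 : max n1 0 ≤ max n2 0 + 3 ∧ max n2 0 ≤ max n1 0 + 3 := by
    by_contra h3
    exact h1 (if_neg h3)
  refine ⟨h2.1, h2.2, ?_⟩
  simp only [remMul, if_pos h2]
  calc _ ≤ pw (inh (s + s') n) * (pw k * pw (n + 1)) * pw (-inh s' n1) * pw (-inh s n2) := by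
        gcongr
    _ ≤ _ := by
        simp only [← pw_add]
        apply pw_mono
        unfold inh
        have h4 : max n 0 ≤ max n2 0 + 4 := by omega
        set a := max n1 0
        set b := max n2 0
        set d := max n 0
        have e1 : (a : ℝ) ≤ b + 3 := by exact_mod_cast h2.1
        have e2 : (b : ℝ) ≤ a + 3 := by exact_mod_cast h2.2
        have e3 : (d : ℝ) ≤ b + 4 := by exact_mod_cast h4
        have e4 : s' * ((b : ℝ) - a) ≤ 3 * |s'| := by
          calc s' * ((b : ℝ) - a) ≤ |s' * ((b : ℝ) - a)| := le_abs_self _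
            _ = |s'| * |(b : ℝ) - a| := abs_mul _ _
            _ ≤ |s'| * 3 := by gcongr; rw [abs_le]; constructor <;> linarith
            _ = _ := by ring
        have e5 : (s + s' + 1 / 2) * ((d : ℝ) - b) ≤ (s + s' + 1 / 2) * 4 :=
          mul_le_mul_of_nonneg_left (by linarith) (by linarith)
        push_cast
        nlinarith

theorem abs_mul_sub_pow_le {σ δ : ℝ} {P : ℕ} (hP : |σ| + 10 ≤ P) (hδ : -2 ≤ δ) :
    |σ| * |δ| - P * δ ≤ -10 * δ + 2 * |σ| + 2 * P := by
  have h0 := abs_nonneg σ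
  rcases le_total 0 δ with h | h
  · rw [abs_of_nonneg h]; nlinarith
  · rw [abs_of_nonpos h]; nlinarith

theorem abs_max_sub_le {n n2 : ℤ} (h : 1 ≤ n2) : |((max n 0 : ℤ) : ℝ) - n2| ≤ |(n2 : ℝ) - n| := by
  have : |max n 0 - n2| ≤ |n2 - n| := by
    rcases abs_cases (max n 0 - n2) with h | h <;> rcases abs_cases (n2 - n) with h' | h' <;> omega
  exact_mod_cast this

/-- The order `P` of vanishing of the cutoff is chosen large enough to absorb the weight of the
output when its frequency is small, and still to leave the decay `2 ^ (-10 * (n2 - n))`. -/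
theorem exists_paraWeight (K : ℝ≥0) {s s' : ℝ} {P : ℕ} (h : s' + 1 / 2 ≤ 0)
    (hP : |s + s' + 1| + 10 ≤ P) : ∃ c, ParaWeight c
    fun n1 n2 n => pw (inh (s + s' + 1) n) * paraMul K P n1 n2 n * pw (-inh s' n1) *
      pw (-inh s n2) := by
  obtain ⟨k, hk⟩ := exists_le_pw K
  obtain ⟨c, hc⟩ := exists_int_gt (4 * (2 * |s + s' + 1| + 2 * P - (s' + 1 / 2) + k))
  refine ⟨c, fun n1 n2 n hn h0 => ?_⟩
  have h1 := right_ne_zero_of_mul (left_ne_zero_of_mul (left_ne_zero_of_mul h0))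
  have h2 : 1 ≤ n2 ∧ n1 ≤ n2 + 1 := by
    by_contra h3
    exact h1 (if_neg h3)
  refine ⟨h2.1, h2.2, ?_⟩
  simp only [paraMul, if_pos h2]
  calc _ ≤ pw (inh (s + s' + 1) n) * (pw k * pw (P * (n - n2))) * pw (-inh s' n1) *
          pw (-inh s n2) := by gcongr
    _ ≤ _ := by
        simp only [← pw_add]
        apply pw_mono
        unfold inh
        have e1 := abs_max_sub_le (n := n) h2.1
        rw [max_eq_left (by omega : 0 ≤ n2)]
        have h4 : max n1 0 ≤ n2 + 1 := by omega
        have e2 : (-2 : ℝ) ≤ n2 - n := by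
          have : -2 ≤ n2 - n := by omega
          exact_mod_cast this
        have e3 := abs_mul_sub_pow_le hP e2
        set a := max n1 0
        set d := max n 0
        have e4 : (s + s' + 1) * ((d : ℝ) - n2) ≤ |s + s' + 1| * |(n2 : ℝ) - n| := by
          calc _ ≤ |(s + s' + 1) * ((d : ℝ) - n2)| := le_abs_self _
            _ = |s + s' + 1| * |(d : ℝ) - n2| := abs_mul _ _
            _ ≤ _ := by gcongr
        have e5 : (a : ℝ) ≤ n2 + 1 := by exact_mod_cast h4
        have e6 : (s' + 1 / 2) * ((n2 : ℝ) - a) ≤ -(s' + 1 / 2) := by nlinarith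
        push_cast
        nlinarith

/-- The analogue of `exists_paraWeight` for `v` of regularity `-1`. -/
theorem exists_paraWeight' (K : ℝ≥0) {s : ℝ} {P : ℕ} (hP : |s| + 10 ≤ P) : ∃ c, ParaWeight' c
    fun n1 n2 n => pw (inh s n) * paraMul K P n1 n2 n * pw (-inh (-1) n1) * pw (-inh s n2) := by
  obtain ⟨k, hk⟩ := exists_le_pw K
  obtain ⟨c, hc⟩ := exists_int_gt (4 * (2 * |s| + 2 * P + k))
  refine ⟨c, fun n1 n2 n hn h0 => ?_⟩
  have h1 := right_ne_zero_of_mul (left_ne_zero_of_mul (left_ne_zero_of_mul h0))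
  have h2 : 1 ≤ n2 ∧ n1 ≤ n2 + 1 := by
    by_contra h3
    exact h1 (if_neg h3)
  refine ⟨h2.1, h2.2, ?_⟩
  simp only [paraMul, if_pos h2]
  calc _ ≤ pw (inh s n) * (pw k * pw (P * (n - n2))) * pw (-inh (-1) n1) *
          pw (-inh s n2) := by gcongr
    _ ≤ _ := by
        simp only [← pw_add]
        apply pw_mono
        unfold inh
        have e1 := abs_max_sub_le (n := n) h2.1
        rw [max_eq_left (by omega : 0 ≤ n2)]
        have e2 : (-2 : ℝ) ≤ n2 - n := by
          have : -2 ≤ n2 - n := by omega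
          exact_mod_cast this
        have e3 := abs_mul_sub_pow_le hP e2
        set a := max n1 0
        set d := max n 0
        have e4 : s * ((d : ℝ) - n2) ≤ |s| * |(n2 : ℝ) - n| := by
          calc _ ≤ |s * ((d : ℝ) - n2)| := le_abs_self _
            _ = |s| * |(d : ℝ) - n2| := abs_mul _ _
            _ ≤ _ := by gcongr
        push_cast
        nlinarith

theorem IsCutoff.exists_tsum_remainder_le (hχ : IsCutoff χ) : ∃ K : ℝ≥0, ∀ ξ₁ ξ₂ ξ : ℝ,
    ξ₁ ≠ 0 → ξ₂ ≠ 0 →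
    ∑' p : NearDiagonal, ENNReal.ofReal |ξ| * (‖lpSymbol χ p.1.1 ξ₁‖ₑ * ‖lpSymbol χ p.1.2 ξ₂‖ₑ) ≤
      remMul K (Int.log 2 |ξ₁|) (Int.log 2 |ξ₂|) (Int.log 2 |ξ|) := by
  obtain ⟨K, hK⟩ := exists_norm_lpSymbol_le χ
  refine ⟨3 * K * (3 * K), fun ξ₁ ξ₂ ξ h1 h2 => ?_⟩
  rw [remMul]
  split_ifs with hc
  · rw [ENNReal.tsum_mul_left, mul_comm]
    have hξ : ENNReal.ofReal |ξ| ≤ pw (Int.log 2 |ξ| + 1) := by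
      have := Int.lt_zpow_succ_log_self (b := 2) (by norm_num) |ξ|
      have h3 := ofReal_two_zpow (Int.log 2 |ξ| + 1)
      push_cast at this h3
      rw [← h3]
      exact ENNReal.ofReal_le_ofReal this.le
    refine mul_le_mul' ?_ hξ
    calc ∑' p : NearDiagonal, ‖lpSymbol χ p.1.1 ξ₁‖ₑ * ‖lpSymbol χ p.1.2 ξ₂‖ₑ
        ≤ ∑' p : ℕ × ℕ, ‖lpSymbol χ p.1 ξ₁‖ₑ * ‖lpSymbol χ p.2 ξ₂‖ₑ :=
          ENNReal.tsum_comp_le_tsum_of_injective Subtype.val_injective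
            fun p : ℕ × ℕ => ‖lpSymbol χ p.1 ξ₁‖ₑ * ‖lpSymbol χ p.2 ξ₂‖ₑ
      _ = (∑' p, ‖lpSymbol χ p ξ₁‖ₑ) * ∑' p, ‖lpSymbol χ p ξ₂‖ₑ := by
          rw [ENNReal.tsum_prod']
          simp_rw [ENNReal.tsum_mul_left, ENNReal.tsum_mul_right]
      _ ≤ (3 * K) * (3 * K) := mul_le_mul' (hχ.tsum_norm_lpSymbol_le hK h1)
          (hχ.tsum_norm_lpSymbol_le hK h2)
      _ = _ := by push_cast; rfl
  · rw [nonpos_iff_eq_zero, ENNReal.tsum_eq_zero]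
    rintro ⟨⟨p, q⟩, hpq⟩
    by_contra h0
    apply hc
    have h3 := right_ne_zero_of_mul h0
    have a1 := hχ.near_of_lpSymbol_ne_zero h1 (enorm_ne_zero.1 (left_ne_zero_of_mul h3))
    have a2 := hχ.near_of_lpSymbol_ne_zero h2 (enorm_ne_zero.1 (right_ne_zero_of_mul h3))
    rw [abs_le] at hpq
    dsimp only at a1 a2 hpq
    omega

theorem IsCutoff.exists_tsum_paraproduct_le (hχ : IsCutoff χ) (P : ℕ) : ∃ K : ℝ≥0, ∀ ξ₁ ξ₂ : ℝ,
    ξ₁ ≠ 0 → 0 < ξ₂ → 0 < ξ₁ + ξ₂ → ∑' p : ℕ, ‖lowSymbol χ p ξ₁‖ₑ * ‖lpSymbol χ p ξ₂‖ₑ ≤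
      paraMul K P (Int.log 2 |ξ₁|) (Int.log 2 |ξ₂|) (Int.log 2 |ξ₁ + ξ₂|) := by
  obtain ⟨K, hK⟩ := exists_norm_lpSymbol_le χ
  obtain ⟨C, hC⟩ := hχ.exists_lowSymbol_mul_le P
  refine ⟨C * (3 * K), fun ξ₁ ξ₂ h1 h2 h12 => ?_⟩
  rw [abs_of_pos h2, abs_of_pos h12, paraMul]
  split_ifs with hc
  · calc _ ≤ ∑' p, C * pw (P * (Int.log 2 (ξ₁ + ξ₂) - Int.log 2 ξ₂)) * ‖lpSymbol χ p ξ₂‖ₑ := by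
          refine ENNReal.tsum_le_tsum fun p => ?_
          by_cases h3 : lpSymbol χ p ξ₂ = 0
          · simp [h3]
          by_cases h4 : lowSymbol χ p ξ₁ = 0
          · simp [h4]
          gcongr
          exact (hC p ξ₁ ξ₂ h2 h12 h4 h3).2.2.2
      _ ≤ C * pw (P * (Int.log 2 (ξ₁ + ξ₂) - Int.log 2 ξ₂)) * (3 * K) := by
          rw [ENNReal.tsum_mul_left]
          gcongr
          exact hχ.tsum_norm_lpSymbol_le hK h2.ne'
      _ = _ := by push_cast; ring
  · rw [nonpos_iff_eq_zero, ENNReal.tsum_eq_zero]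
    intro p
    by_contra h0
    apply hc
    obtain ⟨-, a1, a2, -⟩ := hC p ξ₁ ξ₂ h2 h12 (enorm_ne_zero.1 (left_ne_zero_of_mul h0))
      (enorm_ne_zero.1 (right_ne_zero_of_mul h0))
    have b1 := le_int_log_of_le h2 (k := 1) (by norm_num; exact a2.le)
    have b2 : Int.log 2 |ξ₁| ≤ Int.log 2 ξ₂ := Int.log_mono_right (abs_pos.2 h1) a1.le
    omega

/-! ### Sharp and smooth dyadic decompositions -/

theorem l2_mono_ae {f g : Plane → ℝ≥0∞} (h : ∀ᵐ z, f z ≤ g z) : l2 f ≤ l2 g := by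
  refine ENNReal.rpow_le_rpow (lintegral_mono_ae ?_) (by norm_num)
  filter_upwards [h] with z hz
  gcongr

theorem ae_xi_ne_zero : ∀ᵐ z : Plane, xi z ≠ 0 := by
  have h : volume ((LinearMap.ker (EuclideanSpace.proj (𝕜 := ℝ) (0 : Fin 2)).toLinearMap :
      Submodule ℝ Plane) : Set Plane) = 0 := by
    refine Measure.addHaar_submodule _ _ fun h => ?_
    have : (EuclideanSpace.single 0 1 : Plane) ∈
        LinearMap.ker (EuclideanSpace.proj (𝕜 := ℝ) (0 : Fin 2)).toLinearMap := h ▸ trivial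
    simp at this
  rw [ae_iff]
  refine measure_mono_null (fun z hz => ?_) h
  simpa [xi, Real.pi_ne_zero] using hz

theorem measurable_lpSymbol (χ : 𝓢(ℝ, ℂ)) (p : ℕ) : Measurable (lpSymbol χ p) := by
  have h := χ.continuous.measurable
  cases p with
  | zero => exact h
  | succ n => exact (h.comp (measurable_id.div_const _)).sub (h.comp (measurable_id.div_const _))

theorem measurable_lowSymbol (χ : 𝓢(ℝ, ℂ)) (p : ℕ) : Measurable (lowSymbol χ p) := by
  match p with
  | 0 => exact measurable_const
  | 1 => exact measurable_const
  | n + 2 => exact χ.continuous.measurable.comp (measurable_id.div_const _)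

/-- The symbol of `Δ_{jk}` on the Fourier side of `𝓕`. -/
noncomputable def blkSym (χ : 𝓢(ℝ, ℂ)) (p r : ℕ) (z : Plane) : ℂ :=
  lpSymbol χ p (xi z) * lpSymbol χ r (sg z)

theorem measurable_blkSym (χ : 𝓢(ℝ, ℂ)) (p r : ℕ) : Measurable (blkSym χ p r) :=
  ((measurable_lpSymbol χ p).comp measurable_xi).mul ((measurable_lpSymbol χ r).comp measurable_sg)

/-- The summands of the norm of `X^{s,b,q}`, for a distribution with Fourier transform `g`. -/
noncomputable def fnorm (χ : 𝓢(ℝ, ℂ)) (s b : ℝ) (g : Plane → ℂ) (p r : ℕ) : ℝ≥0∞ :=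
  pw (idx p * s + idx r * b) * l2 fun z => ‖blkSym χ p r z * g z‖ₑ

/-- Closeness of the index `r`, which stands for the integer `r - 1`, of a smooth dyadic piece and
of a sharp index `l`. -/
def Near (r : ℕ) (l : ℤ) : Prop := (r : ℤ) ≤ l + 1 ∧ l ≤ r + 1

instance (r : ℕ) (l : ℤ) : Decidable (Near r l) := inferInstanceAs (Decidable (_ ∧ _))

theorem tsum_ite_near_nat (l : ℤ) (a : ℝ≥0∞) : ∑' r : ℕ, (if Near r l then a else 0) ≤ 3 * a := by
  refine tsum_le_three_mul (m := l) (fun p hp => ?_) fun p => ?_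
  · by_contra h
    exact hp (if_neg h)
  · split_ifs <;> simp

theorem tsum_ite_near_int (r : ℕ) (a : ℝ≥0∞) : ∑' l : ℤ, (if Near r l then a else 0) ≤ 3 * a := by
  rw [tsum_eq_sum (s := Finset.Icc (r - 1 : ℤ) (r + 1))]
  · calc _ ≤ ∑ _l ∈ Finset.Icc (r - 1 : ℤ) (r + 1), a := Finset.sum_le_sum fun l _ => by
          split_ifs <;> simp
      _ = _ := by
        rw [Finset.sum_const, Int.card_Icc, nsmul_eq_mul,
          show ((r : ℤ) + 1 + 1 - (r - 1)).toNat = 3 by omega]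
        norm_num
  · intro l hl
    rw [if_neg]
    rintro ⟨h1, h2⟩
    apply hl
    rw [Finset.mem_Icc]; omega

theorem inh_le {p : ℕ} {n : ℤ} (h : Near p (max n 0)) (s : ℝ) :
    |inh s n - idx p * s| ≤ 2 * |s| := by
  obtain ⟨h1, h2⟩ := h
  unfold inh idx
  set m := max n 0
  have e1 : (p : ℝ) ≤ m + 1 := by exact_mod_cast h1
  have e2 : (m : ℝ) ≤ p + 1 := by exact_mod_cast h2
  rw [show s * (m : ℝ) - (p - 1) * s = (m - p + 1) * s by ring, abs_mul]
  gcongr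
  rw [abs_le]; constructor <;> linarith

theorem modulation_le {r : ℕ} {l : ℤ} (h : Near r l) (b : ℝ) :
    |b * l - idx r * b| ≤ 2 * |b| := by
  obtain ⟨h1, h2⟩ := h
  unfold idx
  have e1 : (r : ℝ) ≤ l + 1 := by exact_mod_cast h1
  have e2 : (l : ℝ) ≤ r + 1 := by exact_mod_cast h2
  rw [show b * (l : ℝ) - (r - 1) * b = (l - r + 1) * b by ring, abs_mul]
  gcongr
  rw [abs_le]; constructor <;> linarith

/-- The constant that compares the sharp and the smooth dyadic decompositions. -/
noncomputable def cmpConst (s b : ℝ) : ℝ≥0∞ := (9 * pw (2 * |s| + 2 * |b|)) ^ 2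

theorem cmpConst_ne_top (s b : ℝ) : cmpConst s b ≠ ∞ :=
  ENNReal.pow_ne_top (ENNReal.mul_ne_top (by norm_num) (pw_ne_top _))

/-- Pointwise comparison of the sharp and the smooth decomposition. -/
theorem IsCutoff.sq_le_tsum (hχ : IsCutoff χ) (s b : ℝ) (g : Plane → ℂ) {z : Plane}
    (hz : xi z ≠ 0) : (pw (b * fl z + inh s (fn z)) * ‖g z‖ₑ) ^ 2 ≤
    cmpConst s b * ∑' r : ℕ, if Near r (fl z) then
      ∑' p : ℕ, (pw (idx p * s + idx r * b) * ‖blkSym χ p r z * g z‖ₑ) ^ 2 else 0 := by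
  obtain ⟨p, hp⟩ := hχ.exists_le_norm_lpSymbol (xi z)
  obtain ⟨r, hr⟩ := hχ.exists_le_norm_lpSymbol (sg z)
  have np : Near p (max (fn z) 0) := hχ.near_of_lpSymbol_ne_zero hz (by
    intro h; rw [h] at hp; norm_num at hp)
  have nr : Near r (fl z) := hχ.near_of_lpSymbol_ne_zero' (by
    intro h; rw [h] at hr; norm_num at hr)
  have hg : ‖g z‖ₑ ≤ 9 * ‖blkSym χ p r z * g z‖ₑ := by
    rw [← ofReal_norm, ← ofReal_norm, show (9 : ℝ≥0∞) = ENNReal.ofReal 9 by norm_num,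
      ← ENNReal.ofReal_mul (by norm_num)]
    apply ENNReal.ofReal_le_ofReal
    rw [norm_mul, blkSym, norm_mul]
    have : 1 / 3 * (1 / 3) ≤ ‖lpSymbol χ p (xi z)‖ * ‖lpSymbol χ r (sg z)‖ := by gcongr
    nlinarith [norm_nonneg (g z)]
  have hw : pw (b * fl z + inh s (fn z)) ≤
      pw (2 * |s| + 2 * |b|) * pw (idx p * s + idx r * b) := by
    rw [← pw_add]
    apply pw_mono
    have h1 := (abs_le.1 (inh_le np s)).2
    have h2 := (abs_le.1 (modulation_le nr b)).2
    linarith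
  calc _ ≤ ((pw (2 * |s| + 2 * |b|) * pw (idx p * s + idx r * b)) *
        (9 * ‖blkSym χ p r z * g z‖ₑ)) ^ 2 := by gcongr
    _ = cmpConst s b * (pw (idx p * s + idx r * b) * ‖blkSym χ p r z * g z‖ₑ) ^ 2 := by
        rw [cmpConst]; ring
    _ ≤ _ := by
        gcongr
        refine le_trans ?_ (ENNReal.le_tsum r)
        rw [if_pos nr]
        exact ENNReal.le_tsum (f := fun p =>
          (pw (idx p * s + idx r * b) * ‖blkSym χ p r z * g z‖ₑ) ^ 2) p

/-- The `L²` norm over a dyadic block, irrespective of the sign of the frequency. -/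
noncomputable def symBlk (g : Plane → ℂ) (n l : ℤ) : ℝ≥0∞ :=
  l2 ({z | xi z ≠ 0 ∧ fn z = n ∧ fl z = l}.indicator fun z => ‖g z‖ₑ)

theorem measurableSet_symBlk (n l : ℤ) :
    MeasurableSet {z | xi z ≠ 0 ∧ fn z = n ∧ fl z = l} :=
  (measurable_xi (measurableSet_singleton 0).compl).inter
    ((measurable_fn (measurableSet_singleton n)).inter (measurable_fl (measurableSet_singleton l)))

theorem sq_fnorm {g : Plane → ℂ} (hg : Measurable g) (s b : ℝ) (p r : ℕ) :
    fnorm χ s b g p r ^ 2 =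
      ∫⁻ z, (pw (idx p * s + idx r * b) * ‖blkSym χ p r z * g z‖ₑ) ^ 2 := by
  have := measurable_blkSym χ p r
  rw [fnorm, ← l2_const_mul (by fun_prop), l2_sq]

/-- The `ℓ²` norm in the frequency of the weighted block norms with modulation index `l`. -/
noncomputable def modNorm (s b : ℝ) (g : Plane → ℂ) (l : ℤ) : ℝ≥0∞ :=
  pw (b * l) * s2 fun n => pw (inh s n) * symBlk g n l

theorem s2_sq {ι : Type*} (f : ι → ℝ≥0∞) : s2 f ^ 2 = ∑' i, f i ^ 2 := by
  rw [s2, ← ENNReal.rpow_natCast, ← ENNReal.rpow_mul]; simp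

/-- The sharp norm at the modulation index `l` is bounded by the smooth ones at the adjacent
indices. -/
theorem IsCutoff.modNorm_sq_le (hχ : IsCutoff χ) (s b : ℝ) {g : Plane → ℂ} (hg : Measurable g)
    (l : ℤ) : modNorm s b g l ^ 2 ≤ cmpConst s b * ∑' r : ℕ, if Near r l then
      ∑' p : ℕ, fnorm χ s b g p r ^ 2 else 0 := by
  have hm := measurable_blkSym χ
  calc modNorm s b g l ^ 2
      = ∑' n, ∫⁻ z, {z | xi z ≠ 0 ∧ fn z = n ∧ fl z = l}.indicator
          (fun z => (pw (b * fl z + inh s (fn z)) * ‖g z‖ₑ) ^ 2) z := by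
        rw [modNorm, mul_pow, s2_sq, ← ENNReal.tsum_mul_left]
        refine tsum_congr fun n => ?_
        rw [symBlk, mul_pow, l2_sq, ← mul_assoc, ← mul_pow, ← pw_add,
          ← lintegral_const_mul _ (by
            exact ((hg.enorm).indicator (measurableSet_symBlk n l)).pow_const 2)]
        congr 1; ext z
        by_cases hz : z ∈ {z | xi z ≠ 0 ∧ fn z = n ∧ fl z = l}
        · rw [Set.indicator_of_mem hz, Set.indicator_of_mem hz, hz.2.1, hz.2.2, mul_pow]
        · simp [Set.indicator_of_notMem hz]
    _ = ∫⁻ z, ∑' n, {z | xi z ≠ 0 ∧ fn z = n ∧ fl z = l}.indicator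
          (fun z => (pw (b * fl z + inh s (fn z)) * ‖g z‖ₑ) ^ 2) z := by
        rw [lintegral_tsum]
        intro n
        have h1 : Measurable fun z : Plane => pw (b * fl z + inh s (fn z)) :=
          (measurable_of_countable fun x : ℤ × ℤ => pw (b * x.1 + inh s x.2)).comp
            (measurable_fl.prodMk measurable_fn)
        exact (((h1.mul hg.enorm).pow_const 2).indicator (measurableSet_symBlk n l)).aemeasurable
    _ ≤ ∫⁻ z, cmpConst s b * ∑' r : ℕ, if Near r l then
          ∑' p : ℕ, (pw (idx p * s + idx r * b) * ‖blkSym χ p r z * g z‖ₑ) ^ 2 else 0 := by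
        refine lintegral_mono fun z => ?_
        rw [tsum_eq_single (fn z)]
        · by_cases hz : z ∈ {z' | xi z' ≠ 0 ∧ fn z' = fn z ∧ fl z' = l}
          · rw [Set.indicator_of_mem hz]
            have := hχ.sq_le_tsum s b g hz.1
            rwa [hz.2.2] at this ⊢
          · rw [Set.indicator_of_notMem hz]; exact zero_le
        · intro n hn
          exact Set.indicator_of_notMem (fun h => hn h.2.1.symm) _
    _ = _ := by
        rw [lintegral_const_mul' _ _ (cmpConst_ne_top s b), lintegral_tsum]
        · congr 1
          refine tsum_congr fun r => ?_
          split_ifs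
          · rw [lintegral_tsum (fun p => by have := hm p r; fun_prop)]
            simp_rw [sq_fnorm hg]
          · simp
        · intro r
          split_ifs
          · exact (Measurable.tsum fun p => by have := hm p r; fun_prop).aemeasurable
          · exact aemeasurable_const

/-- A bound for the `L²` norm without weight in the modulation. -/
theorem IsCutoff.l2_inh_sq_le (hχ : IsCutoff χ) (s : ℝ) {b : ℝ} (hb : 0 ≤ b) {g : Plane → ℂ}
    (hg : Measurable g) : l2 (fun z => pw (inh s (fn z)) * ‖g z‖ₑ) ^ 2 ≤
      cmpConst s b * ∑' x : ℕ × ℕ, fnorm χ s b g x.1 x.2 ^ 2 := by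
  have hm := measurable_blkSym χ
  rw [l2_sq]
  calc _ ≤ ∫⁻ z, cmpConst s b * ∑' x : ℕ × ℕ,
          (pw (idx x.1 * s + idx x.2 * b) * ‖blkSym χ x.1 x.2 z * g z‖ₑ) ^ 2 := by
        refine lintegral_mono_ae ?_
        filter_upwards [ae_xi_ne_zero] with z hz
        calc _ ≤ (pw (b * fl z + inh s (fn z)) * ‖g z‖ₑ) ^ 2 := by
              gcongr
              refine pw_mono (le_add_of_nonneg_left (mul_nonneg hb ?_))
              exact_mod_cast fl_nonneg z
          _ ≤ _ := hχ.sq_le_tsum s b g hz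
          _ ≤ _ := by
              gcongr
              rw [ENNReal.tsum_prod', ENNReal.tsum_comm]
              refine ENNReal.tsum_le_tsum fun r => ?_
              split_ifs
              · exact le_rfl
              · exact zero_le
    _ = _ := by
        rw [lintegral_const_mul' _ _ (cmpConst_ne_top s b),
          lintegral_tsum (fun x => by have := hm x.1 x.2; fun_prop)]
        simp_rw [sq_fnorm hg]

theorem s2_le_tsum {ι : Type*} (f : ι → ℝ≥0∞) : s2 f ≤ ∑' i, f i := by
  have h : ∑' i, f i ^ 2 ≤ (∑' i, f i) ^ 2 := by
    rw [sq, ← ENNReal.tsum_mul_right]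
    refine ENNReal.tsum_le_tsum fun i => ?_
    rw [sq]
    gcongr
    exact ENNReal.le_tsum i
  calc s2 f ≤ ((∑' i, f i) ^ 2) ^ (1 / 2 : ℝ) := ENNReal.rpow_le_rpow h (by norm_num)
    _ = _ := by rw [← ENNReal.rpow_natCast, ← ENNReal.rpow_mul]; simp

theorem IsCutoff.tsum_modNorm_sq_le (hχ : IsCutoff χ) (s b : ℝ) {g : Plane → ℂ}
    (hg : Measurable g) : ∑' l, modNorm s b g l ^ 2 ≤
      3 * cmpConst s b * ∑' x : ℕ × ℕ, fnorm χ s b g x.1 x.2 ^ 2 := by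
  calc _ ≤ ∑' l, cmpConst s b * ∑' r : ℕ, if Near r l then ∑' p : ℕ, fnorm χ s b g p r ^ 2 else 0 :=
        ENNReal.tsum_le_tsum fun l => hχ.modNorm_sq_le s b hg l
    _ ≤ cmpConst s b * ∑' r : ℕ, 3 * ∑' p : ℕ, fnorm χ s b g p r ^ 2 := by
        rw [ENNReal.tsum_mul_left, ENNReal.tsum_comm]
        gcongr with r
        exact tsum_ite_near_int r _
    _ = _ := by
        rw [ENNReal.tsum_mul_left, ENNReal.tsum_comm, ← ENNReal.tsum_prod (f := fun p r =>
          fnorm χ s b g p r ^ 2)]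
        ring

theorem IsCutoff.tsum_modNorm_le (hχ : IsCutoff χ) (s b : ℝ) {g : Plane → ℂ}
    (hg : Measurable g) : ∑' l, modNorm s b g l ≤
      3 * cmpConst s b ^ (1 / 2 : ℝ) * ∑' x : ℕ × ℕ, fnorm χ s b g x.1 x.2 := by
  have h (l : ℤ) : modNorm s b g l ≤ cmpConst s b ^ (1 / 2 : ℝ) *
      ∑' r : ℕ, if Near r l then ∑' p : ℕ, fnorm χ s b g p r else 0 := by
    calc modNorm s b g l = (modNorm s b g l ^ 2) ^ (1 / 2 : ℝ) := by
          rw [← ENNReal.rpow_natCast, ← ENNReal.rpow_mul]; simp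
      _ ≤ (cmpConst s b * ∑' x : ℕ × ℕ,
            (if Near x.1 l then fnorm χ s b g x.2 x.1 else 0) ^ 2) ^ (1 / 2 : ℝ) := by
          refine ENNReal.rpow_le_rpow ((hχ.modNorm_sq_le s b hg l).trans (le_of_eq ?_))
            (by norm_num)
          rw [ENNReal.tsum_prod']
          congr 1
          refine tsum_congr fun r => ?_
          split_ifs <;> simp
      _ = cmpConst s b ^ (1 / 2 : ℝ) *
            s2 fun x : ℕ × ℕ => if Near x.1 l then fnorm χ s b g x.2 x.1 else 0 := by
          rw [ENNReal.mul_rpow_of_nonneg _ _ (by norm_num), s2]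
      _ ≤ _ := by
          gcongr
          refine (s2_le_tsum _).trans (le_of_eq ?_)
          rw [ENNReal.tsum_prod']
          refine tsum_congr fun r => ?_
          split_ifs <;> simp
  calc _ ≤ ∑' l, cmpConst s b ^ (1 / 2 : ℝ) *
        ∑' r : ℕ, if Near r l then ∑' p : ℕ, fnorm χ s b g p r else 0 := ENNReal.tsum_le_tsum h
    _ ≤ cmpConst s b ^ (1 / 2 : ℝ) * ∑' r : ℕ, 3 * ∑' p : ℕ, fnorm χ s b g p r := by
        rw [ENNReal.tsum_mul_left, ENNReal.tsum_comm]
        gcongr with r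
        exact tsum_ite_near_int r _
    _ = _ := by
        rw [ENNReal.tsum_mul_left, ENNReal.tsum_comm, ← ENNReal.tsum_prod (f := fun p r =>
          fnorm χ s b g p r)]
        ring

/-- Above the critical modulation exponent `1 / 2`, square summability implies summability. -/
theorem IsCutoff.exists_tsum_modNorm_half_le (hχ : IsCutoff χ) (s : ℝ) {b : ℝ} (hb : 1 / 2 < b) :
    ∃ C : ℝ≥0∞, C < ∞ ∧ ∀ g : Plane → ℂ, Measurable g →
      ∑' l, modNorm s (1 / 2) g l ≤ C * s2 fun x : ℕ × ℕ => fnorm χ s b g x.1 x.2 := by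
  refine ⟨(∑' k : ℤ, pw (-((2 * b - 1) * |(k : ℝ)|))) ^ (1 / 2 : ℝ) *
    (3 * cmpConst s b) ^ (1 / 2 : ℝ), ENNReal.mul_lt_top
      (ENNReal.rpow_lt_top_of_nonneg (by norm_num) (tsum_pw_neg_abs_lt_top (by linarith)).ne)
      (ENNReal.rpow_lt_top_of_nonneg (by norm_num)
        (ENNReal.mul_ne_top (by norm_num) (cmpConst_ne_top s b))), fun g hg => ?_⟩
  have h (l : ℤ) : modNorm s (1 / 2) g l ≤ pw (-((b - 1 / 2) * |(l : ℝ)|)) * modNorm s b g l := by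
    rcases lt_or_ge l 0 with hl | hl
    · have : modNorm s (1 / 2) g l = 0 := by
        have h0 (n : ℤ) : symBlk g n l = 0 := by
          rw [symBlk, show {z | xi z ≠ 0 ∧ fn z = n ∧ fl z = l} = ∅ by
            ext z
            simp only [Set.mem_ofPred_eq, Set.mem_empty_iff_false, iff_false]
            rintro ⟨-, -, h⟩
            have := fl_nonneg z
            omega]
          simp [l2]
        simp [modNorm, h0, s2]
      rw [this]; exact zero_le
    · rw [abs_of_nonneg (by exact_mod_cast hl), modNorm, modNorm, ← mul_assoc, ← pw_add]
      gcongr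
      apply pw_mono
      linarith
  calc _ ≤ ∑' l : ℤ, pw (-((b - 1 / 2) * |(l : ℝ)|)) * modNorm s b g l := ENNReal.tsum_le_tsum h
    _ ≤ s2 (fun l : ℤ => pw (-((b - 1 / 2) * |(l : ℝ)|))) * s2 (modNorm s b g) :=
        tsum_mul_le_s2 _ _
    _ ≤ (∑' k : ℤ, pw (-((2 * b - 1) * |(k : ℝ)|))) ^ (1 / 2 : ℝ) *
        ((3 * cmpConst s b) ^ (1 / 2 : ℝ) * s2 fun x : ℕ × ℕ => fnorm χ s b g x.1 x.2) := by
        refine mul_le_mul' (le_of_eq ?_) ?_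
        · rw [s2]
          congr 1
          refine tsum_congr fun k => ?_
          rw [pw_sq]; congr 1; ring
        · rw [s2, s2, ← ENNReal.mul_rpow_of_nonneg _ _ (by norm_num)]
          exact ENNReal.rpow_le_rpow (hχ.tsum_modNorm_sq_le s b hg) (by norm_num)
    _ = _ := by ring

/-- Comparison of the smooth and the sharp decomposition for functions carried by positive
frequencies. -/
theorem IsCutoff.tsum_fnorm_le (hχ : IsCutoff χ) (σ b : ℝ) : ∃ C : ℝ≥0∞, C < ∞ ∧
    ∀ (h : Plane → ℂ) (H : Plane → ℝ≥0∞), Measurable H → (∀ z, xi z < 0 → h z = 0) →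
      (∀ z, 0 < xi z → ‖h z‖ₑ ≤ H z) →
      ∑' x : ℕ × ℕ, fnorm χ σ b h x.1 x.2 ≤
        C * ∑' o : ℤ × ℤ, pw (inh σ o.1) * (pw (b * o.2) * l2 ((blk o.1 o.2).indicator H)) := by
  obtain ⟨K, hK⟩ := exists_norm_lpSymbol_le χ
  set c : ℝ≥0∞ := pw (2 * |σ| + 2 * |b|) * (K * K)
  refine ⟨9 * c, ENNReal.mul_lt_top (by norm_num) (ENNReal.mul_lt_top (pw_ne_top _).lt_top
    (ENNReal.mul_lt_top ENNReal.coe_lt_top ENNReal.coe_lt_top)), fun h H hH h0 h1 => ?_⟩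
  set a : ℤ × ℤ → ℝ≥0∞ := fun o =>
    pw (inh σ o.1) * (pw (b * o.2) * l2 ((blk o.1 o.2).indicator H))
  have key (x : ℕ × ℕ) : fnorm χ σ b h x.1 x.2 ≤
      ∑' o : ℤ × ℤ, if Near x.1 (max o.1 0) then (if Near x.2 o.2 then c * a o else 0) else 0 := by
    have hmH (o : ℤ × ℤ) : Measurable ((blk o.1 o.2).indicator H) :=
      hH.indicator (measurableSet_blk _ _)
    set d : ℤ × ℤ → ℝ≥0∞ := fun o =>
      if Near x.1 (max o.1 0) then (if Near x.2 o.2 then K * K else 0) else 0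
    have h2 : ∀ᵐ z, ‖blkSym χ x.1 x.2 z * h z‖ₑ ≤
        ∑' o : ℤ × ℤ, d o * (blk o.1 o.2).indicator H z := by
      filter_upwards [ae_xi_ne_zero] with z hz
      rcases lt_or_gt_of_ne hz with hneg | hpos
      · simp [h0 z hneg]
      by_cases hs : blkSym χ x.1 x.2 z = 0
      · simp [hs]
      refine le_trans ?_ (ENNReal.le_tsum (fn z, fl z))
      have n1 : Near x.1 (max (fn z) 0) := hχ.near_of_lpSymbol_ne_zero hz (left_ne_zero_of_mul hs)
      have n2 : Near x.2 (fl z) := hχ.near_of_lpSymbol_ne_zero' (right_ne_zero_of_mul hs)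
      have hm : z ∈ blk (fn z) (fl z) := ⟨hpos, rfl, rfl⟩
      simp only [d, if_pos n1, if_pos n2, Set.indicator_of_mem hm]
      rw [enorm_mul, blkSym, enorm_mul]
      gcongr
      · exact hK _ _
      · exact hK _ _
      · exact h1 z hpos
    calc fnorm χ σ b h x.1 x.2
        ≤ pw (idx x.1 * σ + idx x.2 * b) * ∑' o : ℤ × ℤ, d o * l2 ((blk o.1 o.2).indicator H) := by
          rw [fnorm]
          gcongr
          refine (l2_mono_ae h2).trans ((l2_tsum_le fun o => (hmH o).const_mul _).trans ?_)
          refine ENNReal.tsum_le_tsum fun o => ?_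
          rw [l2_const_mul (hmH o)]
      _ ≤ _ := by
          rw [← ENNReal.tsum_mul_left]
          refine ENNReal.tsum_le_tsum fun o => ?_
          simp only [d]
          split_ifs with n1 n2
          · have hw : pw (idx x.1 * σ + idx x.2 * b) ≤
                pw (2 * |σ| + 2 * |b|) * (pw (inh σ o.1) * pw (b * o.2)) := by
              rw [← pw_add, ← pw_add]
              apply pw_mono
              have h1 := (abs_le.1 (inh_le n1 σ)).1
              have h2 := (abs_le.1 (modulation_le n2 b)).1
              linarith
            calc _ ≤ (pw (2 * |σ| + 2 * |b|) * (pw (inh σ o.1) * pw (b * o.2))) *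
                  (K * K * l2 ((blk o.1 o.2).indicator H)) := by gcongr
              _ = _ := by simp only [c, a]; ring
          · simp
          · simp
  calc _ ≤ ∑' x : ℕ × ℕ, ∑' o : ℤ × ℤ,
        if Near x.1 (max o.1 0) then (if Near x.2 o.2 then c * a o else 0) else 0 :=
        ENNReal.tsum_le_tsum key
    _ ≤ ∑' o : ℤ × ℤ, 3 * (3 * (c * a o)) := by
        rw [ENNReal.tsum_comm]
        refine ENNReal.tsum_le_tsum fun o => ?_
        rw [ENNReal.tsum_prod']
        calc _ ≤ ∑' p : ℕ, if Near p (max o.1 0) then 3 * (c * a o) else 0 := by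
              refine ENNReal.tsum_le_tsum fun p => ?_
              split_ifs
              · exact tsum_ite_near_nat _ _
              · simp
          _ ≤ _ := tsum_ite_near_nat _ _
    _ = _ := by
        rw [ENNReal.tsum_mul_left, ENNReal.tsum_mul_left, ENNReal.tsum_mul_left]
        ring

/-! ### Tempered distributions whose Fourier transform is a function -/

theorem IsFunction.congr {T : 𝓢'(Plane, ℂ)} {g g' : Plane → ℂ} (h : IsFunction T g)
    (hg : g =ᵐ[volume] g') : IsFunction T g' := by
  refine ⟨(locallyIntegrable_congr hg).1 h.1, fun f => ?_⟩
  have h1 : (fun z => g z * f z) =ᵐ[volume] fun z => g' z * f z := by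
    filter_upwards [hg] with z hz; rw [hz]
  exact ⟨(integrable_congr h1).1 (h.2 f).1, (h.2 f).2.trans (integral_congr_ae h1)⟩

theorem IsFunction.ae_eq {T : 𝓢'(Plane, ℂ)} {g g' : Plane → ℂ} (h : IsFunction T g)
    (h' : IsFunction T g') : g =ᵐ[volume] g' := by
  refine ae_eq_of_integral_contDiff_smul_eq h.1 h'.1 fun f hf hc => ?_
  have hg₁ : HasCompactSupport (Complex.ofRealCLM ∘ f) := hc.comp_left rfl
  have hg₂ : ContDiff ℝ (⊤ : ℕ∞) (Complex.ofRealCLM ∘ f) := by fun_prop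
  have h1 := (h.2 (hg₁.toSchwartzMap hg₂)).2
  rw [(h'.2 (hg₁.toSchwartzMap hg₂)).2] at h1
  simpa [mul_comm] using h1.symm

theorem isFunction_toTemperedDistribution {p : ℝ≥0∞} [hp : Fact (1 ≤ p)]
    (a : Lp ℂ p (volume : Measure Plane)) : IsFunction (Lp.toTemperedDistribution a) a := by
  refine ⟨(Lp.memLp a).locallyIntegrable hp.out, fun f => ⟨?_, ?_⟩⟩
  · have := ENNReal.HolderConjugate.inv_one_sub_inv' hp.out
    exact (Lp.memLp a).integrable_mul (f.memLp (1 - p⁻¹)⁻¹)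
  · rw [Lp.toTemperedDistribution_apply]
    simp [mul_comm]

theorem exists_isFunction_of_memLp {p : ℝ≥0∞} (hp : 1 ≤ p) {h : Plane → ℂ} (hh : MemLp h p) :
    ∃ T, IsFunction T h :=
  haveI : Fact (1 ≤ p) := ⟨hp⟩
  ⟨_, (isFunction_toTemperedDistribution (hh.toLp h)).congr hh.coeFn_toLp⟩

theorem IsFunction.smulLeft {T : 𝓢'(Plane, ℂ)} {g : Plane → ℂ} (h : IsFunction T g)
    {k : Plane → ℂ} (hk : k.HasTemperateGrowth) :
    IsFunction (TemperedDistribution.smulLeftCLM ℂ k T) fun z => k z * g z := by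
  refine ⟨LocallyIntegrable.continuous_mul hk.1.continuous h.1, fun f => ?_⟩
  have h1 : (fun z => k z * g z * f z) =
      fun z => g z * (SchwartzMap.smulLeftCLM ℂ k f) z := by
    ext z
    rw [SchwartzMap.smulLeftCLM_apply_apply hk, smul_eq_mul]; ring
  rw [h1]
  exact h.2 _

theorem IsFunction.smul {T : 𝓢'(Plane, ℂ)} {g : Plane → ℂ} (h : IsFunction T g) (c : ℂ) :
    IsFunction (c • T) fun z => c * g z := by
  refine ⟨h.1.smul c, fun f => ?_⟩
  have h1 : (fun z => c * g z * f z) = fun z => c * (g z * f z) := by ext z; ring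
  rw [h1]
  refine ⟨(h.2 f).1.const_mul c, ?_⟩
  rw [integral_const_mul, ← (h.2 f).2]
  rfl

/-- The symbol of `∂ₓ` is `i ξ`. -/
theorem IsFunction.fourier_lineDeriv {T : 𝓢'(Plane, ℂ)} {g : Plane → ℂ} (h : IsFunction (𝓕 T) g) :
    IsFunction (𝓕 (∂_{(EuclideanSpace.single 0 1 : Plane)} T)) fun z => Complex.I * xi z * g z := by
  rw [TemperedDistribution.fourier_lineDerivOp_eq]
  have h1 : (fun z : Plane => ((inner ℝ z (EuclideanSpace.single 0 1 : Plane) : ℝ) : ℂ)).HasTemperateGrowth := by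
    fun_prop
  refine ((h.smulLeft h1).smul (2 * Real.pi * Complex.I)).congr (Filter.Eventually.of_forall ?_)
  intro z
  have h2 : (inner ℝ z (EuclideanSpace.single 0 1 : Plane) : ℝ) = z 0 := by
    rw [EuclideanSpace.inner_single_right]; simp
  simp only [h2, xi]
  push_cast
  ring

/-- The weight `(1 + |z|²) ^ M`, which compensates for the growth of temperate functions. -/
noncomputable def jb (M : ℕ) (z : Plane) : ℝ := (1 + ‖z‖ ^ 2) ^ M

theorem jb_pos (M : ℕ) (z : Plane) : 0 < jb M z := by unfold jb; positivity

theorem continuous_jb (M : ℕ) : Continuous (jb M) := by unfold jb; fun_prop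

theorem hasTemperateGrowth_jb (M : ℕ) :
    (fun z : Plane => (jb M z : ℂ)).HasTemperateGrowth := by
  have h1 : (fun z : Plane => (1 + ‖z‖ ^ 2 : ℝ)).HasTemperateGrowth :=
    (Function.HasTemperateGrowth.const (1 : ℝ)).add (Function.hasTemperateGrowth_norm_sq Plane)
  have h2 : (fun z : Plane => (1 + ‖z‖ ^ 2 : ℝ) ^ M).HasTemperateGrowth := h1.pow M
  unfold jb
  exact Function.HasTemperateGrowth.comp Function.Complex.hasTemperateGrowth_ofReal h2

/-- Square integrability up to a polynomial weight. -/
def Temperate (F : Plane → ℝ≥0∞) : Prop :=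
  ∃ M : ℕ, l2 (fun z => ENNReal.ofReal (jb M z)⁻¹ * F z) < ∞

theorem eLpNorm_two_eq_l2 (h : Plane → ℂ) : eLpNorm h 2 volume = l2 fun z => ‖h z‖ₑ := by
  rw [eLpNorm_eq_lintegral_rpow_enorm_toReal (by norm_num) (by norm_num)]
  simp [l2]

/-- Every temperate function is a tempered distribution. -/
theorem exists_isFunction {h : Plane → ℂ} (hm : AEStronglyMeasurable h volume)
    (hh : Temperate fun z => ‖h z‖ₑ) : ∃ T, IsFunction T h := by
  obtain ⟨M, hM⟩ := hh
  have h1 : MemLp (fun z => ((jb M z)⁻¹ : ℂ) * h z) 2 := by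
    refine ⟨?_, ?_⟩
    · have : Continuous fun z => ((jb M z)⁻¹ : ℂ) :=
        (Complex.continuous_ofReal.comp (continuous_jb M)).inv₀ fun z => by
          simpa using (jb_pos M z).ne'
      exact this.aestronglyMeasurable.mul hm
    · rw [eLpNorm_two_eq_l2]
      convert hM using 3 with z
      rw [enorm_mul]
      congr 1
      rw [← ofReal_norm, norm_inv, Complex.norm_real, Real.norm_of_nonneg (jb_pos M z).le]
  obtain ⟨T, hT⟩ := exists_isFunction_of_memLp (by norm_num) h1
  refine ⟨_, (hT.smulLeft (hasTemperateGrowth_jb M)).congr (Filter.Eventually.of_forall ?_)⟩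
  intro z
  have : (jb M z : ℂ) ≠ 0 := by exact_mod_cast (jb_pos M z).ne'
  field_simp

theorem Temperate.lintegral_mul_lt_top {F : Plane → ℝ≥0∞} (hF : Temperate F)
    (hm : AEMeasurable F volume) (f : 𝓢(Plane, ℂ)) : ∫⁻ z, F z * ‖f z‖ₑ < ∞ := by
  obtain ⟨M, hM⟩ := hF
  have hj := (continuous_jb M).measurable
  calc ∫⁻ z, F z * ‖f z‖ₑ
      = ∫⁻ z, (ENNReal.ofReal (jb M z)⁻¹ * F z) *
          ‖(SchwartzMap.smulLeftCLM ℂ (fun z : Plane => (jb M z : ℂ)) f) z‖ₑ := by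
        congr 1; ext z
        rw [SchwartzMap.smulLeftCLM_apply_apply (hasTemperateGrowth_jb M), enorm_smul,
          ← ofReal_norm (jb M z : ℂ), Complex.norm_real, Real.norm_of_nonneg (jb_pos M z).le]
        have : ENNReal.ofReal (jb M z)⁻¹ * ENNReal.ofReal (jb M z) = 1 := by
          rw [← ENNReal.ofReal_mul (inv_nonneg.2 (jb_pos M z).le),
            inv_mul_cancel₀ (jb_pos M z).ne', ENNReal.ofReal_one]
        calc F z * ‖f z‖ₑ = (ENNReal.ofReal (jb M z)⁻¹ * ENNReal.ofReal (jb M z)) *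
              (F z * ‖f z‖ₑ) := by rw [this, one_mul]
          _ = _ := by ring
    _ ≤ _ := lintegral_mul_le_sqrt (hj.inv.ennreal_ofReal.aemeasurable.mul hm)
        (SchwartzMap.continuous _).measurable.enorm.aemeasurable
    _ < ∞ := by
        refine ENNReal.mul_lt_top hM ?_
        have := ((SchwartzMap.smulLeftCLM ℂ (fun z : Plane => (jb M z : ℂ)) f).memLp 2).2
        rwa [eLpNorm_two_eq_l2] at this

/-- A series of tempered distributions given by functions converges if the sum of the absolute
values is temperate. -/
theorem exists_hasSum_of_temperate {ι : Type*} [Countable ι] {R : ι → 𝓢'(Plane, ℂ)}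
    {r : ι → Plane → ℂ} (hR : ∀ i, IsFunction (𝓕 (R i)) (r i)) (hr : ∀ i, Measurable (r i))
    (hT : Temperate fun z => ∑' i, ‖r i z‖ₑ) :
    ∃ w, HasSum R w ∧ IsFunction (𝓕 w) fun z => ∑' i, r i z := by
  have hm : AEStronglyMeasurable (fun z => ∑' i, r i z) volume :=
    (Measurable.tsum hr).aestronglyMeasurable
  have hle (z) : ‖∑' i, r i z‖ₑ ≤ ∑' i, ‖r i z‖ₑ := enorm_tsum_le_tsum_enorm
  obtain ⟨T, hTf⟩ := exists_isFunction hm (by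
    obtain ⟨M, hM⟩ := hT
    exact ⟨M, (l2_mono fun z => mul_le_mul' le_rfl (hle z)).trans_lt hM⟩)
  refine ⟨𝓕⁻ T, ?_, by rwa [fourier_fourierInv_eq]⟩
  have key (f : 𝓢(Plane, ℂ)) : HasSum (fun i => R i f) ((𝓕⁻ T) f) := by
    have h1 (S : 𝓢'(Plane, ℂ)) : S f = (𝓕 S) (𝓕⁻ f) := by
      rw [TemperedDistribution.fourier_apply, fourier_fourierInv_eq]
    have h2 : ∀ i, R i f = ∫ z, r i z * (𝓕⁻ f) z := fun i => by rw [h1, ((hR i).2 _).2]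
    have h3 : (𝓕⁻ T) f = ∫ z, ∑' i, r i z * (𝓕⁻ f) z := by
      rw [h1, fourier_fourierInv_eq, (hTf.2 _).2]
      congr 1; ext z
      rw [tsum_mul_right]
    simp_rw [h2]
    rw [h3]
    have h4 : ∑' i, ∫⁻ z, ‖r i z * (𝓕⁻ f) z‖ₑ ≠ ∞ := by
      have hm (i) : AEMeasurable (fun z => ‖r i z * (𝓕⁻ f) z‖ₑ) volume :=
        ((hr i).mul (𝓕⁻ f).continuous.measurable).enorm.aemeasurable
      rw [← lintegral_tsum hm]
      simp_rw [enorm_mul, ENNReal.tsum_mul_right]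
      exact (hT.lintegral_mul_lt_top (Measurable.tsum fun i => (hr i).enorm).aemeasurable _).ne
    refine hasSum_integral_of_summable_integral_norm (fun i => ((hR i).2 _).1) ?_
    have h5 := ENNReal.summable_toReal h4
    refine h5.congr fun i => ?_
    rw [integral_norm_eq_lintegral_enorm ((hR i).2 _).1.aestronglyMeasurable]
  rw [HasSum, PointwiseConvergenceCLM.tendsto_iff_forall_tendsto]
  intro f
  have := key f
  rw [HasSum] at this
  convert this using 2 with t
  simp

theorem IsMultiplier.of_isFunction {m : ℝ → ℝ → ℂ} {u w : 𝓢'(Plane, ℂ)} {g g' : Plane → ℂ}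
    (hu : IsFunction (𝓕 u) g) (hw : IsFunction (𝓕 w) g')
    (h : ∀ z, g' z = m (2 * Real.pi * z 0) (2 * Real.pi * z 1) * g z) : IsMultiplier m u w := by
  refine ⟨g, hu, ?_⟩
  rwa [← funext h]

theorem blockSymbol_eq (χ : 𝓢(ℝ, ℂ)) (p r : ℕ) (z : Plane) :
    blockSymbol χ p r (2 * Real.pi * z 0) (2 * Real.pi * z 1) = blkSym χ p r z := rfl

/-- A function in `L²` is the Fourier transform of a function in `L²`. -/
theorem exists_lp_fourier {h : Plane → ℂ} (hh : MemLp h 2) :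
    ∃ a : Lp ℂ 2 (volume : Measure Plane), (𝓕 a : Lp ℂ 2 (volume : Measure Plane)) =ᵐ[volume] h ∧
      IsFunction (𝓕 (Lp.toTemperedDistribution a)) h ∧ ‖a‖ₑ = l2 fun z => ‖h z‖ₑ := by
  have h1 : 𝓕 (𝓕⁻ (hh.toLp h)) = hh.toLp h := fourier_fourierInv_eq _
  refine ⟨𝓕⁻ (hh.toLp h), ?_, ?_, ?_⟩
  · rw [h1]; exact hh.coeFn_toLp
  · rw [Lp.fourier_toTemperedDistribution_eq, h1]
    exact (isFunction_toTemperedDistribution _).congr hh.coeFn_toLp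
  · rw [← eLpNorm_two_eq_l2, ← enorm_norm, ← Lp.norm_fourier_eq, h1, enorm_norm, Lp.enorm_def]
    exact eLpNorm_congr_ae hh.coeFn_toLp

/-- Plancherel's theorem identifies the block norms with norms on the Fourier side. -/
theorem le_blockNorm {u : 𝓢'(Plane, ℂ)} {g : Plane → ℂ} (hu : IsFunction (𝓕 u) g) (p r : ℕ) :
    l2 (fun z => ‖blkSym χ p r z * g z‖ₑ) ≤ blockNorm χ p r u := by
  refine le_iInf₂ fun a ⟨g', hg', ha⟩ => ?_
  rw [Lp.fourier_toTemperedDistribution_eq] at ha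
  have h1 := (isFunction_toTemperedDistribution _).ae_eq ha
  have h2 := hu.ae_eq hg'
  rw [← enorm_norm, ← Lp.norm_fourier_eq, enorm_norm, Lp.enorm_def, ← eLpNorm_two_eq_l2]
  refine le_of_eq (eLpNorm_congr_ae ?_)
  filter_upwards [h1, h2] with z h1 h2
  rw [h1, h2, blockSymbol_eq]

theorem blockNorm_le {u : 𝓢'(Plane, ℂ)} {g : Plane → ℂ} (hg : Measurable g)
    (hu : IsFunction (𝓕 u) g) (p r : ℕ) :
    blockNorm χ p r u ≤ l2 fun z => ‖blkSym χ p r z * g z‖ₑ := by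
  rcases eq_or_ne (l2 fun z => ‖blkSym χ p r z * g z‖ₑ) ∞ with h | h
  · rw [h]; exact le_top
  obtain ⟨a, -, ha, hn⟩ := exists_lp_fourier (h := fun z => blkSym χ p r z * g z)
    ⟨((measurable_blkSym χ p r).mul hg).aestronglyMeasurable, by
      rw [eLpNorm_two_eq_l2]; exact h.lt_top⟩
  rw [← hn]
  exact iInf₂_le a (IsMultiplier.of_isFunction hu ha fun z => rfl)

theorem xNorm_one_eq (s b : ℝ) (u : 𝓢'(Plane, ℂ)) : xNorm χ s b 1 u =
    ∑' x : ℕ × ℕ, pw (idx x.1 * s + idx x.2 * b) * blockNorm χ x.1 x.2 u := by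
  rw [xNorm, eLpNorm_one_eq_lintegral_enorm, lintegral_count]
  rfl

theorem xNorm_two_eq (s b : ℝ) (u : 𝓢'(Plane, ℂ)) : xNorm χ s b 2 u =
    s2 fun x : ℕ × ℕ => pw (idx x.1 * s + idx x.2 * b) * blockNorm χ x.1 x.2 u := by
  rw [xNorm, eLpNorm_eq_lintegral_rpow_enorm_toReal (by norm_num) (by norm_num), lintegral_count,
    s2]
  simp [pw]

theorem s2_mono {ι : Type*} {f g : ι → ℝ≥0∞} (h : ∀ i, f i ≤ g i) : s2 f ≤ s2 g :=
  ENNReal.rpow_le_rpow (ENNReal.tsum_le_tsum fun i => by gcongr; exact h i) (by norm_num)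

theorem le_s2 {ι : Type*} (f : ι → ℝ≥0∞) (i : ι) : f i ≤ s2 f := by
  rw [← ENNReal.pow_le_pow_left_iff (n := 2) (by norm_num), s2_sq]
  exact ENNReal.le_tsum (f := fun i => f i ^ 2) i

theorem xNorm_one_le {u : 𝓢'(Plane, ℂ)} {g : Plane → ℂ} (hg : Measurable g)
    (hu : IsFunction (𝓕 u) g) (s b : ℝ) :
    xNorm χ s b 1 u ≤ ∑' x : ℕ × ℕ, fnorm χ s b g x.1 x.2 := by
  rw [xNorm_one_eq]
  exact ENNReal.tsum_le_tsum fun x => mul_le_mul' le_rfl (blockNorm_le hg hu _ _)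

theorem tsum_fnorm_le_xNorm {u : 𝓢'(Plane, ℂ)} {g : Plane → ℂ} (hu : IsFunction (𝓕 u) g)
    (s b : ℝ) : ∑' x : ℕ × ℕ, fnorm χ s b g x.1 x.2 ≤ xNorm χ s b 1 u := by
  rw [xNorm_one_eq]
  exact ENNReal.tsum_le_tsum fun x => mul_le_mul' le_rfl (le_blockNorm hu _ _)

theorem s2_fnorm_le_xNorm {u : 𝓢'(Plane, ℂ)} {g : Plane → ℂ} (hu : IsFunction (𝓕 u) g)
    (s b : ℝ) : s2 (fun x : ℕ × ℕ => fnorm χ s b g x.1 x.2) ≤ xNorm χ s b 2 u := by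
  rw [xNorm_two_eq]
  exact s2_mono fun x => mul_le_mul' le_rfl (le_blockNorm hu _ _)

theorem xNorm_two_le_one (s b : ℝ) (u : 𝓢'(Plane, ℂ)) : xNorm χ s b 2 u ≤ xNorm χ s b 1 u := by
  rw [xNorm_one_eq, xNorm_two_eq]
  exact s2_le_tsum _

/-- The Fourier transform of an element of one of the spaces is a function. -/
theorem MemX.exists_isFunction {s b : ℝ} {u : 𝓢'(Plane, ℂ)} (hu : MemX χ s b 2 u) :
    ∃ g, Measurable g ∧ IsFunction (𝓕 u) g := by
  have h1 : blockNorm χ 0 0 u < ∞ := by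
    rw [MemX, xNorm_two_eq] at hu
    have h2 := (le_s2 _ (0, 0)).trans_lt hu
    refine lt_top_iff_ne_top.2 fun h => ?_
    rw [h, ENNReal.mul_top (pw_ne_zero _)] at h2
    exact h2.ne rfl
  obtain ⟨a, ha⟩ := iInf_lt_iff.1 h1
  obtain ⟨⟨g, hg, -⟩, -⟩ := iInf_lt_iff.1 ha
  have hm := hg.1.aestronglyMeasurable
  exact ⟨hm.mk g, hm.stronglyMeasurable_mk.measurable, hg.congr hm.ae_eq_mk⟩

/-! ### The Fourier transform of a product of square integrable functions -/

/-- The convolution of two functions on the plane. -/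
noncomputable def conv (A B : Plane → ℂ) (z : Plane) : ℂ := ∫ y, A y * B (z - y)

theorem conv_comm (A B : Plane → ℂ) (z : Plane) : conv A B z = conv B A z := by
  unfold conv
  rw [← integral_sub_left_eq_self _ _ z]
  simp only [sub_sub_cancel]
  congr 1; ext y; ring

theorem conv_congr {A A' B B' : Plane → ℂ} (hA : A =ᵐ[volume] A') (hB : B =ᵐ[volume] B')
    (z : Plane) : conv A B z = conv A' B' z := by
  refine integral_congr_ae ?_
  have h : (fun y => B (z - y)) =ᵐ[volume] fun y => B' (z - y) :=
    (Measure.measurePreserving_sub_left volume z).quasiMeasurePreserving.ae_eq_comp hB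
  filter_upwards [hA, h] with y h1 h2
  rw [h1, h2]

theorem measurable_conv {A B : Plane → ℂ} (hA : Measurable A) (hB : Measurable B) :
    Measurable (conv A B) := by
  have : StronglyMeasurable fun p : Plane × Plane => A p.2 * B (p.1 - p.2) :=
    (by fun_prop : Measurable fun p : Plane × Plane => A p.2 * B (p.1 - p.2)).stronglyMeasurable
  exact this.integral_prod_right.measurable

theorem enorm_conv_le {A B : Plane → ℂ} (z : Plane) :
    ‖conv A B z‖ₑ ≤ ∫⁻ y, ‖A y‖ₑ * ‖B (z - y)‖ₑ := by
  refine (enorm_integral_le_lintegral_enorm _).trans (le_of_eq ?_)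
  simp_rw [enorm_mul]

theorem enorm_conv_le_l2 {A B : Plane → ℂ} (hA : Measurable A) (hB : Measurable B) (z : Plane) :
    ‖conv A B z‖ₑ ≤ l2 (fun z => ‖A z‖ₑ) * l2 fun z => ‖B z‖ₑ := by
  have := lintegral_mul_shift_le true hA.enorm hB.enorm z
  simp only [shift] at this
  exact (enorm_conv_le z).trans this

/-- Young's inequality for the exponents `2`, `2` and `∞`. -/
theorem norm_conv_le (a b : Lp ℂ 2 (volume : Measure Plane)) (z : Plane) :
    ‖conv a b z‖ ≤ ‖a‖ * ‖b‖ := by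
  have h := enorm_conv_le_l2 (Lp.stronglyMeasurable a).measurable
    (Lp.stronglyMeasurable b).measurable z
  rw [← eLpNorm_two_eq_l2, ← eLpNorm_two_eq_l2, ← Lp.enorm_def, ← Lp.enorm_def,
    ← ofReal_norm, ← ofReal_norm, ← ofReal_norm, ← ENNReal.ofReal_mul (norm_nonneg _)] at h
  exact (ENNReal.ofReal_le_ofReal_iff (by positivity)).1 h

theorem measurable_conv_lp (a b : Lp ℂ 2 (volume : Measure Plane)) : Measurable (conv a b) :=
  measurable_conv (Lp.stronglyMeasurable a).measurable (Lp.stronglyMeasurable b).measurable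

theorem continuous_conv_apply (b : Lp ℂ 2 (volume : Measure Plane)) (z : Plane) :
    Continuous fun a : Lp ℂ 2 (volume : Measure Plane) => conv a b z := by
  have hb : MemLp (fun y => b (z - y)) 2 (volume : Measure Plane) :=
    (Lp.memLp b).comp_measurePreserving (Measure.measurePreserving_sub_left volume z)
  have h : (fun a : Lp ℂ 2 (volume : Measure Plane) => conv a b z) =
      fun a => (ContinuousLinearMap.mul ℂ ℂ).lpPairing volume 2 2 a (hb.toLp _) := by
    ext a
    rw [ContinuousLinearMap.lpPairing_eq_integral, conv]
    refine integral_congr_ae ?_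
    filter_upwards [hb.coeFn_toLp] with y hy
    rw [hy]; rfl
  rw [h]
  exact (((ContinuousLinearMap.mul ℂ ℂ).lpPairing volume 2 2).flip (hb.toLp _)).continuous

/-- Continuity needed to extend the convolution theorem from Schwartz functions by density. -/
theorem continuous_integral_conv (b : Lp ℂ 2 (volume : Measure Plane)) (f : 𝓢(Plane, ℂ)) :
    Continuous fun a : Lp ℂ 2 (volume : Measure Plane) => ∫ z, conv a b z * f z := by
  refine continuous_iff_continuousAt.2 fun a₀ => ?_
  refine continuousAt_of_dominated (bound := fun z => (‖a₀‖ + 1) * ‖b‖ * ‖f z‖) ?_ ?_ ?_ ?_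
  · exact Filter.Eventually.of_forall fun a =>
      ((measurable_conv_lp a b).mul f.continuous.measurable).aestronglyMeasurable
  · have : ∀ᶠ a : Lp ℂ 2 (volume : Measure Plane) in nhds a₀, ‖a‖ < ‖a₀‖ + 1 :=
      continuous_norm.continuousAt.eventually_lt continuousAt_const (by linarith)
    filter_upwards [this] with a ha
    refine Filter.Eventually.of_forall fun z => ?_
    rw [norm_mul]
    gcongr
    exact (norm_conv_le a b z).trans (by gcongr)
  · exact f.integrable.norm.const_mul _
  · exact Filter.Eventually.of_forall fun z =>
      ((continuous_conv_apply b z).mul continuous_const).continuousAt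

theorem continuous_integral_mul (b : Lp ℂ 2 (volume : Measure Plane)) (f : 𝓢(Plane, ℂ)) :
    Continuous fun a : Lp ℂ 2 (volume : Measure Plane) => ∫ z, a z * b z * f z := by
  have hb : MemLp (fun z => b z * f z) 2 (volume : Measure Plane) :=
    (f.memLp ∞).mul (Lp.memLp b)
  have h : (fun a : Lp ℂ 2 (volume : Measure Plane) => ∫ z, a z * b z * f z) =
      fun a => (ContinuousLinearMap.mul ℂ ℂ).lpPairing volume 2 2 a (hb.toLp _) := by
    ext a
    rw [ContinuousLinearMap.lpPairing_eq_integral]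
    refine integral_congr_ae ?_
    filter_upwards [hb.coeFn_toLp] with y hy
    rw [hy, mul_assoc]; rfl
  rw [h]
  exact (((ContinuousLinearMap.mul ℂ ℂ).lpPairing volume 2 2).flip (hb.toLp _)).continuous

/-- The convolution theorem for Schwartz functions, in weak form. -/
theorem fourier_mul_schwartz (f g φ : 𝓢(Plane, ℂ)) :
    ∫ z, f z * g z * (𝓕 φ) z = ∫ z, conv (𝓕 f : 𝓢(Plane, ℂ)) (𝓕 g : 𝓢(Plane, ℂ)) z * φ z := by
  set B := ContinuousLinearMap.mul ℂ ℂ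
  have h2 (f : 𝓢(Plane, ℂ)) (x : Plane) : (𝓕 (𝓕 f)) (-x) = f x := by
    have h3 : (𝓕⁻ (𝓕 f)) x = f x := by rw [fourierInv_fourier_eq]
    rw [← h3, SchwartzMap.fourierInv_coe, SchwartzMap.fourier_coe, Real.fourierInv_eq_fourier_neg]
  have h1 : 𝓕 (SchwartzMap.pairing B f g) = SchwartzMap.convolution B (𝓕 f) (𝓕 g) := by
    ext z
    have h3 : SchwartzMap.convolution B (𝓕 f) (𝓕 g) =
        𝓕⁻ (SchwartzMap.pairing B (𝓕 (𝓕 f)) (𝓕 (𝓕 g))) := by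
      rw [← SchwartzMap.fourier_convolution, fourierInv_fourier_eq]
    rw [h3, SchwartzMap.fourierInv_coe, SchwartzMap.fourier_coe,
      Real.fourierInv_eq_fourier_comp_neg]
    refine congrArg (fun h : Plane → ℂ => 𝓕 h z) (funext fun x => ?_)
    rw [SchwartzMap.pairing_apply_apply, SchwartzMap.pairing_apply_apply, h2, h2]
  calc _ = ∫ z, SchwartzMap.pairing B f g z * (𝓕 φ) z := rfl
    _ = ∫ z, (𝓕 (SchwartzMap.pairing B f g)) z * φ z :=
        (SchwartzMap.integral_fourier_mul_eq _ _).symm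
    _ = _ := by
        rw [h1]
        congr 1; ext z
        rw [SchwartzMap.convolution_apply]
        rfl

/-- The Fourier transform of a product of two functions in `L²` is the convolution of their Fourier
transforms. -/
theorem fourier_mul_lp (a b : Lp ℂ 2 (volume : Measure Plane)) (φ : 𝓢(Plane, ℂ)) :
    ∫ z, a z * b z * (𝓕 φ) z = ∫ z, conv (𝓕 a : Lp ℂ 2 (volume : Measure Plane))
      (𝓕 b : Lp ℂ 2 (volume : Measure Plane)) z * φ z := by
  have hdense := SchwartzMap.denseRange_toLpCLM (E := Plane) (F := ℂ) (μ := volume) (p := 2)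
    ENNReal.ofNat_ne_top
  have hF : Continuous fun a : Lp ℂ 2 (volume : Measure Plane) =>
    (𝓕 a : Lp ℂ 2 (volume : Measure Plane)) := continuous_fourier
  refine hdense.induction_on (p := fun a => ∫ z, a z * b z * (𝓕 φ) z =
    ∫ z, conv (𝓕 a : Lp ℂ 2 (volume : Measure Plane))
      (𝓕 b : Lp ℂ 2 (volume : Measure Plane)) z * φ z) a ?_ fun f => ?_
  · exact isClosed_eq (continuous_integral_mul b _) ((continuous_integral_conv _ φ).comp hF)
  refine hdense.induction_on (p := fun b => ∫ z, (toLpCLM ℂ ℂ 2 volume f) z * b z * (𝓕 φ) z =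
    ∫ z, conv (𝓕 (toLpCLM ℂ ℂ 2 volume f) : Lp ℂ 2 (volume : Measure Plane))
      (𝓕 b : Lp ℂ 2 (volume : Measure Plane)) z * φ z) b ?_ fun g => ?_
  · simp_rw [fun z (b : Lp ℂ 2 (volume : Measure Plane)) =>
      mul_comm ((toLpCLM ℂ ℂ 2 volume f) z) (b z), fun b : Lp ℂ 2 (volume : Measure Plane) =>
      conv_comm (𝓕 (toLpCLM ℂ ℂ 2 volume f) : Lp ℂ 2 (volume : Measure Plane))
      (𝓕 b : Lp ℂ 2 (volume : Measure Plane))]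
    exact isClosed_eq (continuous_integral_mul _ _) ((continuous_integral_conv _ φ).comp hF)
  · simp only [toLpCLM_apply, SchwartzMap.toLp_fourier_eq]
    calc _ = ∫ z, f z * g z * (𝓕 φ) z := by
          refine integral_congr_ae ?_
          filter_upwards [f.coeFn_toLp 2 volume, g.coeFn_toLp 2 volume] with z h1 h2
          rw [h1, h2]
      _ = _ := fourier_mul_schwartz f g φ
      _ = _ := by
          congr 1; ext z
          rw [conv_congr ((𝓕 f).coeFn_toLp 2 volume).symm ((𝓕 g).coeFn_toLp 2 volume).symm]

/-- The product of two functions in `L²` is a tempered distribution, whose Fourier transform is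
given by the convolution of the Fourier transforms. -/
theorem exists_isFunction_mul (a b : Lp ℂ 2 (volume : Measure Plane)) :
    ∃ W : 𝓢'(Plane, ℂ), IsFunction W (fun z => a z * b z) ∧
      IsFunction (𝓕 W) (conv (𝓕 a : Lp ℂ 2 (volume : Measure Plane))
        (𝓕 b : Lp ℂ 2 (volume : Measure Plane))) := by
  obtain ⟨W, hW⟩ := exists_isFunction_of_memLp (p := 1) le_rfl
    ((Lp.memLp b).mul (Lp.memLp a) : MemLp (fun z => a z * b z) 1 volume)
  have hc : MemLp (conv (𝓕 a : Lp ℂ 2 (volume : Measure Plane))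
        (𝓕 b : Lp ℂ 2 (volume : Measure Plane))) ∞ volume :=
    memLp_top_of_bound (measurable_conv_lp _ _).aestronglyMeasurable _
      (Filter.Eventually.of_forall (norm_conv_le _ _))
  obtain ⟨T, hT⟩ := exists_isFunction_of_memLp le_top hc
  refine ⟨W, hW, hT.1, fun φ => ⟨(hT.2 φ).1, ?_⟩⟩
  rw [TemperedDistribution.fourier_apply, (hW.2 _).2, ← fourier_mul_lp]
  rfl

/-! ### Projections, localized products and convergence of the series -/

/-- The sign `±1`. -/
noncomputable def sgn (pos : Bool) : ℝ := if pos then 1 else -1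

/-- The absolute value of the part of `g` carried by the frequencies of sign `±`, reflected to
positive frequencies. -/
noncomputable def half (pos : Bool) (g : Plane → ℂ) (y : Plane) : ℝ≥0∞ :=
  if 0 < xi y then ‖g (if pos then y else -y)‖ₑ else 0

theorem measurable_half (pos : Bool) {g : Plane → ℂ} (hg : Measurable g) :
    Measurable (half pos g) := by
  refine Measurable.ite (measurableSet_lt measurable_const measurable_xi) ?_ measurable_const
  cases pos
  · exact (hg.comp measurable_neg).enorm
  · exact hg.enorm

theorem half_ne_zero {pos : Bool} {g : Plane → ℂ} {z : Plane} (h : half pos g z ≠ 0) :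
    0 < xi z := by
  by_contra h0
  exact h (if_neg h0)

theorem half_of_pos {pos : Bool} {g : Plane → ℂ} {z : Plane} (h : 0 < xi z) :
    half pos g z = ‖g (if pos then z else -z)‖ₑ := if_pos h

theorem l2_comp_neg (f : Plane → ℝ≥0∞) : l2 (fun z => f (-z)) = l2 f := by
  unfold l2
  rw [lintegral_neg_eq_self (fun z => f z ^ 2)]

theorem l2_blk_half_le (pos : Bool) (g : Plane → ℂ) (n l : ℤ) :
    l2 ((blk n l).indicator (half pos g)) ≤ symBlk g n l := by
  cases pos
  · rw [symBlk, ← l2_comp_neg]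
    refine l2_mono fun z => ?_
    by_cases hz : -z ∈ blk n l
    · rw [Set.indicator_of_mem hz]
      obtain ⟨h1, h2, h3⟩ := hz
      rw [half_of_pos h1, Set.indicator_of_mem]
      · simp
      · rw [xi_neg] at h1
        rw [fn_neg] at h2
        rw [fl_neg] at h3
        exact ⟨by linarith, h2, h3⟩
    · rw [Set.indicator_of_notMem hz]; exact zero_le
  · refine l2_mono fun z => ?_
    by_cases hz : z ∈ blk n l
    · rw [Set.indicator_of_mem hz, half_of_pos hz.1, Set.indicator_of_mem]
      · simp
      · exact ⟨hz.1.ne', hz.2⟩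
    · rw [Set.indicator_of_notMem hz]; exact zero_le

/-- The symbol of `P^±`. -/
noncomputable def projSym (ε ξ : ℝ) : ℂ := if 0 ≤ ε * ξ then 1 else 0

theorem measurable_projSym (ε : ℝ) : Measurable (projSym ε) :=
  Measurable.ite (measurableSet_le measurable_const (by fun_prop)) measurable_const
    measurable_const

theorem enorm_projSym_le (ε ξ : ℝ) : ‖projSym ε ξ‖ₑ ≤ 1 := by
  unfold projSym; split_ifs <;> simp

theorem enorm_proj_le_half (pos : Bool) (g : Plane → ℂ) {y : Plane} (hy : xi y ≠ 0) :
    ‖projSym (sgn pos) (xi (if pos then y else -y)) * g (if pos then y else -y)‖ₑ ≤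
      half pos g y := by
  rcases lt_or_gt_of_ne hy with h | h
  · rw [projSym, if_neg]
    · simp
    · cases pos
      · simp [sgn, h]
      · simp [sgn, h]
  · rw [half_of_pos h, enorm_mul]
    exact mul_le_of_le_one_left zero_le (enorm_projSym_le _ _)

theorem ae_xi_shift_ne_zero (pos : Bool) (z : Plane) : ∀ᵐ y, xi (shift pos z y) ≠ 0 := by
  have h : MeasurePreserving (shift pos z) (volume : Measure Plane) volume := by
    cases pos
    · have : shift false z = fun y => z + y := by ext1 y; simp [shift]
      rw [this]; exact measurePreserving_add_left volume z
    · have : shift true z = fun y => z - y := by ext1 y; simp [shift]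
      rw [this]; exact Measure.measurePreserving_sub_left volume z
  exact h.quasiMeasurePreserving.ae ae_xi_ne_zero

/-- The convolution of the projected functions in terms of their reflections to positive
frequencies. -/
theorem enorm_conv_proj_le (pos : Bool) (m₁ m₂ : ℝ → ℂ) (gv gu : Plane → ℂ) (z : Plane) :
    ‖conv (fun y => m₁ (xi y) * (projSym (sgn pos) (xi y) * gv y))
      (fun y => m₂ (xi y) * (projSym 1 (xi y) * gu y)) z‖ₑ ≤
    ∫⁻ y, ‖m₁ (sgn pos * xi y)‖ₑ * ‖m₂ (xi (shift pos z y))‖ₑ *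
      (half pos gv y * half true gu (shift pos z y)) := by
  have h1 : ∀ y, xi y ≠ 0 → xi (shift pos z y) ≠ 0 →
      ‖m₁ (xi (if pos then y else -y)) * (projSym (sgn pos) (xi (if pos then y else -y)) *
        gv (if pos then y else -y))‖ₑ *
      ‖m₂ (xi (shift pos z y)) * (projSym 1 (xi (shift pos z y)) * gu (shift pos z y))‖ₑ ≤
      ‖m₁ (sgn pos * xi y)‖ₑ * ‖m₂ (xi (shift pos z y))‖ₑ *
      (half pos gv y * half true gu (shift pos z y)) := by
    intro y hy hy'
    have e1 := enorm_proj_le_half pos gv hy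
    have e2 := enorm_proj_le_half true gu hy'
    simp only [if_true, sgn] at e2
    have e3 : xi (if pos then y else -y) = sgn pos * xi y := by cases pos <;> simp [sgn]
    rw [enorm_mul (m₁ _), enorm_mul (m₂ _), e3]
    rw [e3] at e1
    calc _ ≤ ‖m₁ (sgn pos * xi y)‖ₑ * half pos gv y *
          (‖m₂ (xi (shift pos z y))‖ₑ * half true gu (shift pos z y)) := by gcongr
      _ = _ := by ring
  refine (enorm_conv_le z).trans ?_
  have h2 := (ae_xi_ne_zero.and (ae_xi_shift_ne_zero pos z)).mono fun y hy => h1 y hy.1 hy.2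
  cases pos
  · rw [← lintegral_neg_eq_self]
    refine lintegral_mono_ae ?_
    filter_upwards [h2] with y hy
    simpa [shift] using hy
  · refine lintegral_mono_ae ?_
    filter_upwards [h2] with y hy
    simpa [shift] using hy

/-- Bounded symbols of bounded support. -/
def CompactSymbol (m : ℝ → ℂ) : Prop :=
  Measurable m ∧ ∃ (K : ℝ≥0) (N : ℕ), ∀ ξ, m ξ ≠ 0 → ‖m ξ‖ₑ ≤ K ∧ |ξ| ≤ 2 ^ N

theorem IsCutoff.compactSymbol_lpSymbol (hχ : IsCutoff χ) (p : ℕ) :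
    CompactSymbol (lpSymbol χ p) := by
  obtain ⟨K, hK⟩ := exists_norm_lpSymbol_le χ
  refine ⟨measurable_lpSymbol χ p, K, p + 1, fun ξ h => ⟨hK p ξ, ?_⟩⟩
  cases p with
  | zero => simpa using hχ.lpSymbol_zero_ne_zero h
  | succ n => exact (hχ.lpSymbol_succ_ne_zero h).2

theorem IsCutoff.compactSymbol_lowSymbol (hχ : IsCutoff χ) (p : ℕ) :
    CompactSymbol (lowSymbol χ p) := by
  obtain ⟨C, hC0, hC⟩ := χ.decay 0 0
  simp only [pow_zero, one_mul, norm_iteratedFDeriv_zero] at hC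
  refine ⟨measurable_lowSymbol χ p, C.toNNReal, p, fun ξ h => ?_⟩
  match p with
  | 0 => simp [lowSymbol] at h
  | 1 => simp [lowSymbol] at h
  | n + 2 =>
    refine ⟨?_, (hχ.lowSymbol_ne_zero h).trans (pow_le_pow_right₀ (by norm_num) (by omega))⟩
    rw [← ofReal_norm]
    exact ENNReal.ofReal_le_ofReal (hC _)

theorem max_fn_le {z : Plane} (hz : xi z ≠ 0) {N : ℕ} (h : |xi z| ≤ 2 ^ N) :
    max (fn z) 0 ≤ N := by
  have : fn z ≤ N := int_log_le_of_le (abs_pos.2 hz) (h.trans_lt (by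
    rw [← zpow_natCast]; exact zpow_lt_zpow_right₀ (by norm_num) (by omega)))
  omega

theorem measurable_pw_inh_int (s b : ℝ) :
    Measurable fun x : ℤ × ℤ => pw (inh s x.1 + b * x.2) := measurable_of_countable _

theorem measurable_pw_inh (s b : ℝ) :
    Measurable fun z : Plane => pw (inh s (fn z) + b * fl z) := by
  have h : Measurable fun z : Plane => (fn z, fl z) := measurable_fn.prodMk measurable_fl
  have h' := (measurable_pw_inh_int s b).comp h
  exact h'

/-- Localization to a bounded set of frequencies makes an element of one of the spaces square
integrable. -/
theorem CompactSymbol.memLp {m : ℝ → ℂ} (hm : CompactSymbol m) {g : Plane → ℂ}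
    (hg : Measurable g) {s : ℝ} (h : l2 (fun z => pw (inh s (fn z)) * ‖g z‖ₑ) < ∞) (ε : ℝ) :
    MemLp (fun z => m (xi z) * (projSym ε (xi z) * g z)) 2 volume := by
  obtain ⟨hm, K, N, hK⟩ := hm
  refine ⟨((hm.comp measurable_xi).mul
    (((measurable_projSym ε).comp measurable_xi).mul hg)).aestronglyMeasurable, ?_⟩
  rw [eLpNorm_two_eq_l2]
  have hmeas : Measurable fun z => pw (inh s (fn z)) * ‖g z‖ₑ := by
    have := measurable_pw_inh s 0
    simp only [zero_mul, add_zero] at this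
    fun_prop
  calc _ ≤ l2 fun z => (K * pw (|s| * N)) * (pw (inh s (fn z)) * ‖g z‖ₑ) := by
        refine l2_mono_ae ?_
        filter_upwards [ae_xi_ne_zero] with z hz
        rw [enorm_mul, enorm_mul]
        by_cases h0 : m (xi z) = 0
        · simp [h0]
        obtain ⟨h1, h2⟩ := hK _ h0
        have h3 : (1 : ℝ≥0∞) ≤ pw (|s| * N) * pw (inh s (fn z)) := by
          rw [← pw_add, ← pw_zero]
          apply pw_mono
          have h4 : ((max (fn z) 0 : ℤ) : ℝ) ≤ N := by exact_mod_cast max_fn_le hz h2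
          have h5 : (0 : ℝ) ≤ ((max (fn z) 0 : ℤ) : ℝ) := by exact_mod_cast le_max_right _ _
          unfold inh
          nlinarith [neg_abs_le s, abs_nonneg s]
        calc _ ≤ K * (1 * ‖g z‖ₑ) := by gcongr; exact enorm_projSym_le _ _
          _ ≤ K * ((pw (|s| * N) * pw (inh s (fn z))) * ‖g z‖ₑ) := by gcongr
          _ = _ := by ring
    _ = _ := l2_const_mul hmeas _
    _ < ∞ := ENNReal.mul_lt_top (ENNReal.mul_lt_top ENNReal.coe_lt_top (pw_ne_top _).lt_top) h

/-- Dyadic weights are controlled by the polynomial weights. -/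
theorem exists_inv_jb_le (s b : ℝ) : ∃ (M : ℕ) (C : ℝ≥0∞), C < ∞ ∧
    ∀ z : Plane, xi z ≠ 0 → ENNReal.ofReal (jb M z)⁻¹ ≤ C * pw (inh s (fn z) + b * fl z) := by
  obtain ⟨M, hM⟩ := exists_nat_ge (|s| + |b|)
  refine ⟨2 * M, ENNReal.ofReal ((100 : ℝ) ^ (2 * M)), ENNReal.ofReal_lt_top, fun z hz => ?_⟩
  have hjb : 0 < jb (2 * M) z := jb_pos _ z
  -- `100` exceeds the constants in the bounds of the frequency and of the modulation by `1 + |z| ^ 2`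
  set X := 100 * (1 + ‖z‖ ^ 2) with hX
  have hpi : Real.pi < 4 := Real.pi_lt_four
  have h0 (i : Fin 2) : |z i| ≤ 1 + ‖z‖ ^ 2 := by
    have h1 : |z i| ≤ ‖z‖ := by
      simpa using PiLp.norm_apply_le z i
    nlinarith [norm_nonneg z, sq_nonneg (‖z‖ - 1)]
  have h0' : |z 0| ^ 2 ≤ ‖z‖ ^ 2 := by
    have h1 : |z 0| ≤ ‖z‖ := by
      simpa using PiLp.norm_apply_le z 0
    gcongr
  have hx1 : |xi z| ≤ 8 * |z 0| := by
    rw [xi, abs_mul, abs_of_pos (by positivity : (0:ℝ) < 2 * Real.pi)]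
    have := abs_nonneg (z 0)
    nlinarith
  have h1 : (2 : ℝ) ^ max (fn z) 0 ≤ X := by
    rcases le_total (fn z) 0 with h | h
    · rw [max_eq_right h, zpow_zero]; nlinarith [sq_nonneg ‖z‖]
    · rw [max_eq_left h]
      have := zpow_fn_le hz
      have := h0 0
      nlinarith
  have h2 : (2 : ℝ) ^ fl z ≤ X := by
    refine (zpow_fl_le z).trans ?_
    have a1 : |sg z| ≤ 8 * |z 1| + |xi z| * |xi z| := by
      rw [sg]
      refine (abs_sub _ _).trans ?_
      rw [abs_mul (xi z), abs_abs, abs_mul, abs_of_pos (by positivity : (0:ℝ) < 2 * Real.pi)]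
      have := abs_nonneg (z 1)
      nlinarith
    have a2 : |xi z| * |xi z| ≤ 64 * ‖z‖ ^ 2 := by
      have := abs_nonneg (xi z)
      nlinarith
    have := h0 1
    nlinarith [sq_nonneg ‖z‖]
  have hX1 : 1 ≤ X := by nlinarith [sq_nonneg ‖z‖]
  have key : (1 : ℝ) ≤ X ^ (2 * M) * (2 : ℝ) ^ (inh s (fn z) + b * fl z) := by
    have e1 : (2 : ℝ) ^ (-(inh s (fn z) + b * fl z)) ≤ X ^ (2 * M) := by
      have hn : (0 : ℝ) ≤ ((max (fn z) 0 : ℤ) : ℝ) := by exact_mod_cast le_max_right _ _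
      have hl : (0 : ℝ) ≤ (fl z : ℝ) := by exact_mod_cast fl_nonneg z
      calc (2 : ℝ) ^ (-(inh s (fn z) + b * fl z))
          ≤ (2 : ℝ) ^ (((max (fn z) 0 : ℤ) : ℝ) * M + (fl z : ℝ) * M) := by
            apply Real.rpow_le_rpow_of_exponent_le (by norm_num)
            unfold inh
            nlinarith [neg_abs_le s, neg_abs_le b, abs_nonneg s, abs_nonneg b]
        _ = ((2 : ℝ) ^ max (fn z) 0) ^ M * ((2 : ℝ) ^ fl z) ^ M := by
            rw [Real.rpow_add (by norm_num), Real.rpow_mul_natCast (by norm_num),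
              Real.rpow_mul_natCast (by norm_num), Real.rpow_intCast, Real.rpow_intCast]
        _ ≤ X ^ M * X ^ M := by gcongr
        _ = _ := by rw [two_mul, pow_add]
    rw [Real.rpow_neg (by norm_num), inv_le_iff_one_le_mul₀ (by positivity)] at e1
    exact e1
  rw [← ofReal_two_rpow, ← ENNReal.ofReal_mul (by positivity)]
  apply ENNReal.ofReal_le_ofReal
  rw [inv_le_iff_one_le_mul₀ hjb]
  calc (1 : ℝ) ≤ X ^ (2 * M) * (2 : ℝ) ^ (inh s (fn z) + b * fl z) := key
    _ = _ := by rw [hX, mul_pow, jb]; ring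

theorem temperate_of_l2 {F : Plane → ℝ≥0∞} (hF : Measurable F) {s b : ℝ}
    (h : l2 (fun z => pw (inh s (fn z) + b * fl z) * F z) < ∞) : Temperate F := by
  obtain ⟨M, C, hC, hM⟩ := exists_inv_jb_le s b
  refine ⟨M, ?_⟩
  calc _ ≤ l2 fun z => C * (pw (inh s (fn z) + b * fl z) * F z) := by
        refine l2_mono_ae ?_
        filter_upwards [ae_xi_ne_zero] with z hz
        rw [← mul_assoc]
        exact mul_le_mul' (hM z hz) le_rfl
    _ = _ := l2_const_mul ((measurable_pw_inh s b).mul hF) _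
    _ < ∞ := ENNReal.mul_lt_top hC h

/-- The projections are defined on the spaces under consideration. -/
theorem exists_isProj {ε s : ℝ} {u : 𝓢'(Plane, ℂ)} {g : Plane → ℂ} (hg : Measurable g)
    (hu : IsFunction (𝓕 u) g) (h : l2 (fun z => pw (inh s (fn z)) * ‖g z‖ₑ) < ∞) :
    ∃ u₁, IsProj ε u u₁ ∧ IsFunction (𝓕 u₁) fun z => projSym ε (xi z) * g z := by
  have hm : Measurable fun z => projSym ε (xi z) * g z :=
    ((measurable_projSym ε).comp measurable_xi).mul hg
  obtain ⟨T, hT⟩ := exists_isFunction (h := fun z => projSym ε (xi z) * g z)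
    hm.aestronglyMeasurable (temperate_of_l2 hm.enorm (s := s) (b := 0) (by
      refine lt_of_le_of_lt (l2_mono fun z => ?_) h
      rw [zero_mul, add_zero, enorm_mul]
      gcongr
      exact mul_le_of_le_one_left zero_le (enorm_projSym_le _ _)))
  have h1 : IsFunction (𝓕 (𝓕⁻ T)) fun z => projSym ε (xi z) * g z := by
    rwa [fourier_fourierInv_eq]
  exact ⟨𝓕⁻ T, IsMultiplier.of_isFunction hu h1 fun z => rfl, h1⟩

/-- The single terms of the series, and a bound for their Fourier transforms. -/
theorem exists_localizedProduct (pos : Bool) {m₁ m₂ : ℝ → ℂ} (h₁ : CompactSymbol m₁)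
    (h₂ : CompactSymbol m₂) {v₁ u₁ : 𝓢'(Plane, ℂ)} {gv gu : Plane → ℂ} {s s' : ℝ}
    (hgv : Measurable gv) (hgu : Measurable gu)
    (hv : IsFunction (𝓕 v₁) fun z => projSym (sgn pos) (xi z) * gv z)
    (hu : IsFunction (𝓕 u₁) fun z => projSym 1 (xi z) * gu z)
    (hnv : l2 (fun z => pw (inh s' (fn z)) * ‖gv z‖ₑ) < ∞)
    (hnu : l2 (fun z => pw (inh s (fn z)) * ‖gu z‖ₑ) < ∞) :
    ∃ (W Q : 𝓢'(Plane, ℂ)) (q : Plane → ℂ), IsLocalizedProduct m₁ m₂ v₁ u₁ W ∧ IsProj 1 W Q ∧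
      Measurable q ∧ IsFunction (𝓕 Q) q ∧ (∀ z, xi z < 0 → q z = 0) ∧
      ∀ z, ‖q z‖ₑ ≤ ∫⁻ y, ‖m₁ (sgn pos * xi y)‖ₑ * ‖m₂ (xi (shift pos z y))‖ₑ *
        (half pos gv y * half true gu (shift pos z y)) := by
  obtain ⟨a, ha, ha', -⟩ := exists_lp_fourier (h₁.memLp hgv hnv (sgn pos))
  obtain ⟨b, hb, hb', -⟩ := exists_lp_fourier (h₂.memLp hgu hnu 1)
  obtain ⟨W, hW, hW'⟩ := exists_isFunction_mul a b
  set c := conv (𝓕 a : Lp ℂ 2 (volume : Measure Plane)) (𝓕 b : Lp ℂ 2 (volume : Measure Plane))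
    with hc
  have hcm : Measurable c := measurable_conv_lp _ _
  have hqm : Measurable fun z => projSym 1 (xi z) * c z :=
    ((measurable_projSym 1).comp measurable_xi).mul hcm
  obtain ⟨T, hT⟩ := exists_isFunction_of_memLp (p := ∞) (h := fun z => projSym 1 (xi z) * c z) le_top
    (memLp_top_of_bound hqm.aestronglyMeasurable
      (‖(𝓕 a : Lp ℂ 2 (volume : Measure Plane))‖ * ‖(𝓕 b : Lp ℂ 2 (volume : Measure Plane))‖)
      (Filter.Eventually.of_forall fun z => by
        rw [norm_mul]
        have h1 : ‖projSym 1 (xi z)‖ ≤ 1 := by unfold projSym; split_ifs <;> simp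
        exact (mul_le_of_le_one_left (norm_nonneg _) h1).trans (norm_conv_le _ _ z)))
  have h1 : IsFunction (𝓕 (𝓕⁻ T)) fun z => projSym 1 (xi z) * c z := by
    rwa [fourier_fourierInv_eq]
  refine ⟨W, 𝓕⁻ T, _, ⟨a, b, IsMultiplier.of_isFunction hv ha' fun z => rfl,
    IsMultiplier.of_isFunction hu hb' fun z => rfl, hW⟩,
    IsMultiplier.of_isFunction hW' h1 fun z => rfl, hqm, h1, fun z hz => ?_, fun z => ?_⟩
  · rw [projSym, if_neg (by linarith), zero_mul]
  · rw [enorm_mul, hc, conv_congr ha hb]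
    exact (mul_le_of_le_one_left zero_le (enorm_projSym_le _ _)).trans
      (enorm_conv_proj_le pos m₁ m₂ gv gu z)

/-- The norm of `X^{σ,-1/2,1}` in terms of the sharp dyadic blocks. -/
noncomputable def outNorm (σ : ℝ) (H : Plane → ℝ≥0∞) : ℝ≥0∞ :=
  ∑' o : ℤ × ℤ, pw (inh σ o.1) * (pw (-(o.2 : ℝ) / 2) * l2 ((blk o.1 o.2).indicator H))

/-- A series of distributions carried by nonnegative frequencies converges, with a bound for the
norm of its sum, if the absolute values on the Fourier side have a sum of finite norm. -/
theorem IsCutoff.exists_hasSum (hχ : IsCutoff χ) (σ : ℝ) : ∃ C : ℝ≥0∞, C < ∞ ∧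
    ∀ {ι : Type} [Countable ι] (R : ι → 𝓢'(Plane, ℂ)) (r : ι → Plane → ℂ) (H : Plane → ℝ≥0∞),
      (∀ i, IsFunction (𝓕 (R i)) (r i)) → (∀ i, Measurable (r i)) →
      (∀ i z, xi z < 0 → r i z = 0) → Measurable H → (∀ z, 0 < xi z → ∑' i, ‖r i z‖ₑ ≤ H z) →
      outNorm σ H < ∞ → ∃ w, HasSum R w ∧ xNorm χ σ (-(1 / 2)) 1 w ≤ C * outNorm σ H := by
  obtain ⟨C, hC, h⟩ := hχ.tsum_fnorm_le σ (-(1 / 2))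
  refine ⟨C, hC, fun {ι} _ R r H hR hr h0 hH hle hfin => ?_⟩
  have hw (l : ℤ) : pw (-(1 / 2) * (l : ℝ)) = pw (-(l : ℝ) / 2) := by congr 1; ring
  have hT : Temperate fun z => ∑' i, ‖r i z‖ₑ := by
    refine temperate_of_l2 (Measurable.tsum fun i => (hr i).enorm) (s := σ) (b := -(1 / 2)) ?_
    have hmH (o : ℤ × ℤ) : Measurable ((blk o.1 o.2).indicator H) :=
      hH.indicator (measurableSet_blk _ _)
    calc _ ≤ l2 fun z => ∑' o : ℤ × ℤ,
          (pw (inh σ o.1) * pw (-(o.2 : ℝ) / 2)) * (blk o.1 o.2).indicator H z := by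
          refine l2_mono_ae ?_
          filter_upwards [ae_xi_ne_zero] with z hz
          rcases lt_or_gt_of_ne hz with hneg | hpos
          · simp [fun i => h0 i z hneg]
          · refine le_trans ?_ (ENNReal.le_tsum (fn z, fl z))
            have hm : z ∈ blk (fn z) (fl z) := ⟨hpos, rfl, rfl⟩
            rw [Set.indicator_of_mem hm, pw_add, hw]
            gcongr
            exact hle z hpos
      _ ≤ ∑' o : ℤ × ℤ, l2 fun z =>
          (pw (inh σ o.1) * pw (-(o.2 : ℝ) / 2)) * (blk o.1 o.2).indicator H z :=
          l2_tsum_le fun o => (hmH o).const_mul _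
      _ = outNorm σ H := by
          refine tsum_congr fun o => ?_
          rw [l2_const_mul (hmH o), mul_assoc]
      _ < ∞ := hfin
  obtain ⟨w, hw1, hw2⟩ := exists_hasSum_of_temperate hR hr hT
  refine ⟨w, hw1, (xNorm_one_le (Measurable.tsum hr) hw2 _ _).trans ?_⟩
  have := h (fun z => ∑' i, r i z) H hH (fun z hz => by simp [fun i => h0 i z hz])
    fun z hz => enorm_tsum_le_tsum_enorm.trans (hle z hz)
  simp_rw [hw] at this
  exact this

/-! ### Bounds of the paraproduct and of the remainder -/

theorem measurable_bconv (pos : Bool) (μ : ℤ → ℤ → ℤ → ℝ≥0∞) {f g : Plane → ℝ≥0∞}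
    (hf : Measurable f) (hg : Measurable g) : Measurable (bconv pos μ f g) := by
  have h1 : Measurable fun x : ℤ × ℤ × ℤ => μ x.1 x.2.1 x.2.2 := measurable_of_countable _
  have h2 : Measurable fun p : Plane × Plane => (fn p.2, fn (shift pos p.1 p.2), fn p.1) :=
    (measurable_fn.comp measurable_snd).prodMk
      ((measurable_fn.comp (measurable_shift pos)).prodMk (measurable_fn.comp measurable_fst))
  have h3 := h1.comp h2
  have h4 : Measurable fun p : Plane × Plane => f p.2 * g (shift pos p.1 p.2) :=
    (hf.comp measurable_snd).mul (hg.comp (measurable_shift pos))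
  have h5 := h3.mul h4
  exact Measurable.lintegral_prod_right' h5

/-- Passage from a pointwise bound of the symbol of a series of bilinear operators to a bound by
`bconv`. -/
theorem tsum_lintegral_le_bconv (pos : Bool) {ι : Type} [Countable ι] {k : ι → ℝ → ℝ → ℝ≥0∞}
    {c : ℝ≥0∞} {μ : ℤ → ℤ → ℤ → ℝ≥0∞} {f g : Plane → ℝ≥0∞} (hf : Measurable f) (hg : Measurable g)
    (hf0 : ∀ z, f z ≠ 0 → 0 < xi z) (hg0 : ∀ z, g z ≠ 0 → 0 < xi z)
    (hk : ∀ i, Measurable fun p : ℝ × ℝ => k i p.1 p.2) (z : Plane)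
    (h : ∀ y, 0 < xi y → 0 < xi (shift pos z y) →
      ∑' i, c * k i (xi y) (xi (shift pos z y)) ≤ μ (fn y) (fn (shift pos z y)) (fn z)) :
    ∑' i, c * ∫⁻ y, k i (xi y) (xi (shift pos z y)) * (f y * g (shift pos z y)) ≤
      bconv pos μ f g z := by
  have hm (i) : Measurable fun y => k i (xi y) (xi (shift pos z y)) * (f y * g (shift pos z y)) := by
    have h1 := measurable_shift_right pos z
    have h2 : Measurable fun y => (xi y, xi (shift pos z y)) :=
      measurable_xi.prodMk (measurable_xi.comp h1)
    have h3 := (hk i).comp h2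
    exact h3.mul (hf.mul (hg.comp h1))
  calc _ = ∑' i, ∫⁻ y, c * (k i (xi y) (xi (shift pos z y)) * (f y * g (shift pos z y))) :=
        tsum_congr fun i => (lintegral_const_mul _ (hm i)).symm
    _ = ∫⁻ y, ∑' i, c * (k i (xi y) (xi (shift pos z y)) * (f y * g (shift pos z y))) :=
        (lintegral_tsum fun i => ((hm i).const_mul _).aemeasurable).symm
    _ ≤ _ := by
        refine lintegral_mono fun y => ?_
        by_cases h1 : f y = 0
        · simp [h1]
        by_cases h2 : g (shift pos z y) = 0
        · simp [h2]
        simp_rw [← mul_assoc c]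
        rw [ENNReal.tsum_mul_right]
        exact mul_le_mul' (h y (hf0 _ h1) (hg0 _ h2)) le_rfl

/-- `g` represents the Fourier transform of `u`, and `u` has finite `L²` norm of order `s` in the
space variable. -/
structure Rep (s : ℝ) (u : 𝓢'(Plane, ℂ)) (g : Plane → ℂ) : Prop where
  meas : Measurable g
  isFunction : IsFunction (𝓕 u) g
  fin : l2 (fun z => pw (inh s (fn z)) * ‖g z‖ₑ) < ∞

theorem xi_shift (pos : Bool) (z y : Plane) : xi z = sgn pos * xi y + xi (shift pos z y) := by
  cases pos <;> simp [sgn, shift]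

theorem sgn_cases (pos : Bool) : sgn pos = 1 ∨ sgn pos = -1 := by cases pos <;> simp [sgn]

theorem abs_sgn_mul (pos : Bool) (x : ℝ) : |sgn pos * x| = |x| := by
  rcases sgn_cases pos with h | h <;> simp [h]

theorem sgn_mul_ne_zero (pos : Bool) {x : ℝ} (h : x ≠ 0) : sgn pos * x ≠ 0 := by
  rcases sgn_cases pos with h' | h' <;> simpa [h'] using h

/-- The paraproduct exists, and is bounded by the positive bilinear operator `bconv`. -/
theorem IsCutoff.exists_paraproduct (hχ : IsCutoff χ) (P : ℕ) (σ : ℝ) :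
    ∃ (K : ℝ≥0) (C : ℝ≥0∞), C < ∞ ∧ ∀ (pos : Bool) (s s' : ℝ) (u v : 𝓢'(Plane, ℂ))
      (gu gv : Plane → ℂ), Rep s u gu → Rep s' v gv →
      outNorm σ (bconv pos (paraMul K P) (half pos gv) (half true gu)) < ∞ →
      ∃ w, IsParaproduct χ (sgn pos) v u w ∧ xNorm χ σ (-(1 / 2)) 1 w ≤
        C * outNorm σ (bconv pos (paraMul K P) (half pos gv) (half true gu)) := by
  obtain ⟨K, hK⟩ := hχ.exists_tsum_paraproduct_le P
  obtain ⟨C, hC, hsum⟩ := hχ.exists_hasSum σ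
  refine ⟨K, C, hC, fun pos s s' u v gu gv hu hv hfin => ?_⟩
  obtain ⟨v₁, hv₁, hv₁'⟩ := exists_isProj (ε := sgn pos) hv.meas hv.isFunction hv.fin
  obtain ⟨u₁, hu₁, hu₁'⟩ := exists_isProj (ε := 1) hu.meas hu.isFunction hu.fin
  choose W Q q hW hQ hqm hqf hq0 hq using fun n : ℕ => exists_localizedProduct pos
    (hχ.compactSymbol_lowSymbol n) (hχ.compactSymbol_lpSymbol n) hv.meas hu.meas hv₁' hu₁'
    hv.fin hu.fin
  have hmv := measurable_half pos hv.meas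
  have hmu := measurable_half true hu.meas
  obtain ⟨w, hw, hw'⟩ := hsum Q q _ hqf hqm hq0 (measurable_bconv pos (paraMul K P) hmv hmu)
    (fun z hz => by
      have := tsum_lintegral_le_bconv pos (c := 1) (μ := paraMul K P)
        (k := fun n x y => ‖lowSymbol χ n (sgn pos * x)‖ₑ * ‖lpSymbol χ n y‖ₑ) hmv hmu
        (fun _ => half_ne_zero) (fun _ => half_ne_zero) (fun n => by
          have h1 := measurable_lowSymbol χ n
          have h2 := measurable_lpSymbol χ n
          fun_prop) z (fun y hy hy' => by
          simp_rw [one_mul]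
          have h1 := hK (sgn pos * xi y) (xi (shift pos z y)) (sgn_mul_ne_zero pos hy.ne') hy'
            (by rwa [← xi_shift])
          rwa [abs_sgn_mul, ← xi_shift] at h1)
      simp_rw [one_mul] at this
      exact (ENNReal.tsum_le_tsum fun n => hq n z).trans this) hfin
  exact ⟨w, ⟨v₁, u₁, W, Q, hv₁, hu₁, hW, hQ, hw⟩, hw'⟩

/-- The differentiated remainder exists, and is bounded by the positive bilinear operator `bconv`.
-/
theorem IsCutoff.exists_derivRemainder (hχ : IsCutoff χ) (σ : ℝ) :
    ∃ (K : ℝ≥0) (C : ℝ≥0∞), C < ∞ ∧ ∀ (pos : Bool) (s s' : ℝ) (u v : 𝓢'(Plane, ℂ))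
      (gu gv : Plane → ℂ), Rep s u gu → Rep s' v gv →
      outNorm σ (bconv pos (remMul K) (half pos gv) (half true gu)) < ∞ →
      ∃ w, IsDerivRemainder χ (sgn pos) v u w ∧ xNorm χ σ (-(1 / 2)) 1 w ≤
        C * outNorm σ (bconv pos (remMul K) (half pos gv) (half true gu)) := by
  obtain ⟨K, hK⟩ := hχ.exists_tsum_remainder_le
  obtain ⟨C, hC, hsum⟩ := hχ.exists_hasSum σ
  refine ⟨K, C, hC, fun pos s s' u v gu gv hu hv hfin => ?_⟩
  obtain ⟨v₁, hv₁, hv₁'⟩ := exists_isProj (ε := sgn pos) hv.meas hv.isFunction hv.fin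
  obtain ⟨u₁, hu₁, hu₁'⟩ := exists_isProj (ε := 1) hu.meas hu.isFunction hu.fin
  choose W Q q hW hQ hqm hqf hq0 hq using fun p : NearDiagonal => exists_localizedProduct pos
    (hχ.compactSymbol_lpSymbol p.1.1) (hχ.compactSymbol_lpSymbol p.1.2) hv.meas hu.meas hv₁' hu₁'
    hv.fin hu.fin
  have hmv := measurable_half pos hv.meas
  have hmu := measurable_half true hu.meas
  obtain ⟨w, hw, hw'⟩ := hsum (fun p => ∂_{(EuclideanSpace.single 0 1 : Plane)} (Q p))
    (fun p z => Complex.I * xi z * q p z) _ (fun p => (hqf p).fourier_lineDeriv)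
    (fun p => by have := hqm p; fun_prop) (fun p z hz => by rw [hq0 p z hz, mul_zero])
    (measurable_bconv pos (remMul K) hmv hmu)
    (fun z hz => by
      have := tsum_lintegral_le_bconv pos (c := ENNReal.ofReal |xi z|) (μ := remMul K)
        (k := fun (p : NearDiagonal) x y =>
          ‖lpSymbol χ p.1.1 (sgn pos * x)‖ₑ * ‖lpSymbol χ p.1.2 y‖ₑ) hmv hmu
        (fun _ => half_ne_zero) (fun _ => half_ne_zero) (fun p => by
          have h1 := measurable_lpSymbol χ p.1.1
          have h2 := measurable_lpSymbol χ p.1.2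
          fun_prop) z (fun y hy hy' => by
          have h1 := hK (sgn pos * xi y) (xi (shift pos z y)) (xi z)
            (sgn_mul_ne_zero pos hy.ne') hy'.ne'
          rwa [abs_sgn_mul] at h1)
      refine (ENNReal.tsum_le_tsum fun p => ?_).trans this
      rw [enorm_mul, enorm_mul, ← ofReal_norm, ← ofReal_norm (xi z : ℂ), Complex.norm_real,
        Complex.norm_I, ENNReal.ofReal_one, one_mul, Real.norm_eq_abs]
      exact mul_le_mul' le_rfl (hq p z)) hfin
  exact ⟨w, ⟨v₁, u₁, W, Q, hv₁, hu₁, hW, hQ, hw⟩, hw'⟩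

/-- The block norms weighted with `2 ^ (n s + l / 2)`. -/
noncomputable def blkNorm (s : ℝ) (f : Plane → ℝ≥0∞) (n l : ℤ) : ℝ≥0∞ :=
  pw (inh s n) * (pw ((l : ℝ) / 2) * l2 ((blk n l).indicator f))

theorem outNorm_bconv_le (pos : Bool) (μ : ℤ → ℤ → ℤ → ℝ≥0∞) {gu gv : Plane → ℂ}
    (hu : Measurable gu) (hv : Measurable gv) (σ s s' : ℝ) :
    outNorm σ (bconv pos μ (half pos gv) (half true gu)) ≤
      8 * total pos (fun n1 n2 n => pw (inh σ n) * μ n1 n2 n * pw (-inh s' n1) * pw (-inh s n2))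
        (blkNorm s' (half pos gv)) (blkNorm s (half true gu)) :=
  tsum_l2_blk_bconv_le pos μ (measurable_half pos hv) (measurable_half true hu)
    (fun _ => half_ne_zero) (fun _ => half_ne_zero) (fun n => pw (inh σ n)) (inh s') (inh s)

theorem s2_blkNorm_le (pos : Bool) (g : Plane → ℂ) (s b : ℝ) (l : ℤ) :
    pw ((b - 1 / 2) * l) * s2 (fun n => blkNorm s (half pos g) n l) ≤ modNorm s b g l := by
  rw [modNorm, show b * (l : ℝ) = (b - 1 / 2) * l + l / 2 by ring, pw_add, mul_assoc]
  refine mul_le_mul' le_rfl ?_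
  rw [← s2_mul_left]
  refine s2_mono fun n => ?_
  rw [blkNorm]
  calc _ = pw ((l : ℝ) / 2) * (pw (inh s n) * l2 ((blk n l).indicator (half pos g))) := by ring
    _ ≤ _ := by gcongr; exact l2_blk_half_le pos g n l

theorem s2_blkNorm_le_half (pos : Bool) (g : Plane → ℂ) (s : ℝ) (l : ℤ) :
    s2 (fun n => blkNorm s (half pos g) n l) ≤ modNorm s (1 / 2) g l := by
  simpa using s2_blkNorm_le pos g s (1 / 2) l

theorem s2_blkNorm_prod_le (pos : Bool) (g : Plane → ℂ) (s : ℝ) :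
    s2 (fun p : ℤ × ℤ => blkNorm s (half pos g) p.1 p.2) ≤ s2 (modNorm s (1 / 2) g) := by
  rw [s2, ENNReal.tsum_prod', ENNReal.tsum_comm]
  refine ENNReal.rpow_le_rpow (ENNReal.tsum_le_tsum fun l => ?_) (by norm_num)
  rw [← s2_sq]
  gcongr
  exact s2_blkNorm_le_half pos g s l

theorem Rep.of_memX (hχ : IsCutoff χ) {s b : ℝ} (hb : 0 ≤ b) {u : 𝓢'(Plane, ℂ)}
    {g : Plane → ℂ} (hg : Measurable g) (hf : IsFunction (𝓕 u) g) (hu : MemX χ s b 2 u) :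
    Rep s u g := by
  refine ⟨hg, hf, ?_⟩
  have h1 := (s2_fnorm_le_xNorm hf s b).trans_lt hu
  have h2 := hχ.l2_inh_sq_le s hb hg
  rw [← s2_sq] at h2
  have h3 := h2.trans_lt (ENNReal.mul_lt_top (cmpConst_ne_top s b).lt_top (ENNReal.pow_lt_top h1))
  exact (ENNReal.pow_lt_top_iff.1 h3).resolve_right (by norm_num)

theorem MemX.two {s b : ℝ} {u : 𝓢'(Plane, ℂ)} (hu : MemX χ s b 1 u) : MemX χ s b 2 u :=
  (xNorm_two_le_one s b u).trans_lt hu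

/-- The norm of `X^{s,1/2,1}` controls the sharp norms, summed over the modulation. -/
theorem IsCutoff.exists_rep_one (hχ : IsCutoff χ) (s : ℝ) : ∃ C : ℝ≥0∞, C < ∞ ∧
    ∀ u, MemX χ s (1 / 2) 1 u → ∃ g, Rep s u g ∧
      ∑' l, modNorm s (1 / 2) g l ≤ C * xNorm χ s (1 / 2) 1 u := by
  refine ⟨3 * cmpConst s (1 / 2) ^ (1 / 2 : ℝ), ENNReal.mul_lt_top (by norm_num)
    (ENNReal.rpow_lt_top_of_nonneg (by norm_num) (cmpConst_ne_top _ _)), fun u hu => ?_⟩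
  obtain ⟨g, hg, hf⟩ := hu.two.exists_isFunction
  refine ⟨g, Rep.of_memX hχ (by norm_num) hg hf hu.two, ?_⟩
  exact (hχ.tsum_modNorm_le s _ hg).trans (mul_le_mul' le_rfl (tsum_fnorm_le_xNorm hf s _))

/-- The embedding of `X^{s,b,2}` for `b > 1 / 2` into the functions that are summable in the
modulation. -/
theorem IsCutoff.exists_rep_two (hχ : IsCutoff χ) (s : ℝ) {b : ℝ} (hb : 1 / 2 < b) :
    ∃ C : ℝ≥0∞, C < ∞ ∧ ∀ u, MemX χ s b 2 u → ∃ g, Rep s u g ∧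
      ∑' l, modNorm s (1 / 2) g l ≤ C * xNorm χ s b 2 u := by
  obtain ⟨C, hC, h⟩ := hχ.exists_tsum_modNorm_half_le s hb
  refine ⟨C, hC, fun u hu => ?_⟩
  obtain ⟨g, hg, hf⟩ := hu.exists_isFunction
  exact ⟨g, Rep.of_memX hχ (by linarith) hg hf hu,
    (h g hg).trans (mul_le_mul' le_rfl (s2_fnorm_le_xNorm hf s _))⟩

theorem IsCutoff.s2_modNorm_le (hχ : IsCutoff χ) (s : ℝ) {u : 𝓢'(Plane, ℂ)} {g : Plane → ℂ}
    (hg : Measurable g) (hf : IsFunction (𝓕 u) g) :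
    s2 (modNorm s (1 / 2) g) ≤ (3 * cmpConst s (1 / 2)) ^ (1 / 2 : ℝ) * xNorm χ s (1 / 2) 2 u := by
  calc _ ≤ (3 * cmpConst s (1 / 2) * ∑' x : ℕ × ℕ, fnorm χ s (1 / 2) g x.1 x.2 ^ 2) ^ (1 / 2 : ℝ) :=
        ENNReal.rpow_le_rpow (hχ.tsum_modNorm_sq_le s _ hg) (by norm_num)
    _ = (3 * cmpConst s (1 / 2)) ^ (1 / 2 : ℝ) * s2 fun x : ℕ × ℕ => fnorm χ s (1 / 2) g x.1 x.2 := by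
        rw [ENNReal.mul_rpow_of_nonneg _ _ (by norm_num), s2]
    _ ≤ _ := mul_le_mul' le_rfl (s2_fnorm_le_xNorm hf s _)

theorem sqrt_cmpConst_lt_top (s : ℝ) : (3 * cmpConst s (1 / 2)) ^ (1 / 2 : ℝ) < ∞ :=
  ENNReal.rpow_lt_top_of_nonneg (by norm_num)
    (ENNReal.mul_ne_top (by norm_num) (cmpConst_ne_top _ _))

/-- The bounds for the remainder with both factors summable in the modulation. -/
theorem IsCutoff.exists_derivRemainder_le (hχ : IsCutoff χ) {s s' : ℝ} (h : -(1 / 2) ≤ s + s') :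
    ∃ C : ℝ≥0∞, C < ∞ ∧ ∀ (pos : Bool) (u v : 𝓢'(Plane, ℂ)) (gu gv : Plane → ℂ),
      Rep s u gu → Rep s' v gv →
      ∑' l, modNorm s (1 / 2) gu l < ∞ → ∑' l, modNorm s' (1 / 2) gv l < ∞ →
      ∃ w, IsDerivRemainder χ (sgn pos) v u w ∧ xNorm χ (s + s') (-(1 / 2)) 1 w ≤
        C * (∑' l, modNorm s' (1 / 2) gv l) * ∑' l, modNorm s (1 / 2) gu l := by
  obtain ⟨K, C₁, hC₁, h₁⟩ := hχ.exists_derivRemainder (s + s')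
  obtain ⟨c, hc⟩ := exists_remWeight K h
  obtain ⟨C₂, hC₂, h₂⟩ := total_remainder_le c
  refine ⟨C₁ * (8 * C₂), ENNReal.mul_lt_top hC₁ (ENNReal.mul_lt_top (by norm_num) hC₂),
    fun pos u v gu gv hu hv hfu hfv => ?_⟩
  have key : outNorm (s + s') (bconv pos (remMul K) (half pos gv) (half true gu)) ≤
      8 * C₂ * (∑' l, modNorm s' (1 / 2) gv l) * ∑' l, modNorm s (1 / 2) gu l := by
    refine (outNorm_bconv_le pos _ hu.meas hv.meas _ s s').trans ?_
    rw [mul_assoc, mul_assoc, ← mul_assoc C₂]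
    refine mul_le_mul' le_rfl ((h₂ pos _ hc _ _).trans ?_)
    exact mul_le_mul' (mul_le_mul' le_rfl (ENNReal.tsum_le_tsum fun l =>
      s2_blkNorm_le_half pos gv s' l)) (ENNReal.tsum_le_tsum fun l => s2_blkNorm_le_half true gu s l)
  obtain ⟨w, hw, hw'⟩ := h₁ pos s s' u v gu gv hu hv (key.trans_lt (ENNReal.mul_lt_top
    (ENNReal.mul_lt_top (ENNReal.mul_lt_top (by norm_num) hC₂) hfv) hfu))
  refine ⟨w, hw, hw'.trans ((mul_le_mul' le_rfl key).trans (le_of_eq ?_))⟩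
  ring

/-- The bounds for the remainder with `v` square summable in the modulation. -/
theorem IsCutoff.exists_derivRemainder_l2_le (hχ : IsCutoff χ) :
    ∃ C : ℝ≥0∞, C < ∞ ∧ ∀ (pos : Bool) (u v : 𝓢'(Plane, ℂ)) (gu gv : Plane → ℂ),
      Rep (-(1 / 2)) u gu → Rep 0 v gv → ∑' l, modNorm (-(1 / 2)) (1 / 2) gu l < ∞ →
      s2 (modNorm 0 (1 / 2) gv) + ∑' l, modNorm 0 (1 / 4) gv l < ∞ →
      ∃ w, IsDerivRemainder χ (sgn pos) v u w ∧ xNorm χ (-(1 / 2)) (-(1 / 2)) 1 w ≤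
        C * (s2 (modNorm 0 (1 / 2) gv) + ∑' l, modNorm 0 (1 / 4) gv l) *
          ∑' l, modNorm (-(1 / 2)) (1 / 2) gu l := by
  obtain ⟨K, C₁, hC₁, h₁⟩ := hχ.exists_derivRemainder (-(1 / 2))
  obtain ⟨c, hc⟩ := exists_remWeight K (s := -(1 / 2)) (s' := 0) (by norm_num)
  rw [add_zero] at hc
  obtain ⟨C₂, hC₂, h₂⟩ := total_remainder_l2_le c
  refine ⟨C₁ * (8 * C₂), ENNReal.mul_lt_top hC₁ (ENNReal.mul_lt_top (by norm_num) hC₂),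
    fun pos u v gu gv hu hv hfu hfv => ?_⟩
  have key : outNorm (-(1 / 2)) (bconv pos (remMul K) (half pos gv) (half true gu)) ≤
      8 * C₂ * (s2 (modNorm 0 (1 / 2) gv) + ∑' l, modNorm 0 (1 / 4) gv l) *
        ∑' l, modNorm (-(1 / 2)) (1 / 2) gu l := by
    refine (outNorm_bconv_le pos _ hu.meas hv.meas _ (-(1 / 2)) 0).trans ?_
    rw [mul_assoc, mul_assoc, ← mul_assoc C₂]
    refine mul_le_mul' le_rfl ((h₂ pos _ hc _ _).trans ?_)
    refine mul_le_mul' (mul_le_mul' le_rfl (add_le_add (s2_blkNorm_prod_le pos gv 0)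
      (ENNReal.tsum_le_tsum fun l => ?_)))
      (ENNReal.tsum_le_tsum fun l => s2_blkNorm_le_half true gu _ l)
    refine le_trans (le_of_eq ?_) (s2_blkNorm_le pos gv 0 (1 / 4) l)
    congr 2; ring
  obtain ⟨w, hw, hw'⟩ := h₁ pos _ _ u v gu gv hu hv (key.trans_lt (ENNReal.mul_lt_top
    (ENNReal.mul_lt_top (ENNReal.mul_lt_top (by norm_num) hC₂) hfv) hfu))
  refine ⟨w, hw, hw'.trans ((mul_le_mul' le_rfl key).trans (le_of_eq ?_))⟩
  ring

/-- The bounds for the paraproduct with both factors summable in the modulation. -/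
theorem IsCutoff.exists_paraproduct_le (hχ : IsCutoff χ) {s s' : ℝ} (h : s' + 1 / 2 ≤ 0) :
    ∃ C : ℝ≥0∞, C < ∞ ∧ ∀ (pos : Bool) (u v : 𝓢'(Plane, ℂ)) (gu gv : Plane → ℂ),
      Rep s u gu → Rep s' v gv →
      ∑' l, modNorm s (1 / 2) gu l < ∞ → ∑' l, modNorm s' (1 / 2) gv l < ∞ →
      ∃ w, IsParaproduct χ (sgn pos) v u w ∧ xNorm χ (s + s' + 1) (-(1 / 2)) 1 w ≤
        C * (∑' l, modNorm s' (1 / 2) gv l) * ∑' l, modNorm s (1 / 2) gu l := by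
  obtain ⟨P, hP⟩ := exists_nat_ge (|s + s' + 1| + 10)
  obtain ⟨K, C₁, hC₁, h₁⟩ := hχ.exists_paraproduct P (s + s' + 1)
  obtain ⟨c, hc⟩ := exists_paraWeight K h hP
  obtain ⟨C₂, hC₂, h₂⟩ := total_paraproduct_le c
  refine ⟨C₁ * (8 * C₂), ENNReal.mul_lt_top hC₁ (ENNReal.mul_lt_top (by norm_num) hC₂),
    fun pos u v gu gv hu hv hfu hfv => ?_⟩
  have key : outNorm (s + s' + 1) (bconv pos (paraMul K P) (half pos gv) (half true gu)) ≤
      8 * C₂ * (∑' l, modNorm s' (1 / 2) gv l) * ∑' l, modNorm s (1 / 2) gu l := by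
    refine (outNorm_bconv_le pos _ hu.meas hv.meas _ s s').trans ?_
    rw [mul_assoc, mul_assoc, ← mul_assoc C₂]
    refine mul_le_mul' le_rfl ((h₂ pos _ hc _ _).trans ?_)
    exact mul_le_mul' (mul_le_mul' le_rfl (ENNReal.tsum_le_tsum fun l =>
      s2_blkNorm_le_half pos gv s' l)) (ENNReal.tsum_le_tsum fun l => s2_blkNorm_le_half true gu s l)
  obtain ⟨w, hw, hw'⟩ := h₁ pos s s' u v gu gv hu hv (key.trans_lt (ENNReal.mul_lt_top
    (ENNReal.mul_lt_top (ENNReal.mul_lt_top (by norm_num) hC₂) hfv) hfu))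
  refine ⟨w, hw, hw'.trans ((mul_le_mul' le_rfl key).trans (le_of_eq ?_))⟩
  ring

/-- The bounds for the paraproduct with both factors square summable in the modulation. -/
theorem IsCutoff.exists_paraproduct_l2_le (hχ : IsCutoff χ) (s : ℝ) :
    ∃ C : ℝ≥0∞, C < ∞ ∧ ∀ (pos : Bool) (u v : 𝓢'(Plane, ℂ)) (gu gv : Plane → ℂ),
      Rep s u gu → Rep (-1) v gv →
      s2 (modNorm s (1 / 2) gu) < ∞ → s2 (modNorm (-1) (1 / 2) gv) < ∞ →
      ∃ w, IsParaproduct χ (sgn pos) v u w ∧ xNorm χ s (-(1 / 2)) 1 w ≤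
        C * s2 (modNorm (-1) (1 / 2) gv) * s2 (modNorm s (1 / 2) gu) := by
  obtain ⟨P, hP⟩ := exists_nat_ge (|s| + 10)
  obtain ⟨K, C₁, hC₁, h₁⟩ := hχ.exists_paraproduct P s
  obtain ⟨c, hc⟩ := exists_paraWeight' K hP
  obtain ⟨C₂, hC₂, h₂⟩ := total_paraproduct_l2_le c
  refine ⟨C₁ * (8 * C₂), ENNReal.mul_lt_top hC₁ (ENNReal.mul_lt_top (by norm_num) hC₂),
    fun pos u v gu gv hu hv hfu hfv => ?_⟩
  have key : outNorm s (bconv pos (paraMul K P) (half pos gv) (half true gu)) ≤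
      8 * C₂ * s2 (modNorm (-1) (1 / 2) gv) * s2 (modNorm s (1 / 2) gu) := by
    refine (outNorm_bconv_le pos _ hu.meas hv.meas _ s (-1)).trans ?_
    rw [mul_assoc, mul_assoc, ← mul_assoc C₂]
    refine mul_le_mul' le_rfl ((h₂ pos _ hc _ _).trans ?_)
    exact mul_le_mul' (mul_le_mul' le_rfl (s2_blkNorm_prod_le pos gv (-1)))
      (s2_blkNorm_prod_le true gu s)
  obtain ⟨w, hw, hw'⟩ := h₁ pos _ _ u v gu gv hu hv (key.trans_lt (ENNReal.mul_lt_top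
    (ENNReal.mul_lt_top (ENNReal.mul_lt_top (by norm_num) hC₂) hfv) hfu))
  refine ⟨w, hw, hw'.trans ((mul_le_mul' le_rfl key).trans (le_of_eq ?_))⟩
  ring

theorem isFunction_zero : IsFunction (𝓕 (0 : 𝓢'(Plane, ℂ))) fun _ => 0 := by
  have h : 𝓕 (0 : 𝓢'(Plane, ℂ)) = 0 := by
    ext f
    rw [TemperedDistribution.fourier_apply]
    rfl
  rw [h]
  exact ⟨locallyIntegrable_zero, fun f => ⟨by simp, by simp⟩⟩

theorem xNorm_two_zero (s b : ℝ) : xNorm χ s b 2 0 = 0 := by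
  rw [← nonpos_iff_eq_zero]
  refine (xNorm_two_le_one s b 0).trans ((xNorm_one_le measurable_const isFunction_zero s b).trans ?_)
  simp [fnorm, l2]

/-- Absorbing the constants of the bounds for the factors. -/
theorem mul_le_mul_const {C A B a b x y : ℝ≥0∞} (hx : x ≤ A * a) (hy : y ≤ B * b) :
    C * x * y ≤ C * A * B * a * b := by
  calc C * x * y ≤ C * (A * a) * (B * b) := by gcongr
    _ = _ := by ring

/-- The norm of `X^{s,1/2,2}` controls the sharp norms, square summed over the modulation. -/
theorem IsCutoff.exists_rep_l2 (hχ : IsCutoff χ) (s : ℝ) : ∃ C : ℝ≥0∞, C < ∞ ∧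
    ∀ u, MemX χ s (1 / 2) 2 u → ∃ g, Rep s u g ∧
      s2 (modNorm s (1 / 2) g) ≤ C * xNorm χ s (1 / 2) 2 u := by
  refine ⟨_, sqrt_cmpConst_lt_top s, fun u hu => ?_⟩
  obtain ⟨g, hg, hf⟩ := hu.exists_isFunction
  exact ⟨g, Rep.of_memX hχ (by norm_num) hg hf hu, hχ.s2_modNorm_le s hg hf⟩

/-- The sharp norms on the intersection `X^{0,1/2,2} ∩ X^{0,1/4,1}`. -/
theorem IsCutoff.exists_modNorm_inter_le (hχ : IsCutoff χ) : ∃ C : ℝ≥0∞, C < ∞ ∧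
    ∀ v, MemX χ 0 (1 / 2) 2 v → ∃ g, Rep 0 v g ∧
      s2 (modNorm 0 (1 / 2) g) + ∑' l, modNorm 0 (1 / 4) g l ≤
        C * (xNorm χ 0 (1 / 2) 2 v + xNorm χ 0 (1 / 4) 1 v) := by
  refine ⟨(3 * cmpConst 0 (1 / 2)) ^ (1 / 2 : ℝ) + 3 * cmpConst 0 (1 / 4) ^ (1 / 2 : ℝ),
    ENNReal.add_lt_top.2 ⟨sqrt_cmpConst_lt_top 0, ENNReal.mul_lt_top (by norm_num)
      (ENNReal.rpow_lt_top_of_nonneg (by norm_num) (cmpConst_ne_top _ _))⟩, fun v hv => ?_⟩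
  obtain ⟨g, hg, hf⟩ := hv.exists_isFunction
  refine ⟨g, Rep.of_memX hχ (by norm_num) hg hf hv, ?_⟩
  have h1 := hχ.s2_modNorm_le 0 hg hf
  have h2 := (hχ.tsum_modNorm_le 0 (1 / 4) hg).trans
    (mul_le_mul' le_rfl (tsum_fnorm_le_xNorm (χ := χ) hf 0 (1 / 4)))
  refine (add_le_add h1 h2).trans ?_
  rw [mul_add]
  gcongr
  · exact le_self_add
  · exact le_add_self

end BenjaminOno

theorem propositionA (χ : 𝓢(ℝ, ℂ)) (hχ : BenjaminOno.IsCutoff χ) (ε : ℝ) (hε : ε = 1 ∨ ε = -1) :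
    -- remainder, `b = 1/2`, `q = 1`
    (∀ s s' : ℝ, -(1 / 2) ≤ s + s' → ∃ C : ℝ≥0, ∀ u v : 𝓢'(BenjaminOno.Plane, ℂ),
      BenjaminOno.MemX χ s (1 / 2) 1 u → BenjaminOno.MemX χ s' (1 / 2) 1 v →
      ∃ w, BenjaminOno.IsDerivRemainder χ ε v u w ∧
        BenjaminOno.xNorm χ (s + s') (-(1 / 2)) 1 w ≤
          C * BenjaminOno.xNorm χ s' (1 / 2) 1 v * BenjaminOno.xNorm χ s (1 / 2) 1 u) ∧
    -- remainder, `s' = 0`, `s > 1/4`, `b > 1/2`, `q = 2`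
    (∀ s b : ℝ, 1 / 4 < s → 1 / 2 < b → ∃ C : ℝ≥0, ∀ u v : 𝓢'(BenjaminOno.Plane, ℂ),
      BenjaminOno.MemX χ s b 2 u → BenjaminOno.MemX χ 0 (1 / 2) 1 v →
      ∃ w, BenjaminOno.IsDerivRemainder χ ε v u w ∧
        ∃ w₁ w₂, w = w₁ + w₂ ∧
          BenjaminOno.xNorm χ s (b - 1) 2 w₁ + BenjaminOno.xNorm χ s (-(1 / 2)) 1 w₂ ≤
            C * BenjaminOno.xNorm χ 0 (1 / 2) 1 v * BenjaminOno.xNorm χ s b 2 u) ∧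
    -- paraproduct, `b = 1/2`, `q = 1`
    (∀ s s' : ℝ, s' + 1 / 2 ≤ 0 → ∃ C : ℝ≥0, ∀ u v : 𝓢'(BenjaminOno.Plane, ℂ),
      BenjaminOno.MemX χ s (1 / 2) 1 u → BenjaminOno.MemX χ s' (1 / 2) 1 v →
      ∃ w, BenjaminOno.IsParaproduct χ ε v u w ∧
        BenjaminOno.xNorm χ (s + s' + 1) (-(1 / 2)) 1 w ≤
          C * BenjaminOno.xNorm χ s' (1 / 2) 1 v * BenjaminOno.xNorm χ s (1 / 2) 1 u) ∧
    -- paraproduct, `b > 1/2`, `q = 2`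
    (∀ s s' b : ℝ, s' + 1 / 2 ≤ 0 → 1 / 2 < b → ∃ C : ℝ≥0, ∀ u v : 𝓢'(BenjaminOno.Plane, ℂ),
      BenjaminOno.MemX χ s b 2 u → BenjaminOno.MemX χ s' (1 / 2) 1 v →
      ∃ w, BenjaminOno.IsParaproduct χ ε v u w ∧
        ∃ w₁ w₂, w = w₁ + w₂ ∧
          BenjaminOno.xNorm χ (s + s' + 1) (b - 1) 2 w₁ +
              BenjaminOno.xNorm χ (s + s' + 1) (-(1 / 2)) 1 w₂ ≤
            C * BenjaminOno.xNorm χ s' (1 / 2) 1 v * BenjaminOno.xNorm χ s b 2 u) ∧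
    -- paraproduct, refinement with `q = 2` for both factors
    (∀ s : ℝ, ∃ C : ℝ≥0, ∀ u v : 𝓢'(BenjaminOno.Plane, ℂ),
      BenjaminOno.MemX χ s (1 / 2) 2 u → BenjaminOno.MemX χ (-1) (1 / 2) 2 v →
      ∃ w, BenjaminOno.IsParaproduct χ ε v u w ∧
        BenjaminOno.xNorm χ s (-(1 / 2)) 1 w ≤
          C * BenjaminOno.xNorm χ (-1) (1 / 2) 2 v * BenjaminOno.xNorm χ s (1 / 2) 2 u) ∧
    -- remainder, refinement with `v` in an intersection of two spaces
    (∃ C : ℝ≥0, ∀ u v : 𝓢'(BenjaminOno.Plane, ℂ),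
      BenjaminOno.MemX χ (-(1 / 2)) (1 / 2) 1 u →
      BenjaminOno.MemX χ 0 (1 / 2) 2 v → BenjaminOno.MemX χ 0 (1 / 4) 1 v →
      ∃ w, BenjaminOno.IsDerivRemainder χ ε v u w ∧
        BenjaminOno.xNorm χ (-(1 / 2)) (-(1 / 2)) 1 w ≤
          C * (BenjaminOno.xNorm χ 0 (1 / 2) 2 v + BenjaminOno.xNorm χ 0 (1 / 4) 1 v) *
            BenjaminOno.xNorm χ (-(1 / 2)) (1 / 2) 1 u) := by
  obtain ⟨pos, rfl⟩ : ∃ pos, ε = BenjaminOno.sgn pos := by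
    rcases hε with rfl | rfl
    · exact ⟨true, by simp [BenjaminOno.sgn]⟩
    · exact ⟨false, by simp [BenjaminOno.sgn]⟩
  refine ⟨fun s s' h => ?_, fun s b hs hb => ?_, fun s s' h => ?_, fun s s' b h hb => ?_,
    fun s => ?_, ?_⟩
  · obtain ⟨C, hC, hmain⟩ := hχ.exists_derivRemainder_le h
    obtain ⟨A, hA, hu'⟩ := hχ.exists_rep_one s
    obtain ⟨B, hB, hv'⟩ := hχ.exists_rep_one s'
    lift C to ℝ≥0 using hC.ne
    lift A to ℝ≥0 using hA.ne
    lift B to ℝ≥0 using hB.ne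
    refine ⟨C * B * A, fun u v hu hv => ?_⟩
    obtain ⟨gu, ru, nu⟩ := hu' u hu
    obtain ⟨gv, rv, nv⟩ := hv' v hv
    obtain ⟨w, hw, hle⟩ := hmain pos u v gu gv ru rv
      (nu.trans_lt (ENNReal.mul_lt_top ENNReal.coe_lt_top hu))
      (nv.trans_lt (ENNReal.mul_lt_top ENNReal.coe_lt_top hv))
    refine ⟨w, hw, hle.trans ?_⟩
    push_cast
    exact BenjaminOno.mul_le_mul_const nv nu
  · obtain ⟨C, hC, hmain⟩ := hχ.exists_derivRemainder_le (s := s) (s' := 0) (by linarith)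
    obtain ⟨A, hA, hu'⟩ := hχ.exists_rep_two s hb
    obtain ⟨B, hB, hv'⟩ := hχ.exists_rep_one 0
    lift C to ℝ≥0 using hC.ne
    lift A to ℝ≥0 using hA.ne
    lift B to ℝ≥0 using hB.ne
    refine ⟨C * B * A, fun u v hu hv => ?_⟩
    obtain ⟨gu, ru, nu⟩ := hu' u hu
    obtain ⟨gv, rv, nv⟩ := hv' v hv
    obtain ⟨w, hw, hle⟩ := hmain pos u v gu gv ru rv
      (nu.trans_lt (ENNReal.mul_lt_top ENNReal.coe_lt_top hu))
      (nv.trans_lt (ENNReal.mul_lt_top ENNReal.coe_lt_top hv))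
    -- the whole output lies in the second space of the sum
    refine ⟨w, hw, 0, w, (zero_add w).symm, ?_⟩
    rw [BenjaminOno.xNorm_two_zero, zero_add]
    rw [add_zero] at hle
    refine hle.trans ?_
    push_cast
    exact BenjaminOno.mul_le_mul_const nv nu
  · obtain ⟨C, hC, hmain⟩ := hχ.exists_paraproduct_le (s := s) h
    obtain ⟨A, hA, hu'⟩ := hχ.exists_rep_one s
    obtain ⟨B, hB, hv'⟩ := hχ.exists_rep_one s'
    lift C to ℝ≥0 using hC.ne
    lift A to ℝ≥0 using hA.ne
    lift B to ℝ≥0 using hB.ne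
    refine ⟨C * B * A, fun u v hu hv => ?_⟩
    obtain ⟨gu, ru, nu⟩ := hu' u hu
    obtain ⟨gv, rv, nv⟩ := hv' v hv
    obtain ⟨w, hw, hle⟩ := hmain pos u v gu gv ru rv
      (nu.trans_lt (ENNReal.mul_lt_top ENNReal.coe_lt_top hu))
      (nv.trans_lt (ENNReal.mul_lt_top ENNReal.coe_lt_top hv))
    refine ⟨w, hw, hle.trans ?_⟩
    push_cast
    exact BenjaminOno.mul_le_mul_const nv nu
  · obtain ⟨C, hC, hmain⟩ := hχ.exists_paraproduct_le (s := s) h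
    obtain ⟨A, hA, hu'⟩ := hχ.exists_rep_two s hb
    obtain ⟨B, hB, hv'⟩ := hχ.exists_rep_one s'
    lift C to ℝ≥0 using hC.ne
    lift A to ℝ≥0 using hA.ne
    lift B to ℝ≥0 using hB.ne
    refine ⟨C * B * A, fun u v hu hv => ?_⟩
    obtain ⟨gu, ru, nu⟩ := hu' u hu
    obtain ⟨gv, rv, nv⟩ := hv' v hv
    obtain ⟨w, hw, hle⟩ := hmain pos u v gu gv ru rv
      (nu.trans_lt (ENNReal.mul_lt_top ENNReal.coe_lt_top hu))
      (nv.trans_lt (ENNReal.mul_lt_top ENNReal.coe_lt_top hv))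
    -- the whole output lies in the second space of the sum
    refine ⟨w, hw, 0, w, (zero_add w).symm, ?_⟩
    rw [BenjaminOno.xNorm_two_zero, zero_add]
    refine hle.trans ?_
    push_cast
    exact BenjaminOno.mul_le_mul_const nv nu
  · obtain ⟨C, hC, hmain⟩ := hχ.exists_paraproduct_l2_le s
    obtain ⟨A, hA, hu'⟩ := hχ.exists_rep_l2 s
    obtain ⟨B, hB, hv'⟩ := hχ.exists_rep_l2 (-1)
    lift C to ℝ≥0 using hC.ne
    lift A to ℝ≥0 using hA.ne
    lift B to ℝ≥0 using hB.ne
    refine ⟨C * B * A, fun u v hu hv => ?_⟩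
    obtain ⟨gu, ru, nu⟩ := hu' u hu
    obtain ⟨gv, rv, nv⟩ := hv' v hv
    obtain ⟨w, hw, hle⟩ := hmain pos u v gu gv ru rv
      (nu.trans_lt (ENNReal.mul_lt_top ENNReal.coe_lt_top hu))
      (nv.trans_lt (ENNReal.mul_lt_top ENNReal.coe_lt_top hv))
    refine ⟨w, hw, hle.trans ?_⟩
    push_cast
    exact BenjaminOno.mul_le_mul_const nv nu
  · obtain ⟨C, hC, hmain⟩ := hχ.exists_derivRemainder_l2_le
    obtain ⟨A, hA, hu'⟩ := hχ.exists_rep_one (-(1 / 2))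
    obtain ⟨B, hB, hv'⟩ := hχ.exists_modNorm_inter_le
    lift C to ℝ≥0 using hC.ne
    lift A to ℝ≥0 using hA.ne
    lift B to ℝ≥0 using hB.ne
    refine ⟨C * B * A, fun u v hu hv hv₂ => ?_⟩
    obtain ⟨gu, ru, nu⟩ := hu' u hu
    obtain ⟨gv, rv, nv⟩ := hv' v hv
    obtain ⟨w, hw, hle⟩ := hmain pos u v gu gv ru rv
      (nu.trans_lt (ENNReal.mul_lt_top ENNReal.coe_lt_top hu))
      (nv.trans_lt (ENNReal.mul_lt_top ENNReal.coe_lt_top (ENNReal.add_lt_top.2 ⟨hv, hv₂⟩)))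
    refine ⟨w, hw, hle.trans ?_⟩
    push_cast
    exact BenjaminOno.mul_le_mul_const nv nu
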